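/- Let $k$ be a field and $A$ a commutative $k$-algebra; unadorned $\otimes$ is over $k$, and all rings are $k$-algebras. **Conventions.** An *$A$-ring* is a ring $R$ with a ring map $A\to R$ (whose image need not be central); $R^*=\mathrm{Hom}_{-A}(R,A)$ is its right dual. An *$A$-coring* is an $A$-bimodule $C$ (with $k$ acting centrally) with a coassociative, counital pair of bimodule maps $\Delta:C\to C\otimes_AC$, $x\mapsto x_1\otimes x_2$, and $\varepsilon:C\to A$. Its left convolution ring ${}^*C=\mathrm{Hom}_{A-}(C,A)$ has product $(f*g)(x)=g(x_1f(x_2))$, unit $\varepsilon$, and is an $A$-ring with $(afb)(x)=f(xa)b$. This gives a functor ${}^*(-):\mathrm{Corings}_A^{op}\to\mathrm{Rings}_A$. For an $A$-ring $R$ and an $A$-coring $C$, a map $f:C\to R^*$ is said to satisfy $(\zeta)$ if, for $z\in C$, $x,y,u\in R$, $a,b\in A$, $$f(z)(xy)=f(z_1)\big(f(z_2)(x)\,y\big),\qquad f(z)(1)=\varepsilon(z),\qquad f(azb)(u)=a\,f(z)(bu).$$ A *commutative Hopf algebroid* over $A$ is a commutative $k$-algebra $\mathcal H$ with algebra maps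 $s,t:A\to\mathcal H$ (write $\eta(a\otimes b)=s(a)t(b)$ for the resulting $A\otimes A$-algebra structure, and $axb=s(a)xt(b)$), an $A$-coring structure on this bimodule for which $\Delta,\varepsilon$ are algebra maps, and an algebra map $\mathcal S:\mathcal H\to\mathcal H$ with $\mathcal S s=t$, $\mathcal S t=s$, $\mathcal S^2=\mathrm{id}$, $\mathcal S(x_1)x_2=t\varepsilon(x)$, $x_1\mathcal S(x_2)=s\varepsilon(x)$. Morphisms are the maps of $A$-corings that are algebra maps commuting with $\mathcal S$; the category is $\mathrm{CHAlgd}_A$. A (right) *cocommutative Hopf algebroid* over $A$ is an $A$-ring $\mathcal U$ with a right $A$-linear map $\varepsilon:\mathcal U\to A$ such that $\varepsilon(1)=1$, $\varepsilon(uv)=\varepsilon(\varepsilon(u)v)$, and an $A$-ring map $\Delta:\mathcal U\to\mathcal U\times_A\mathcal U$, $u\mapsto u_1\otimes u_2$, into the ring $\mathcal U\times_A\mathcal U=\{\sum u_i\otimes v_i\in\mathcal U_A\otimes_A\mathcal U_A:\ \sum au_i\otimes v_i=\sum u_i\otimes av_i\ \forall a\in A\}$ with product $(u\otimes v)(u'\otimes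 v')=uu'\otimes vv'$ and the $A$-ring structure $a\mapsto a\otimes1$, such that $\Delta$ is coassociative, cocommutative and has counit $\varepsilon$, and such that $\beta:\mathcal U_A\otimes_A{}_A\mathcal U\to\mathcal U_A\otimes_A\mathcal U_A$, $u\otimes v\mapsto uv_1\otimes v_2$, is bijective. Write $u_-\otimes u_+=\beta^{-1}(1\otimes u)$. Morphisms are the $A$-ring maps compatible with $\varepsilon$ and $\Delta$; the category is $\mathrm{CCHAlgd}_A$. The right dual $\mathcal U^*$ is an $A\otimes A$-algebra with the convolution product $(f*g)(u)=f(u_1)g(u_2)$ and the unit $a\otimes b\mapsto[u\mapsto\varepsilon(bu)a]$. **Theorem.** The functor ${}^*(-):\mathrm{Corings}_A^{op}\to\mathrm{Rings}_A$ has a left adjoint $(-)^\bullet$. For such a left adjoint, let $\xi:R^\bullet\to R^*$ be the map obtained from the unit $j:R\to{}^*(R^\bullet)$ of the adjunction, $\xi(z)(r)=j(r)(z)$. 1. The functor $(-)^\bullet$ induces a contravariant functor $\mathrm{CCHAlgd}_A\to\mathrm{CHAlgd}_A$: its values have the $\mathcal U^\bullet$ as underlying corings, and on morphisms it agrees with $(-)^\bullet$.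 For every $\mathcal U$ in $\mathrm{CCHAlgd}_A$, the map $\xi:\mathcal U^\bullet\to\mathcal U^*$ satisfies $(\zeta)$, and the commutative Hopf algebroid structure of the coring $\mathcal U^\bullet$ is the unique one for which $$\xi(\eta(a\otimes b))(u)=\varepsilon(bu)a,\qquad \xi(xy)(u)=\xi(x)(u_1)\,\xi(y)(u_2),\qquad \xi(\mathcal S(x))(u)=\varepsilon\big(\xi(x)(u_-)\,u_+\big).$$ 2. Universal property: if $\mathcal H$ is a commutative Hopf algebroid over $A$ and $f:\mathcal H\to\mathcal U^*$ is a map of $A\otimes A$-algebras satisfying $(\zeta)$, then there is a morphism of commutative Hopf algebroids $\hat f:\mathcal H\to\mathcal U^\bullet$ with $\xi\circ\hat f=f$, and $\hat f$ is the only map of $A$-corings with this property. 3. Let $\mathcal U^\circ$ be the quotient of $\bigoplus_PP^*\otimes P$, where $P$ runs over (a small skeleton of) the right $\mathcal U$-modules that are finitely generated and projective over $A$ and $P^*=\mathrm{Hom}_A(P,A)$, by the span of the elements $\psi\otimes tp-\psi t\otimes p$ for $\mathcal U$-linear $t:P\to Q$, $p\in P$, $\psi\in Q^*$. It is a commutative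 Hopf algebroid, with $a(\varphi\otimes p)b=a\varphi\otimes pb$, $\varepsilon(\varphi\otimes p)=\varphi(p)$, $\Delta(\varphi\otimes p)=\sum_i(\varphi\otimes e_i)\otimes_A(e_i^*\otimes p)$ for any dual basis $(e_i,e_i^*)$ of $P$, with unit $\mathrm{id}_A\otimes1$ at $P=A$ (with action $a\cdot u=\varepsilon(au)$), product $(\varphi\otimes p)(\psi\otimes q)=(\varphi\otimes\psi)\otimes(p\otimes q)$ at $P\otimes_AQ$ (with action $(p\otimes q)u=pu_1\otimes qu_2$), and $\mathcal S(\varphi\otimes p)=\mathrm{ev}_p\otimes\varphi$ at $P^*$ (with action $(\varphi u)(p)=\varepsilon(\varphi(pu_-)u_+)$). The map $\zeta:\mathcal U^\circ\to\mathcal U^*$, $\zeta(\varphi\otimes p)(u)=\varphi(pu)$, is a map of $A\otimes A$-algebras satisfying $(\zeta)$. Hence there is a morphism of commutative Hopf algebroids $\hat\zeta:\mathcal U^\circ\to\mathcal U^\bullet$ with $\xi\circ\hat\zeta=\zeta$, and it is the only map of $A$-corings with this property. It is an isomorphism if $A$ is a field, and also if the right $A$-module $\mathcal U_A$ is finitely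 generated and projective. -/

import Mathlib

open CategoryTheory TensorProduct Opposite

universe u

noncomputable section

namespace HAlgd

/-! ## Actions of a commutative algebra and tensor products over it -/

/-- An action of the commutative `k`-algebra `A` on the `k`-module `M` by `k`-linear maps.
As `A` is commutative, left and right actions are the same kind of data. -/
abbrev Act (k A M : Type*) [Field k] [CommRing A] [Algebra k A] [AddCommGroup M] [Module k M] :=
  A →ₐ[k] Module.End k M

section Balanced

variable {k A M N P M' N' M'' N'' : Type*} [Field k] [CommRing A] [Algebra k A]
variable [AddCommGroup M] [Module k M] [AddCommGroup N] [Module k N]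
variable [AddCommGroup P] [Module k P] [AddCommGroup M'] [Module k M']
variable [AddCommGroup N'] [Module k N'] [AddCommGroup M''] [Module k M'']
variable [AddCommGroup N''] [Module k N'']

/-- The `k`-span of the elements `m a ⊗ n - m ⊗ a n`, where `A` acts on `M` through `ρ` and on
`N` through `σ`. -/
def balRel (ρ : Act k A M) (σ : Act k A N) : Submodule k (M ⊗[k] N) :=
  Submodule.span k {z | ∃ a m n, z = ρ a m ⊗ₜ[k] n - m ⊗ₜ[k] σ a n}

/-- The tensor product `M ⊗_A N`, where `A` acts on `M` through `ρ` and on `N` through `σ`. -/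
abbrev Bal (ρ : Act k A M) (σ : Act k A N) := (M ⊗[k] N) ⧸ balRel ρ σ

/-- The class `m ⊗_A n`. -/
def bt (ρ : Act k A M) (σ : Act k A N) (m : M) (n : N) : Bal ρ σ :=
  (balRel ρ σ).mkQ (m ⊗ₜ[k] n)

theorem bt_bal (ρ : Act k A M) (σ : Act k A N) (a : A) (m : M) (n : N) :
    bt ρ σ (ρ a m) n = bt ρ σ m (σ a n) := by
  unfold bt
  rw [← sub_eq_zero, ← map_sub]
  exact (Submodule.Quotient.mk_eq_zero _).2 (Submodule.subset_span ⟨a, m, n, rfl⟩)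

/-- The bilinear map `f` is `A`-balanced. -/
structure IsBal (ρ : Act k A M) (σ : Act k A N) (f : M →ₗ[k] N →ₗ[k] P) : Prop where
  bal : ∀ a m n, f (ρ a m) n = f m (σ a n)

/-- The map `f` is `A`-linear. -/
structure IsALin (ρ : Act k A M) (ρ' : Act k A M') (f : M →ₗ[k] M') : Prop where
  lin : ∀ a m, f (ρ a m) = ρ' a (f m)

/-- The map out of `M ⊗_A N` induced by a balanced bilinear map. -/
def Bal.lift {ρ : Act k A M} {σ : Act k A N} (f : M →ₗ[k] N →ₗ[k] P)
    (h : IsBal ρ σ f) : Bal ρ σ →ₗ[k] P :=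
  (balRel ρ σ).liftQ (TensorProduct.lift f) (by
    rw [balRel, Submodule.span_le]
    rintro _ ⟨a, m, n, rfl⟩
    simp [h.bal])

@[simp] theorem Bal.lift_bt {ρ : Act k A M} {σ : Act k A N} (f : M →ₗ[k] N →ₗ[k] P)
    (h : IsBal ρ σ f) (m : M) (n : N) :
    Bal.lift f h (bt ρ σ m n) = f m n := by
  simp [Bal.lift, bt]

theorem Bal.ind {ρ : Act k A M} {σ : Act k A N} {p : Bal ρ σ → Prop}
    (h0 : p 0) (ht : ∀ m n, p (bt ρ σ m n)) (ha : ∀ x y, p x → p y → p (x + y))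
    (x : Bal ρ σ) : p x := by
  obtain ⟨t, rfl⟩ := Submodule.mkQ_surjective _ x
  induction t using TensorProduct.induction_on with
  | zero => simpa using h0
  | tmul m n => exact ht m n
  | add x y hx hy => rw [map_add]; exact ha _ _ hx hy

theorem Bal.hom_ext {ρ : Act k A M} {σ : Act k A N} {f g : Bal ρ σ →ₗ[k] P}
    (h : ∀ m n, f (bt ρ σ m n) = g (bt ρ σ m n)) : f = g := by
  ext1
  ext m n
  exact h m n

theorem bt_add_left (ρ : Act k A M) (σ : Act k A N) (m m' : M) (n : N) :
    bt ρ σ (m + m') n = bt ρ σ m n + bt ρ σ m' n := by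
  simp only [bt, TensorProduct.add_tmul, map_add]

theorem bt_add_right (ρ : Act k A M) (σ : Act k A N) (m : M) (n n' : N) :
    bt ρ σ m (n + n') = bt ρ σ m n + bt ρ σ m n' := by
  simp only [bt, TensorProduct.tmul_add, map_add]

theorem bt_smul_left (ρ : Act k A M) (σ : Act k A N) (c : k) (m : M) (n : N) :
    bt ρ σ (c • m) n = c • bt ρ σ m n := by
  simp only [bt, ← TensorProduct.smul_tmul', map_smul]

theorem bt_smul_right (ρ : Act k A M) (σ : Act k A N) (c : k) (m : M) (n : N) :
    bt ρ σ m (c • n) = c • bt ρ σ m n := by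
  simp only [bt, TensorProduct.tmul_smul, map_smul]

/-- `(m, n) ↦ m ⊗_A n` as a bilinear map. -/
def btL (ρ : Act k A M) (σ : Act k A N) : M →ₗ[k] N →ₗ[k] Bal ρ σ :=
  LinearMap.mk₂ k (bt ρ σ) (bt_add_left ρ σ) (bt_smul_left ρ σ) (bt_add_right ρ σ)
    (bt_smul_right ρ σ)

@[simp] theorem btL_apply (ρ : Act k A M) (σ : Act k A N) (m : M) (n : N) :
    btL ρ σ m n = bt ρ σ m n := rfl

/-- `f ⊗_A g` for `A`-linear maps `f` and `g`. -/
def Bal.map {ρ : Act k A M} {σ : Act k A N} {ρ' : Act k A M'} {σ' : Act k A N'}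
    (f : M →ₗ[k] M') (g : N →ₗ[k] N') (hf : IsALin ρ ρ' f)
    (hg : IsALin σ σ' g) : Bal ρ σ →ₗ[k] Bal ρ' σ' :=
  Bal.lift ((btL ρ' σ').compl₁₂ f g) ⟨fun a m n => by simp [hf.lin, hg.lin, bt_bal]⟩

@[simp] theorem Bal.map_bt {ρ : Act k A M} {σ : Act k A N} {ρ' : Act k A M'} {σ' : Act k A N'}
    (f : M →ₗ[k] M') (g : N →ₗ[k] N') (hf : IsALin ρ ρ' f)
    (hg : IsALin σ σ' g) (m : M) (n : N) :
    Bal.map f g hf hg (bt ρ σ m n) = bt ρ' σ' (f m) (g n) := by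
  simp [Bal.map]

/-- The action `a (m ⊗ n) = (a m) ⊗ n` induced by a second action `τ` on the first factor. -/
def Bal.actL {ρ : Act k A M} (σ : Act k A N) (τ : Act k A M)
    (h : ∀ a b m, τ a (ρ b m) = ρ b (τ a m)) : Act k A (Bal ρ σ) :=
  AlgHom.ofLinearMap
    { toFun := fun a => Bal.map (τ a) LinearMap.id ⟨fun b m => h a b m⟩ ⟨fun _ _ => rfl⟩
      map_add' := fun a b => Bal.hom_ext fun m n => by simp [bt_add_left]
      map_smul' := fun c a => Bal.hom_ext fun m n => by simp [bt_smul_left] }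
    (Bal.hom_ext fun m n => by simp)
    (fun a b => Bal.hom_ext fun m n => by simp)

@[simp] theorem Bal.actL_bt {ρ : Act k A M} (σ : Act k A N) (τ : Act k A M)
    (h : ∀ a b m, τ a (ρ b m) = ρ b (τ a m)) (a : A) (m : M) (n : N) :
    Bal.actL σ τ h a (bt ρ σ m n) = bt ρ σ (τ a m) n := by
  simp [Bal.actL]

/-- The action `a (m ⊗ n) = m ⊗ (a n)` induced by a second action `τ` on the second factor. -/
def Bal.actR (ρ : Act k A M) {σ : Act k A N} (τ : Act k A N)
    (h : ∀ a b n, τ a (σ b n) = σ b (τ a n)) : Act k A (Bal ρ σ) :=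
  AlgHom.ofLinearMap
    { toFun := fun a => Bal.map LinearMap.id (τ a) ⟨fun _ _ => rfl⟩ ⟨fun b n => h a b n⟩
      map_add' := fun a b => Bal.hom_ext fun m n => by simp [bt_add_right]
      map_smul' := fun c a => Bal.hom_ext fun m n => by simp [bt_smul_right] }
    (Bal.hom_ext fun m n => by simp)
    (fun a b => Bal.hom_ext fun m n => by simp)

@[simp] theorem Bal.actR_bt (ρ : Act k A M) {σ : Act k A N} (τ : Act k A N)
    (h : ∀ a b n, τ a (σ b n) = σ b (τ a n)) (a : A) (m : M) (n : N) :
    Bal.actR ρ τ h a (bt ρ σ m n) = bt ρ σ m (τ a n) := by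
  simp [Bal.actR]

/-- The associativity map `(M ⊗_A N) ⊗_A P → M ⊗_A (N ⊗_A P)`, `(m ⊗ n) ⊗ p ↦ m ⊗ (n ⊗ p)`;
the first tensor product uses the action `σ` on `N`, the second one the action `τ`. -/
def Bal.assoc (ρ : Act k A M) (σ τ : Act k A N) (υ : Act k A P)
    (h : ∀ a b n, τ a (σ b n) = σ b (τ a n)) :
    Bal (Bal.actR ρ τ h) υ →ₗ[k] Bal ρ (Bal.actL υ σ (fun a b n => (h b a n).symm)) :=
  Bal.lift
    (Bal.lift
      (LinearMap.mk₂ k (fun m n =>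
          (btL ρ (Bal.actL υ σ (fun a b n => (h b a n).symm)) m).comp (btL τ υ n))
        (fun m m' n => by ext p; simp [bt_add_left])
        (fun c m n => by ext p; simp [bt_smul_left])
        (fun m n n' => by ext p; simp [bt_add_left, bt_add_right])
        (fun c m n => by ext p; simp [bt_smul_left, bt_smul_right]))
      ⟨fun a m n => by
        ext p
        simp [bt_bal]⟩)
    ⟨fun a w p => by
      induction w using Bal.ind with
      | h0 => simp
      | ht m n => simp [bt_bal]
      | ha x y hx hy => simp only [map_add, LinearMap.add_apply, hx, hy]⟩

@[simp] theorem Bal.assoc_bt (ρ : Act k A M) (σ τ : Act k A N) (υ : Act k A P)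
    (h : ∀ a b n, τ a (σ b n) = σ b (τ a n)) (m : M) (n : N) (p : P) :
    Bal.assoc ρ σ τ υ h (bt _ υ (bt ρ σ m n) p) = bt ρ _ m (bt τ υ n p) := by
  simp [Bal.assoc]

/-- The flip `m ⊗ n ↦ n ⊗ m`. -/
def Bal.flip (ρ : Act k A M) (σ : Act k A N) : Bal ρ σ →ₗ[k] Bal σ ρ :=
  Bal.lift (btL σ ρ).flip ⟨fun a m n => by simp [bt_bal]⟩

@[simp] theorem Bal.flip_bt (ρ : Act k A M) (σ : Act k A N) (m : M) (n : N) :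
    Bal.flip ρ σ (bt ρ σ m n) = bt σ ρ n m := by
  simp [Bal.flip]

/-- `M`, with the action `ρ` of `A`, is a finitely generated projective `A`-module. -/
def IsFGP (ρ : Act k A M) : Prop :=
  letI : Module A M := Module.compHom M ρ.toRingHom
  Module.Finite A M ∧ Module.Projective A M

end Balanced

variable (k A : Type u) [Field k] [CommRing A] [Algebra k A]

/-! ## Bimodules and corings -/

/-- An `A`-bimodule (with central underlying `k`-vector space structure); `l` is the left action
and `r` is the right action. -/
structure ABimod where
  carrier : Type u
  [grp : AddCommGroup carrier]
  [mod : Module k carrier]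
  l : Act k A carrier
  r : Act k A carrier
  comm : ∀ a b x, l a (r b x) = r b (l a x)

attribute [instance] ABimod.grp ABimod.mod

variable {k A}

/-- The structure of an `A`-coring on an `A`-bimodule `M`: coassociative and counital
`A`-bilinear maps `M → M ⊗_A M` and `M → A`. -/
@[ext] structure CoringStr (M : ABimod k A) where
  comul : M.carrier →ₗ[k] Bal M.r M.l
  counit : M.carrier →ₗ[k] A
  comul_l : ∀ a x, comul (M.l a x) = Bal.actL M.l M.l M.comm a (comul x)
  comul_r : ∀ a x, comul (M.r a x) = Bal.actR M.r M.r (fun a b x => (M.comm b a x).symm) a (comul x)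
  counit_l : ∀ a x, counit (M.l a x) = a * counit x
  counit_r : ∀ a x, counit (M.r a x) = counit x * a
  coassoc : ∀ x, Bal.assoc M.r M.l M.r M.l (fun a b x => (M.comm b a x).symm)
      (Bal.map comul LinearMap.id ⟨comul_r⟩ ⟨fun _ _ => rfl⟩ (comul x)) =
        Bal.map LinearMap.id comul ⟨fun _ _ => rfl⟩ ⟨comul_l⟩ (comul x)
  counit_comul : ∀ x, Bal.lift (P := M.carrier) (M.l.toLinearMap.comp counit)
      ⟨fun a m n => by simp [counit_r]⟩ (comul x) = x
  comul_counit : ∀ x, Bal.lift (P := M.carrier) (M.r.toLinearMap.comp counit).flip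
      ⟨fun a m n => by simp [counit_l, mul_comm a]⟩ (comul x) = x

variable (k A) in
/-- `A`-corings. -/
structure ACoring where
  toBimod : ABimod k A
  str : CoringStr toBimod

namespace ACoring

abbrev carrier (C : ACoring k A) : Type u := C.toBimod.carrier
abbrev l (C : ACoring k A) : Act k A C.carrier := C.toBimod.l
abbrev r (C : ACoring k A) : Act k A C.carrier := C.toBimod.r
abbrev comul (C : ACoring k A) : C.carrier →ₗ[k] Bal C.r C.l := C.str.comul
abbrev counit (C : ACoring k A) : C.carrier →ₗ[k] A := C.str.counit

/-- Morphisms of `A`-corings. -/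
@[ext] structure Hom (C D : ACoring k A) where
  toLin : C.carrier →ₗ[k] D.carrier
  map_l : ∀ a x, toLin (C.l a x) = D.l a (toLin x)
  map_r : ∀ a x, toLin (C.r a x) = D.r a (toLin x)
  counit_map : ∀ x, D.counit (toLin x) = C.counit x
  comul_map : ∀ x, D.comul (toLin x) = Bal.map toLin toLin ⟨map_r⟩ ⟨map_l⟩ (C.comul x)

instance : Category (ACoring k A) where
  Hom := Hom
  id C :=
    { toLin := LinearMap.id
      map_l := fun _ _ => rfl
      map_r := fun _ _ => rfl
      counit_map := fun _ => rfl
      comul_map := fun x => by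
        have : Bal.map (ρ := C.r) (σ := C.l) (ρ' := C.r) (σ' := C.l) LinearMap.id LinearMap.id
            ⟨fun _ _ => rfl⟩ ⟨fun _ _ => rfl⟩ = LinearMap.id := Bal.hom_ext fun m n => by simp
        rw [this]; rfl }
  comp f g :=
    { toLin := g.toLin.comp f.toLin
      map_l := fun a x => by simp [f.map_l, g.map_l]
      map_r := fun a x => by simp [f.map_r, g.map_r]
      counit_map := fun x => by simp [f.counit_map, g.counit_map]
      comul_map := fun x => by
        rw [LinearMap.comp_apply, g.comul_map, f.comul_map, ← LinearMap.comp_apply]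
        congr 1
        exact Bal.hom_ext fun m n => by simp }

end ACoring

/-! ## A-rings and the left convolution algebra of a coring -/

variable (k A) in
/-- `A`-rings: `k`-algebras `R` with an algebra map `s : A → R`, not necessarily central. -/
structure ARing where
  carrier : Type u
  [ring : Ring carrier]
  [alg : Algebra k carrier]
  s : A →ₐ[k] carrier

attribute [instance] ARing.ring ARing.alg

namespace ARing

/-- The left action `a x = s(a) x`. -/
def l (R : ARing k A) : Act k A R.carrier := (Algebra.lmul k R.carrier).comp R.s

/-- The right action `x a = x s(a)`. -/
def r (R : ARing k A) : Act k A R.carrier :=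
  AlgHom.ofLinearMap ((LinearMap.mul k R.carrier).flip.comp R.s.toLinearMap)
    (by ext x; simp) (fun a b => by ext x; simp [mul_comm a b, mul_assoc])

@[simp] theorem l_apply (R : ARing k A) (a : A) (x : R.carrier) : R.l a x = R.s a * x := rfl
@[simp] theorem r_apply (R : ARing k A) (a : A) (x : R.carrier) : R.r a x = x * R.s a := rfl

/-- Morphisms of `A`-rings. -/
@[ext] structure Hom (R T : ARing k A) where
  toAlgHom : R.carrier →ₐ[k] T.carrier
  map_s : ∀ a, toAlgHom (R.s a) = T.s a

instance : Category (ARing k A) where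
  Hom := Hom
  id R := { toAlgHom := AlgHom.id k _, map_s := fun _ => rfl }
  comp f g :=
    { toAlgHom := g.toAlgHom.comp f.toAlgHom
      map_s := fun a => by simp [f.map_s, g.map_s] }

/-- The right dual `R^* = Hom_{-A}(R, A)`. -/
def RDual (R : ARing k A) : Submodule k (R.carrier →ₗ[k] A) where
  carrier := {f | ∀ x a, f (x * R.s a) = f x * a}
  add_mem' := fun hf hg x a => by simp [hf x a, hg x a, add_mul]
  zero_mem' := fun x a => by simp
  smul_mem' := fun c f hf x a => by simp [hf x a]

end ARing

namespace ACoring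

/-- The left dual `^*C = Hom_{A-}(C, A)`. -/
def LDual (C : ACoring k A) : Submodule k (C.carrier →ₗ[k] A) where
  carrier := {f | ∀ a x, f (C.l a x) = a * f x}
  add_mem' := fun hf hg a x => by simp [hf a x, hg a x, mul_add]
  zero_mem' := fun a x => by simp
  smul_mem' := fun c f hf a x => by simp [hf a x]

variable (C : ACoring k A)

/-- The map `x ⊗ y ↦ x f(y)` on `C ⊗_A C`, for `f` in `^*C`. -/
def contr (f : C.LDual) : Bal C.r C.l →ₗ[k] C.carrier :=
  Bal.lift (C.r.toLinearMap.comp f.1).flip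
    ⟨fun a m n => by simp [f.2 a n, mul_comm a]⟩

@[simp] theorem contr_bt (f : C.LDual) (x y : C.carrier) :
    C.contr f (bt C.r C.l x y) = C.r (f.1 y) x := by
  simp [contr]

theorem contr_actL (f : C.LDual) (a : A) (w : Bal C.r C.l) :
    C.contr f (Bal.actL C.l C.l C.toBimod.comm a w) = C.l a (C.contr f w) := by
  induction w using Bal.ind with
  | h0 => simp
  | ht m n => simp [C.toBimod.comm]
  | ha x y hx hy => simp only [map_add, hx, hy]

/-- The convolution product `(f * g)(x) = g(x₁ f(x₂))`. -/
instance : Mul C.LDual where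
  mul f g := ⟨g.1.comp ((C.contr f).comp C.comul), fun a x => by
    simp only [LinearMap.comp_apply]
    rw [C.str.comul_l, contr_actL, g.2]⟩

instance : One C.LDual where
  one := ⟨C.counit, C.str.counit_l⟩

theorem mul_apply (f g : C.LDual) (x : C.carrier) :
    (f * g).1 x = g.1 (C.contr f (C.comul x)) := rfl

theorem one_apply (x : C.carrier) : (1 : C.LDual).1 x = C.counit x := rfl

theorem contr_one (x : C.carrier) : C.contr 1 (C.comul x) = x := C.str.comul_counit x

theorem counit_contr (f : C.LDual) (x : C.carrier) :
    C.counit (C.contr f (C.comul x)) = f.1 x := by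
  conv_rhs => rw [← C.str.counit_comul x]
  induction C.comul x using Bal.ind with
  | h0 => simp
  | ht m n => simp [C.str.counit_r, f.2 (C.counit m) n]
  | ha x y hx hy => simp only [map_add, hx, hy]

theorem contr_mul (f g : C.LDual) (x : C.carrier) :
    C.contr (f * g) (C.comul x) = C.contr g (C.comul (C.contr f (C.comul x))) := by
  let Φ : Bal C.r (Bal.actL C.l C.l C.toBimod.comm) →ₗ[k] C.carrier :=
    Bal.lift (C.r.toLinearMap.comp (g.1.comp (C.contr f))).flip ⟨fun a m w => by
      simp [contr_actL, g.2 a, mul_comm a]⟩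
  have h1 : ∀ w, C.contr (f * g) w = Φ (Bal.map LinearMap.id C.comul ⟨fun _ _ => rfl⟩
      ⟨C.str.comul_l⟩ w) := fun w => by
    induction w using Bal.ind with
    | h0 => simp
    | ht m n => simp [Φ, mul_apply]
    | ha x y hx hy => simp only [map_add, hx, hy]
  have h3 : ∀ w z, C.contr g (Bal.actR C.r C.r (fun a b x => (C.toBimod.comm b a x).symm)
      (f.1 z) w) = Φ (Bal.assoc C.r C.l C.r C.l (fun a b x => (C.toBimod.comm b a x).symm)
        (bt _ C.l w z)) := fun w z => by
    induction w using Bal.ind with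
    | h0 => simp [bt]
    | ht m n => simp [Φ]
    | ha x y hx hy => simp only [map_add, bt_add_left, hx, hy]
  have h2 : ∀ w, C.contr g (C.comul (C.contr f w)) = Φ (Bal.assoc C.r C.l C.r C.l
      (fun a b x => (C.toBimod.comm b a x).symm)
      (Bal.map C.comul LinearMap.id ⟨C.str.comul_r⟩ ⟨fun _ _ => rfl⟩ w)) := fun w => by
    induction w using Bal.ind with
    | h0 => simp
    | ht m n => rw [contr_bt, C.str.comul_r, h3, Bal.map_bt]; rfl
    | ha x y hx hy => simp only [map_add, hx, hy]
  rw [h1, h2, C.str.coassoc]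

instance : Ring C.LDual :=
  { (inferInstance : AddCommGroup C.LDual), (inferInstance : Mul C.LDual),
    (inferInstance : One C.LDual) with
    left_distrib := fun f g h => by
      apply Subtype.ext; ext x; rfl
    right_distrib := fun f g h => by
      apply Subtype.ext; ext x
      change (_ * _ : C.LDual).1 x = (f * h).1 x + (g * h).1 x
      simp only [mul_apply, ← map_add]
      congr 1
      induction C.comul x using Bal.ind with
      | h0 => simp
      | ht m n => simp
      | ha x y hx hy => rw [map_add, hx, hy]; simp only [map_add]; abel
    zero_mul := fun f => by
      apply Subtype.ext; ext x
      change f.1 (C.contr 0 (C.comul x)) = 0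
      have : C.contr 0 = 0 := Bal.hom_ext fun m n => by simp
      rw [this]; simp
    mul_zero := fun f => by
      apply Subtype.ext; ext x; rfl
    mul_assoc := fun f g h => by
      apply Subtype.ext; ext x
      simp only [mul_apply, contr_mul]
    one_mul := fun f => by
      apply Subtype.ext; ext x
      simp only [mul_apply, contr_one]
    mul_one := fun f => by
      apply Subtype.ext; ext x
      rw [mul_apply, one_apply, counit_contr]
    neg_add_cancel := fun f => neg_add_cancel f
    zsmul := fun n f => n • f
    nsmul := fun n f => n • f
    nsmul_zero := fun f => AddMonoid.nsmul_zero f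
    nsmul_succ := fun n f => AddMonoid.nsmul_succ n f
    zsmul_zero' := fun f => SubNegMonoid.zsmul_zero' f
    zsmul_succ' := fun n f => SubNegMonoid.zsmul_succ' n f
    zsmul_neg' := fun n f => SubNegMonoid.zsmul_neg' n f }

instance : Algebra k C.LDual :=
  Algebra.ofModule
    (fun c f g => by
      apply Subtype.ext; ext x
      change g.1 (C.contr (c • f) (C.comul x)) = c • g.1 (C.contr f (C.comul x))
      have : C.contr (c • f) = c • C.contr f := Bal.hom_ext fun m n => by simp
      rw [this]; simp)
    (fun c f g => by apply Subtype.ext; ext x; rfl)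

/-- The element `a ε = ε a : x ↦ ε(x) a` of `^*C`. -/
def ldualUnit (a : A) : C.LDual :=
  ⟨(LinearMap.mulRight k a).comp C.counit, fun b x => by simp [C.str.counit_l, mul_assoc]⟩

@[simp] theorem ldualUnit_apply (a : A) (x : C.carrier) :
    (C.ldualUnit a).1 x = C.counit x * a := rfl

theorem mul_ldualUnit (f : C.LDual) (a : A) (x : C.carrier) :
    (f * C.ldualUnit a).1 x = f.1 x * a := by
  rw [mul_apply, ldualUnit_apply, counit_contr]

/-- The `A`-ring `^*C`, the left convolution algebra of `C`. -/
def ldual : ARing k A where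
  carrier := C.LDual
  s := AlgHom.ofLinearMap (B := C.LDual)
    { toFun := C.ldualUnit
      map_add' := fun a b => by apply Subtype.ext; ext x; simp [mul_add]
      map_smul' := fun c a => by apply Subtype.ext; ext x; simp }
    (by apply Subtype.ext; ext x; simp [one_apply])
    (fun a b => by
      apply Subtype.ext; ext x
      change _ = (C.ldualUnit a * C.ldualUnit b).1 x
      rw [mul_ldualUnit]; simp [mul_assoc])

variable {C} in
/-- The map `^*f : ^*D → ^*C`, `g ↦ g ∘ f`. -/
def ldualMap {D : ACoring k A} (f : C ⟶ D) : D.ldual ⟶ C.ldual :=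
  let pre : D.LDual →ₗ[k] C.LDual :=
    { toFun := fun g => ⟨g.1.comp f.toLin, fun a x => by simp [f.map_l, g.2 a]⟩
      map_add' := fun g h => rfl
      map_smul' := fun c g => rfl }
  { toAlgHom := AlgHom.ofLinearMap (A := D.LDual) (B := C.LDual) pre
      (by apply Subtype.ext; ext x; exact f.counit_map x)
      (fun g h => by
        apply Subtype.ext; ext x
        change h.1 (D.contr g (D.comul (f.toLin x))) =
          h.1 (f.toLin (C.contr (pre g) (C.comul x)))
        rw [f.comul_map]
        congr 1
        induction C.comul x using Bal.ind with
        | h0 => simp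
        | ht m n => simp [f.map_r, pre]
        | ha x y hx hy => simp only [map_add, hx, hy])
    map_s := fun a => by
      apply Subtype.ext; ext x
      change D.counit (f.toLin x) * a = C.counit x * a
      rw [f.counit_map] }

end ACoring

variable (k A) in
/-- The convolution-dual functor `^*(-) : Corings_A^op → Rings_A`. -/
def ldualFunctor : (ACoring k A)ᵒᵖ ⥤ ARing k A where
  obj C := C.unop.ldual
  map f := ACoring.ldualMap f.unop
  map_id _ := rfl
  map_comp _ _ := rfl

/-- The map `C → R^*`, `z ↦ [r ↦ h(r)(z)]`, attached to a morphism of `A`-rings `h : R → ^*C`. -/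
def toRDual {R : ARing k A} {C : ACoring k A} (h : R ⟶ C.ldual) : C.carrier →ₗ[k] R.RDual :=
  let ev : R.carrier →ₗ[k] (C.carrier →ₗ[k] A) :=
    C.LDual.subtype.comp (h.toAlgHom.toLinearMap : R.carrier →ₗ[k] C.LDual)
  { toFun := fun z => ⟨ev.flip z, fun x a => by
      have e : (show C.LDual from h.toAlgHom (x * R.s a)) =
          (show C.LDual from h.toAlgHom x) * C.ldualUnit a := by
        rw [map_mul, h.map_s]; rfl
      change (show C.LDual from h.toAlgHom (x * R.s a)).1 z = (show C.LDual from h.toAlgHom x).1 z * a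
      rw [e, ACoring.mul_ldualUnit]⟩
    map_add' := fun z w => by apply Subtype.ext; simp
    map_smul' := fun c z => by apply Subtype.ext; simp }

/-- The dual coring `R^•`, for a left adjoint `L` of the functor `^*(-)`. -/
abbrev bullet (L : ARing k A ⥤ (ACoring k A)ᵒᵖ) (R : ARing k A) : ACoring k A := (L.obj R).unop

/-- The canonical map `ξ : R^• → R^*`: the unit `R → ^*(R^•)` of the adjunction is
`r ↦ [z ↦ ξ(z)(r)]`. -/
def xi {L : ARing k A ⥤ (ACoring k A)ᵒᵖ} (adj : L ⊣ ldualFunctor k A) (R : ARing k A) :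
    (bullet L R).carrier →ₗ[k] R.RDual :=
  toRDual (C := bullet L R) (adj.unit.app R)

/-- The map `z ⊗ w ↦ f(z)(f(w)(x) y)` on `C ⊗_A C`, where `f : C → R^*`. -/
def zetaPair {R : ARing k A} {C : ACoring k A} (f : C.carrier →ₗ[k] R.RDual)
    (hl : ∀ a z u, (f (C.l a z)).1 u = a * (f z).1 u)
    (hr : ∀ a z u, (f (C.r a z)).1 u = (f z).1 (R.s a * u)) (x y : R.carrier) :
    Bal C.r C.l →ₗ[k] A :=
  Bal.lift
    (LinearMap.mk₂ k (fun z w => (f z).1 (R.s ((f w).1 x) * y))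
      (by intros; simp) (by intros; simp)
      (by intros; simp [add_mul]) (by intros; simp))
    ⟨fun a z w => by simp [hl, hr, mul_assoc]⟩

/-- The conditions, for a map `f : C → R^*` from an `A`-coring to the right dual of an `A`-ring:
`f(z)(xy) = f(z₁)(f(z₂)(x) y)`, `f(z)(1) = ε(z)` and `f(a z b)(u) = a f(z)(b u)`. -/
structure ZetaProp {R : ARing k A} {C : ACoring k A} (f : C.carrier →ₗ[k] R.RDual) : Prop where
  map_l : ∀ a z u, (f (C.l a z)).1 u = a * (f z).1 u
  map_r : ∀ a z u, (f (C.r a z)).1 u = (f z).1 (R.s a * u)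
  map_one : ∀ z, (f z).1 1 = C.counit z
  map_mul : ∀ z x y, (f z).1 (x * y) = zetaPair f map_l map_r x y (C.comul z)

/-! ## Commutative Hopf algebroids -/

/-- A structure of commutative algebra over `A ⊗ A` on an `A`-bimodule `M`, that is, of a
commutative `k`-algebra with source and target maps `s(a) = a 1`, `t(a) = 1 a` such that
`a x b = s(a) x t(b)`. -/
@[ext] structure AlgStr (M : ABimod k A) where
  mul : M.carrier →ₗ[k] M.carrier →ₗ[k] M.carrier
  one : M.carrier
  mul_comm : ∀ x y, mul x y = mul y x
  mul_assoc : ∀ x y z, mul (mul x y) z = mul x (mul y z)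
  one_mul : ∀ x, mul one x = x
  l_mul : ∀ a x y, mul (M.l a x) y = M.l a (mul x y)
  r_mul : ∀ a x y, mul (M.r a x) y = M.r a (mul x y)

namespace AlgStr

variable {M : ABimod k A} (H : AlgStr M)

/-- The source map. -/
def s (a : A) : M.carrier := M.l a H.one

/-- The target map. -/
def t (a : A) : M.carrier := M.r a H.one

/-- The unit `η(a ⊗ b) = s(a) t(b)`. -/
def eta (a b : A) : M.carrier := H.mul (H.s a) (H.t b)

theorem mul_l (a : A) (x y : M.carrier) : H.mul x (M.l a y) = M.l a (H.mul x y) := by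
  rw [H.mul_comm, H.l_mul, H.mul_comm]

theorem mul_r (a : A) (x y : M.carrier) : H.mul x (M.r a y) = M.r a (H.mul x y) := by
  rw [H.mul_comm, H.r_mul, H.mul_comm]

/-- The product `(x ⊗ y)(x' ⊗ y') = x x' ⊗ y y'` of the algebra `M ⊗_A M`. -/
def mulT : Bal M.r M.l →ₗ[k] Bal M.r M.l →ₗ[k] Bal M.r M.l :=
  Bal.lift
    (LinearMap.mk₂ k
      (fun x y => Bal.map (H.mul x) (H.mul y) ⟨fun a m => H.mul_r a x m⟩
        ⟨fun a m => H.mul_l a y m⟩)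
      (fun _ _ _ => Bal.hom_ext fun _ _ => by simp [bt_add_left])
      (fun _ _ _ => Bal.hom_ext fun _ _ => by simp [bt_smul_left])
      (fun _ _ _ => Bal.hom_ext fun _ _ => by simp [bt_add_right])
      (fun _ _ _ => Bal.hom_ext fun _ _ => by simp [bt_smul_right]))
    ⟨fun a x y => Bal.hom_ext fun m n => by simp [H.r_mul, H.l_mul, bt_bal]⟩

end AlgStr

/-- A structure of commutative Hopf algebroid on the `A`-coring `C`: a commutative algebra
structure, with source and target inducing the bimodule structure of `C`, such that the counit and
the comultiplication are algebra maps, and an antipode `S`. Since `S` is an algebra map, the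
conditions `S s = t` and `S t = s` are written as `S(a x) = S(x) a` and `S(x a) = a S(x)`. -/
@[ext] structure HopfStr (C : ACoring k A) extends AlgStr C.toBimod where
  counit_one : C.counit one = 1
  counit_mul : ∀ x y, C.counit (mul x y) = C.counit x * C.counit y
  comul_one : C.comul one = bt C.r C.l one one
  comul_mul : ∀ x y, C.comul (mul x y) = toAlgStr.mulT (C.comul x) (C.comul y)
  S : C.carrier →ₗ[k] C.carrier
  S_one : S one = one
  S_mul : ∀ x y, S (mul x y) = mul (S x) (S y)
  S_l : ∀ a x, S (C.l a x) = C.r a (S x)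
  S_r : ∀ a x, S (C.r a x) = C.l a (S x)
  S_S : ∀ x, S (S x) = x
  /-- `S(x₁) x₂ = t(ε(x))` -/
  S_mul_id : ∀ x, Bal.lift (P := C.carrier) (mul.comp S)
    ⟨fun a x y => (congrArg (fun z => mul z y) (S_r a x)).trans
      ((toAlgStr.l_mul a (S x) y).trans (toAlgStr.mul_l a (S x) y).symm)⟩ (C.comul x) =
      toAlgStr.t (C.counit x)
  /-- `x₁ S(x₂) = s(ε(x))` -/
  id_mul_S : ∀ x, Bal.lift (P := C.carrier) (mul.compl₂ S)
    ⟨fun a x y => (toAlgStr.r_mul a x (S y)).trans ((toAlgStr.mul_r a x (S y)).symm.trans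
      (congrArg (mul x) (S_l a y).symm))⟩ (C.comul x) =
      toAlgStr.s (C.counit x)

variable (k A) in
/-- Commutative Hopf algebroids with base algebra `A`. -/
structure CHopf where
  coring : ACoring k A
  str : HopfStr coring

namespace CHopf

/-- Morphisms of commutative Hopf algebroids (over the identity of `A`): coring maps that are
algebra maps and commute with the antipodes. They commute with sources and targets because they
are `A`-bilinear and unital. -/
@[ext] structure Hom (H K : CHopf k A) where
  toCoringHom : H.coring ⟶ K.coring
  map_one : toCoringHom.toLin H.str.one = K.str.one
  map_mul : ∀ x y, toCoringHom.toLin (H.str.mul x y) =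
    K.str.mul (toCoringHom.toLin x) (toCoringHom.toLin y)
  map_S : ∀ x, toCoringHom.toLin (H.str.S x) = K.str.S (toCoringHom.toLin x)

instance : Category (CHopf k A) where
  Hom := Hom
  id H := ⟨𝟙 _, rfl, fun _ _ => rfl, fun _ => rfl⟩
  comp f g := ⟨f.toCoringHom ≫ g.toCoringHom,
    by
      change g.toCoringHom.toLin (f.toCoringHom.toLin _) = _
      rw [f.map_one, g.map_one],
    fun x y => by
      change g.toCoringHom.toLin (f.toCoringHom.toLin _) = _
      rw [f.map_mul, g.map_mul]; rfl,
    fun x => by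
      change g.toCoringHom.toLin (f.toCoringHom.toLin _) = _
      rw [f.map_S, g.map_S]; rfl⟩

variable (k A) in
/-- The forgetful functor from commutative Hopf algebroids to `A`-corings. -/
def forgetCoring : CHopf k A ⥤ ACoring k A where
  obj H := H.coring
  map f := f.toCoringHom

end CHopf

/-! ## Cocommutative Hopf algebroids -/

namespace ARing

variable (R : ARing k A)

/-- `U_A ⊗_A U_A`. -/
abbrev TRR := Bal R.r R.r

/-- `U_A ⊗_A (_A U)`. -/
abbrev TRL := Bal R.r R.l

theorem rr (a b : A) (x : R.carrier) : R.r a (R.r b x) = R.r b (R.r a x) := by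
  simp [mul_assoc, ← map_mul, mul_comm]

/-- The map `u ⊗ v ↦ x u ⊗ y v` on `U_A ⊗_A U_A`. -/
def mulLL (x y : R.carrier) : R.TRR →ₗ[k] R.TRR :=
  Bal.map (LinearMap.mulLeft k x) (LinearMap.mulLeft k y)
    ⟨fun a m => by simp [mul_assoc]⟩ ⟨fun a m => by simp [mul_assoc]⟩

@[simp] theorem mulLL_bt (x y u v : R.carrier) :
    R.mulLL x y (bt R.r R.r u v) = bt R.r R.r (x * u) (y * v) := by
  simp [mulLL]

theorem mulLL_mulLL (x y x' y' : R.carrier) (w : R.TRR) :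
    R.mulLL x y (R.mulLL x' y' w) = R.mulLL (x * x') (y * y') w := by
  rw [← LinearMap.comp_apply]
  congr 1
  exact Bal.hom_ext fun m n => by simp [mul_assoc]

/-- Membership in `U ×_A U`: the elements `Σ uᵢ ⊗ vᵢ` of `U_A ⊗_A U_A` such that
`Σ a uᵢ ⊗ vᵢ = Σ uᵢ ⊗ a vᵢ` for all `a`. -/
def IsTak (w : R.TRR) : Prop := ∀ a, R.mulLL (R.s a) 1 w = R.mulLL 1 (R.s a) w

/-- `(x, y) ↦ (x ⊗ y) · w` as a bilinear map. -/
def mulBil (w : R.TRR) : R.carrier →ₗ[k] R.carrier →ₗ[k] R.TRR :=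
  LinearMap.mk₂ k (fun x y => R.mulLL x y w)
    (fun x x' y => by
      change _ = (R.mulLL x y + R.mulLL x' y) w
      congr 1
      exact Bal.hom_ext fun m n => by simp [add_mul, bt_add_left])
    (fun c x y => by
      change _ = (c • R.mulLL x y) w
      congr 1
      exact Bal.hom_ext fun m n => by simp [bt_smul_left])
    (fun x y y' => by
      change _ = (R.mulLL x y + R.mulLL x y') w
      congr 1
      exact Bal.hom_ext fun m n => by simp [add_mul, bt_add_right])
    (fun c x y => by
      change _ = (c • R.mulLL x y) w
      congr 1
      exact Bal.hom_ext fun m n => by simp [bt_smul_right])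

@[simp] theorem mulBil_apply (w : R.TRR) (x y : R.carrier) : R.mulBil w x y = R.mulLL x y w := rfl

/-- The product `z ↦ z · w`, `(x ⊗ y) · (u ⊗ v) = x u ⊗ y v`, for `w` in `U ×_A U`. -/
def takMul (w : R.TRR) (hw : R.IsTak w) : R.TRR →ₗ[k] R.TRR :=
  Bal.lift (R.mulBil w) ⟨fun a x y => by
    have h1 := R.mulLL_mulLL x y (R.s a) 1 w
    have h2 := R.mulLL_mulLL x y 1 (R.s a) w
    rw [hw a, h2] at h1
    simpa using h1.symm⟩

@[simp] theorem takMul_bt (w : R.TRR) (hw : R.IsTak w) (x y : R.carrier) :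
    R.takMul w hw (bt R.r R.r x y) = R.mulLL x y w := by
  simp [takMul]

end ARing

variable (k A) in
/-- The structure of a (right) cocommutative bialgebroid. -/
structure CCBialgd extends ARing k A where
  counit : carrier →ₗ[k] A
  counit_r : ∀ u a, counit (u * s a) = counit u * a
  counit_one : counit 1 = 1
  counit_mul : ∀ u v, counit (u * v) = counit (s (counit u) * v)
  comul : carrier →ₗ[k] toARing.TRR
  comul_r : ∀ a u, comul (toARing.r a u) =
    Bal.actR toARing.r toARing.r toARing.rr a (comul u)
  comul_tak : ∀ u, toARing.IsTak (comul u)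
  comul_one : comul 1 = bt toARing.r toARing.r 1 1
  comul_s : ∀ a, comul (s a) = bt toARing.r toARing.r (s a) 1
  comul_mul : ∀ u v, comul (u * v) = toARing.takMul (comul v) (comul_tak v) (comul u)
  coassoc : ∀ u, Bal.assoc toARing.r toARing.r toARing.r toARing.r toARing.rr
      (Bal.map comul LinearMap.id ⟨comul_r⟩ ⟨fun _ _ => rfl⟩ (comul u)) =
        Bal.map LinearMap.id comul ⟨fun _ _ => rfl⟩
          ⟨fun a u => by
            rw [comul_r a u]
            induction comul u using Bal.ind with
            | h0 => simp
            | ht m n => simp only [Bal.actR_bt, Bal.actL_bt, bt_bal]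
            | ha x y hx hy => simp only [map_add, hx, hy]⟩ (comul u)
  cocomm : ∀ u, Bal.flip toARing.r toARing.r (comul u) = comul u
  counit_comul : ∀ u, Bal.lift (P := carrier) (toARing.r.toLinearMap.comp counit)
      ⟨fun a m n => by
        change n * s (counit (m * s a)) = n * s a * s (counit m)
        rw [counit_r, mul_comm, map_mul, mul_assoc]⟩ (comul u) = u
  comul_counit : ∀ u, Bal.lift (P := carrier) (toARing.r.toLinearMap.comp counit).flip
      ⟨fun a m n => by
        change m * s a * s (counit n) = m * s (counit (n * s a))
        rw [counit_r, mul_comm (counit n), map_mul, mul_assoc]⟩ (comul u) = u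

namespace CCBialgd

variable (U : CCBialgd k A)

theorem comul_l (a : A) (v : U.carrier) : U.comul (U.s a * v) = U.mulLL (U.s a) 1 (U.comul v) := by
  rw [U.comul_mul, U.comul_s, ARing.takMul_bt]

/-- The canonical map `β(u ⊗ v) = u v₁ ⊗ v₂`. -/
def beta : U.TRL →ₗ[k] U.TRR :=
  Bal.lift
    (LinearMap.mk₂ k (fun u v => U.mulLL u 1 (U.comul v))
      (fun u u' v => (U.mulBil (U.comul v)).map_add₂ u u' 1)
      (fun c u v => (U.mulBil (U.comul v)).map_smul₂ c u 1)
      (fun u v v' => by simp)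
      (fun c u v => by simp))
    ⟨fun a u v => by
      change U.mulLL (u * U.s a) 1 (U.comul v) = U.mulLL u 1 (U.comul (U.s a * v))
      rw [U.comul_l, ARing.mulLL_mulLL, mul_one]⟩

/-- The map `u ⊗ v ↦ f(u) g(v)` on `U_A ⊗_A U_A`. -/
def convPair (f g : U.RDual) : U.TRR →ₗ[k] A :=
  Bal.lift ((LinearMap.mul k A).compl₁₂ f.1 g.1)
    ⟨fun a m n => by simp [f.2 m a, g.2 n a]; ring⟩

/-- The convolution product on `U^*`: `(f * g)(u) = f(u₁) g(u₂)`. -/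
def conv (f g : U.RDual) (u : U.carrier) : A := U.convPair f g (U.comul u)

/-- A `k`-linear map `f : H → U^*` is a morphism of `A ⊗ A`-algebras, where `U^*` carries the
convolution product and the unit `a ⊗ b ↦ [u ↦ ε(b u) a]`. -/
structure IsAlgMap {M : ABimod k A} (H : AlgStr M) (f : M.carrier →ₗ[k] U.RDual) : Prop where
  map_eta : ∀ a b u, (f (H.eta a b)).1 u = U.counit (U.s b * u) * a
  map_mul : ∀ x y u, (f (H.mul x y)).1 u = U.conv (f x) (f y) u

end CCBialgd

variable (k A) in
/-- (Right) cocommutative Hopf algebroids with base algebra `A`. -/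
structure CCHopf extends CCBialgd k A where
  beta_bij : Function.Bijective toCCBialgd.beta

namespace CCHopf

/-- The translation map `u ↦ u₋ ⊗ u₊ = β⁻¹(1 ⊗ u)`. -/
def transl (U : CCHopf k A) (u : U.carrier) : U.TRL :=
  (Equiv.ofBijective _ U.beta_bij).symm (bt U.r U.r 1 u)

/-- The map `v ⊗ w ↦ ε(f(v) w)` on `U_A ⊗_A (_A U)`, for a right `A`-linear map `f : U → A`. -/
def antiPair (U : CCHopf k A) (f : U.RDual) : U.TRL →ₗ[k] A :=
  Bal.lift
    (LinearMap.mk₂ k (fun v w => U.counit (U.s (f.1 v) * w))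
      (by intros; simp [add_mul]) (by intros; simp)
      (by intros; simp [mul_add]) (by intros; simp))
    ⟨fun a v w => by simp [f.2 v a, mul_assoc]⟩

/-- Morphisms of cocommutative Hopf algebroids (over the identity of `A`). -/
@[ext] structure Hom (U V : CCHopf k A) where
  toRingHom : U.toARing ⟶ V.toARing
  counit_map : ∀ u, V.counit (toRingHom.toAlgHom u) = U.counit u
  comul_map : ∀ u, V.comul (toRingHom.toAlgHom u) =
    Bal.map toRingHom.toAlgHom.toLinearMap toRingHom.toAlgHom.toLinearMap
      ⟨fun a m => by simp [toRingHom.map_s]⟩ ⟨fun a m => by simp [toRingHom.map_s]⟩ (U.comul u)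

instance : Category (CCHopf k A) where
  Hom := Hom
  id U := ⟨𝟙 _, fun _ => rfl, fun u => by
    change U.comul u = _
    have : Bal.map (ρ := U.r) (σ := U.r) (ρ' := U.r) (σ' := U.r) LinearMap.id LinearMap.id
            ⟨fun _ _ => rfl⟩ ⟨fun _ _ => rfl⟩ = LinearMap.id := Bal.hom_ext fun m n => by simp
    exact (congrArg (fun g => g (U.comul u)) this).symm⟩
  comp {U V W} f g := ⟨f.toRingHom ≫ g.toRingHom,
    fun u => by
      change W.counit (g.toRingHom.toAlgHom (f.toRingHom.toAlgHom u)) = _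
      rw [g.counit_map, f.counit_map],
    fun u => by
      change W.comul (g.toRingHom.toAlgHom (f.toRingHom.toAlgHom u)) = _
      rw [g.comul_map, f.comul_map, ← LinearMap.comp_apply]
      congr 1
      exact Bal.hom_ext fun m n => by
        simp only [LinearMap.comp_apply, Bal.map_bt]; rfl⟩

variable (k A) in
/-- The forgetful functor from cocommutative Hopf algebroids to `A`-rings. -/
def forgetRing : CCHopf k A ⥤ ARing k A where
  obj U := U.toARing
  map f := f.toRingHom

end CCHopf

/-- The relations `ξ(η(a ⊗ b))(u) = ε(b u) a`, `ξ(x y)(u) = ξ(x)(u₁) ξ(y)(u₂)` and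
`ξ(S(x))(u) = ε(ξ(x)(u₋) u₊)`. -/
structure DualRel (U : CCHopf k A) {C : ACoring k A} (ξ : C.carrier →ₗ[k] U.RDual)
    (H : HopfStr C) : Prop where
  eta : ∀ a b u, (ξ (H.eta a b)).1 u = U.counit (U.s b * u) * a
  mul : ∀ x y u, (ξ (H.mul x y)).1 u = U.conv (ξ x) (ξ y) u
  antipode : ∀ x u, (ξ (H.S x)).1 u = U.antiPair (ξ x) (U.transl u)

/-! ## The Tannakian dual -/

/-- Right `R`-modules whose underlying `A`-module is finitely generated and projective. Such an
`A`-module is isomorphic to a submodule of some `A^n`, so it is enough, up to isomorphism, to take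
the modules carried by these submodules; this makes the category small. -/
structure FGPMod (R : ARing k A) : Type u where
  n : ℕ
  S : Submodule A (Fin n → A)
  finite : Module.Finite A S
  proj : Module.Projective A S
  act : S →ₗ[k] R.carrier →ₗ[k] S
  act_one : ∀ p, act p 1 = p
  act_mul : ∀ p x y, act p (x * y) = act (act p x) y
  act_s : ∀ p a, act p (R.s a) = a • p

namespace FGPMod

variable {R : ARing k A}

theorem act_r (P : FGPMod R) (p : P.S) (a : A) (x : R.carrier) :
    P.act p (x * R.s a) = a • P.act p x := by
  rw [P.act_mul, P.act_s]

/-- `R`-linear maps. -/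
def IsLin {P Q : FGPMod R} (t : P.S →ₗ[A] Q.S) : Prop :=
  ∀ p x, t (P.act p x) = Q.act (t p) x

end FGPMod

section Circ

open scoped DirectSum Classical

variable (R : ARing k A)

variable {R} in
/-- The summand `P^* ⊗ P`. -/
def CircSummand (P : FGPMod R) : Type u := Module.Dual A P.S ⊗[k] P.S

instance (P : FGPMod R) : AddCommGroup (CircSummand P) :=
  inferInstanceAs (AddCommGroup (Module.Dual A P.S ⊗[k] P.S))

instance (P : FGPMod R) : Module k (CircSummand P) :=
  inferInstanceAs (Module k (Module.Dual A P.S ⊗[k] P.S))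

variable {R} in
/-- `(φ, p) ↦ φ ⊗ p` as a bilinear map. -/
def csum (P : FGPMod R) : Module.Dual A P.S →ₗ[k] P.S →ₗ[k] CircSummand P :=
  TensorProduct.mk k (Module.Dual A P.S) P.S

/-- `⊕_P P^* ⊗ P`, the sum over the right `R`-modules `P` with finitely generated projective
underlying `A`-module. -/
abbrev CircPre := DirectSum (FGPMod R) (CircSummand (R := R))

variable {R} in
/-- The element `φ ⊗ p` of the summand `P`. -/
def cpre (P : FGPMod R) (φ : Module.Dual A P.S) (p : P.S) : CircPre R :=
  DirectSum.lof k (FGPMod R) CircSummand P (csum P φ p)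

/-- The span of the elements `ψ ⊗ t p - ψ t ⊗ p` for `t : P → Q` an `R`-linear map. -/
def circRel : Submodule k (CircPre R) :=
  Submodule.span k {z | ∃ (P Q : FGPMod R) (t : P.S →ₗ[A] Q.S) (ψ : Module.Dual A Q.S) (p : P.S),
    FGPMod.IsLin t ∧ z = cpre Q ψ (t p) - cpre P (ψ.comp t) p}

abbrev CircCarrier := CircPre R ⧸ circRel R

variable {R} in
/-- The class of `φ ⊗ p` in `R°`. -/
def cmk (P : FGPMod R) (φ : Module.Dual A P.S) (p : P.S) : CircCarrier R :=
  (circRel R).mkQ (cpre P φ p)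

variable {R} in
theorem cmk_rel {P Q : FGPMod R} (t : P.S →ₗ[A] Q.S) (ht : FGPMod.IsLin t)
    (ψ : Module.Dual A Q.S) (p : P.S) : cmk Q ψ (t p) = cmk P (ψ.comp t) p := by
  unfold cmk
  rw [← sub_eq_zero, ← map_sub]
  exact (Submodule.Quotient.mk_eq_zero _).2 (Submodule.subset_span ⟨P, Q, t, ψ, p, ht, rfl⟩)

variable {R} in
/-- The map out of `P^* ⊗ P` induced by a bilinear map. -/
def csumLift {V : Type*} [AddCommGroup V] [Module k V] (P : FGPMod R)
    (f : Module.Dual A P.S →ₗ[k] P.S →ₗ[k] V) : CircSummand P →ₗ[k] V :=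
  TensorProduct.lift f

variable {R} in
@[simp] theorem csumLift_csum {V : Type*} [AddCommGroup V] [Module k V] (P : FGPMod R)
    (f : Module.Dual A P.S →ₗ[k] P.S →ₗ[k] V) (φ : Module.Dual A P.S) (p : P.S) :
    csumLift P f (csum P φ p) = f φ p := TensorProduct.lift.tmul _ _

variable {R} in
theorem csum_hom_ext {V : Type*} [AddCommGroup V] [Module k V] {P : FGPMod R}
    {f g : CircSummand P →ₗ[k] V} (h : ∀ φ p, f (csum P φ p) = g (csum P φ p)) : f = g :=
  TensorProduct.ext' h

variable {R} in
/-- The family of bilinear maps `f` is compatible with `R`-linear maps. -/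
structure IsNatFam {V : Type*} [AddCommGroup V] [Module k V]
    (f : ∀ P : FGPMod R, Module.Dual A P.S →ₗ[k] P.S →ₗ[k] V) : Prop where
  nat : ∀ (P Q : FGPMod R) (t : P.S →ₗ[A] Q.S) (ψ : Module.Dual A Q.S) (p : P.S),
    FGPMod.IsLin t → f Q ψ (t p) = f P (ψ.comp t) p

variable {R} in
/-- The map out of `R°` induced by a natural family of bilinear maps. -/
def circLift {V : Type*} [AddCommGroup V] [Module k V]
    (f : ∀ P : FGPMod R, Module.Dual A P.S →ₗ[k] P.S →ₗ[k] V)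
    (h : IsNatFam f) : CircCarrier R →ₗ[k] V :=
  (circRel R).liftQ (DirectSum.toModule k _ _ fun P => csumLift P (f P)) (by
    rw [circRel, Submodule.span_le]
    rintro _ ⟨P, Q, t, ψ, p, ht, rfl⟩
    simp [cpre, h.nat P Q t ψ p ht])

variable {R} in
@[simp] theorem circLift_cmk {V : Type*} [AddCommGroup V] [Module k V]
    (f : ∀ P : FGPMod R, Module.Dual A P.S →ₗ[k] P.S →ₗ[k] V)
    (h : IsNatFam f)
    (P : FGPMod R) (φ : Module.Dual A P.S) (p : P.S) :
    circLift f h (cmk P φ p) = f P φ p := by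
  simp [circLift, cmk, cpre]

variable {R} in
theorem circ_hom_ext {V : Type*} [AddCommGroup V] [Module k V] {f g : CircCarrier R →ₗ[k] V}
    (h : ∀ P φ p, f (cmk P φ p) = g (cmk P φ p)) : f = g := by
  apply Submodule.linearMap_qext
  apply DirectSum.linearMap_ext
  intro P
  exact csum_hom_ext fun φ p => h P φ p

variable {R} in
/-- `(φ, p) ↦` the class of `φ ⊗ p`, as a bilinear map. -/
def cmkL (P : FGPMod R) : Module.Dual A P.S →ₗ[k] P.S →ₗ[k] CircCarrier R :=
  (csum P).compr₂ ((circRel R).mkQ.comp (DirectSum.lof k (FGPMod R) CircSummand P))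

variable {R} in
@[simp] theorem cmkL_apply (P : FGPMod R) (φ : Module.Dual A P.S) (p : P.S) :
    cmkL P φ p = cmk P φ p := rfl

theorem circL_nat (a : A) : IsNatFam (R := R)
    (fun P => (cmkL P).comp (Algebra.lsmul k k (Module.Dual A P.S) a)) :=
  ⟨fun _ _ t ψ p ht => cmk_rel t ht (a • ψ) p⟩

theorem circR_nat (a : A) : IsNatFam (R := R)
    (fun P => (cmkL P).compl₂ (Algebra.lsmul k k P.S a)) :=
  ⟨fun P Q t ψ p ht => by
    change cmk Q ψ (a • t p) = cmk P (ψ.comp t) (a • p)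
    rw [← map_smul, cmk_rel t ht]⟩

/-- The left action `a (φ ⊗ p) = a φ ⊗ p` on `R°`. -/
def circL : Act k A (CircCarrier R) :=
  let F : A → Module.End k (CircCarrier R) := fun a => circLift _ (circL_nat R a)
  have hF : ∀ a (P : FGPMod R) φ p, F a (cmk P φ p) = cmk P (a • φ) p :=
    fun a P φ p => circLift_cmk _ _ P φ p
  AlgHom.ofLinearMap
    { toFun := F
      map_add' := fun a b => circ_hom_ext fun P φ p => by
        rw [LinearMap.add_apply, hF, hF, hF, add_smul]
        exact (cmkL P).map_add₂ _ _ _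
      map_smul' := fun c a => circ_hom_ext fun P φ p => by
        rw [LinearMap.smul_apply, hF, hF, smul_assoc]
        exact (cmkL P).map_smul₂ _ _ _ }
    (circ_hom_ext fun P φ p => (hF 1 P φ p).trans (by rw [one_smul]; rfl))
    (fun a b => circ_hom_ext fun P φ p => by
      change F (a * b) _ = F a (F b _)
      rw [hF, hF, hF, mul_smul])

@[simp] theorem circL_cmk (a : A) (P : FGPMod R) (φ : Module.Dual A P.S) (p : P.S) :
    circL R a (cmk P φ p) = cmk P (a • φ) p := circLift_cmk _ (circL_nat R a) P φ p

/-- The right action `(φ ⊗ p) b = φ ⊗ p b` on `R°`. -/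
def circR : Act k A (CircCarrier R) :=
  let F : A → Module.End k (CircCarrier R) := fun a => circLift _ (circR_nat R a)
  have hF : ∀ a (P : FGPMod R) φ p, F a (cmk P φ p) = cmk P φ (a • p) :=
    fun a P φ p => circLift_cmk _ _ P φ p
  AlgHom.ofLinearMap
    { toFun := F
      map_add' := fun a b => circ_hom_ext fun P φ p => by
        rw [LinearMap.add_apply, hF, hF, hF, add_smul]
        exact (cmkL P φ).map_add _ _
      map_smul' := fun c a => circ_hom_ext fun P φ p => by
        rw [LinearMap.smul_apply, hF, hF, smul_assoc]
        exact (cmkL P φ).map_smul _ _ }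
    (circ_hom_ext fun P φ p => (hF 1 P φ p).trans (by rw [one_smul]; rfl))
    (fun a b => circ_hom_ext fun P φ p => by
      change F (a * b) _ = F a (F b _)
      rw [hF, hF, hF, mul_smul])

@[simp] theorem circR_cmk (b : A) (P : FGPMod R) (φ : Module.Dual A P.S) (p : P.S) :
    circR R b (cmk P φ p) = cmk P φ (b • p) := circLift_cmk _ (circR_nat R b) P φ p

/-- The `A`-bimodule `R°`, the quotient of `⊕_P P^* ⊗ P` by the elements
`ψ ⊗ t p - ψ t ⊗ p`, with the actions `a (φ ⊗ p) b = a φ ⊗ p b`. -/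
abbrev circ : ABimod k A where
  carrier := CircCarrier R
  l := circL R
  r := circR R
  comm := fun a b x => by
    have : (circL R a).comp (circR R b) = (circR R b).comp (circL R a) :=
      circ_hom_ext fun P φ p => by
        simp only [LinearMap.comp_apply, circL_cmk, circR_cmk]
    exact congrArg (fun g => g x) this

/-- The canonical map `ζ : R° → R^*`, `φ ⊗ p ↦ [x ↦ φ(p x)]`. -/
def zeta : (circ R).carrier →ₗ[k] R.RDual :=
  circLift
    (fun P => LinearMap.mk₂ k
      (fun φ p => (⟨(φ.restrictScalars k).comp (P.act p), fun x a => by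
        simp [FGPMod.act_r, mul_comm]⟩ : R.RDual))
      (fun _ _ _ => by apply Subtype.ext; ext x; simp)
      (fun _ _ _ => by apply Subtype.ext; ext x; simp)
      (fun _ _ _ => by apply Subtype.ext; ext x; simp)
      (fun _ _ _ => by apply Subtype.ext; ext x; simp))
    ⟨fun P Q t ψ p ht => by apply Subtype.ext; ext x; simp [ht p x]⟩

end Circ

section Tannaka

variable (U : CCHopf k A)

/-- `Z` is, through the isomorphism `θ`, the base algebra `A` with the `U`-action
`a · u = ε(a u)`. -/
def IsUnitMod (Z : FGPMod U.toARing) (θ : A ≃ₗ[A] Z.S) : Prop :=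
  ∀ a u, Z.act (θ a) u = θ (U.counit (U.s a * u))

/-- The map `u ⊗ v ↦ (x u) ⊗ (y v)`. -/
def tensorPair {X Y : FGPMod U.toARing} (x : X.S) (y : Y.S) : U.TRR →ₗ[k] X.S ⊗[A] Y.S :=
  Bal.lift
    (LinearMap.mk₂ k (fun u v => X.act x u ⊗ₜ[A] Y.act y v)
      (by intros; simp [TensorProduct.add_tmul])
      (by intros; simp [TensorProduct.smul_tmul'])
      (by intros; simp [TensorProduct.tmul_add])
      (by intros; simp))
    ⟨fun a u v => by
      change X.act x (u * U.s a) ⊗ₜ[A] Y.act y v = X.act x u ⊗ₜ[A] Y.act y (v * U.s a)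
      rw [FGPMod.act_r, FGPMod.act_r, TensorProduct.smul_tmul]⟩

/-- `Z` is, through the isomorphism `θ`, the tensor product `X ⊗_A Y` with the `U`-action
`(x ⊗ y) · u = (x · u₁) ⊗ (y · u₂)`. -/
def IsTensorMod (X Y Z : FGPMod U.toARing) (θ : X.S ⊗[A] Y.S ≃ₗ[A] Z.S) : Prop :=
  ∀ x y u, Z.act (θ (x ⊗ₜ y)) u = θ (tensorPair U x y (U.comul u))

/-- The right `A`-linear map `v ↦ φ(x v)` on `U`. -/
def coeff {X : FGPMod U.toARing} (φ : Module.Dual A X.S) (x : X.S) : U.RDual :=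
  ⟨(φ.restrictScalars k).comp (X.act x), fun v a => by simp [FGPMod.act_r, mul_comm]⟩

/-- `Z` is, through the isomorphism `θ`, the dual `X^*` with the `U`-action
`(φ · u)(x) = ε(φ(x · u₋) u₊)`. -/
def IsDualMod (X Z : FGPMod U.toARing) (θ : Module.Dual A X.S ≃ₗ[A] Z.S) : Prop :=
  ∀ φ u x, θ.symm (Z.act (θ φ) u) x = U.antiPair (coeff U φ x) (U.transl u)

/-- The Hopf algebroid structure of the finite dual `U°` obtained by Tannaka reconstruction:
`ε(φ ⊗ x) = φ(x)`, `Δ(φ ⊗ x) = Σ (φ ⊗ eᵢ) ⊗_A (eᵢ^* ⊗ x)` for any dual basis `(eᵢ, eᵢ^*)`,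
the unit is `id ⊗ 1` (at the unit module `A`), the product of `φ ⊗ x` and `ψ ⊗ y` is
`(φ ⊗ ψ) ⊗ (x ⊗ y)` (at `X ⊗_A Y`), and `S(φ ⊗ x) = ev_x ⊗ φ` (at `X^*`). -/
structure IsTannaka (c : CoringStr (circ U.toARing)) (H : HopfStr ⟨circ U.toARing, c⟩) : Prop where
  counit : ∀ (X : FGPMod U.toARing) φ x, c.counit (cmk X φ x) = φ x
  comul : ∀ (X : FGPMod U.toARing) φ x (m : ℕ) (e : Fin m → X.S) (e' : Fin m → Module.Dual A X.S),
    (∀ y, ∑ i, e' i y • e i = y) →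
      c.comul (cmk X φ x) =
        ∑ i, bt (circ U.toARing).r (circ U.toARing).l (cmk X φ (e i)) (cmk X (e' i) x)
  one : ∃ (Z : FGPMod U.toARing) (θ : A ≃ₗ[A] Z.S), IsUnitMod U Z θ ∧
    H.one = cmk Z θ.symm.toLinearMap (θ 1)
  mul : ∀ (X Y : FGPMod U.toARing) φ ψ x y,
    ∃ (Z : FGPMod U.toARing) (θ : X.S ⊗[A] Y.S ≃ₗ[A] Z.S), IsTensorMod U X Y Z θ ∧
      H.mul (cmk X φ x) (cmk Y ψ y) =
        cmk Z ((LinearMap.mul' A A).comp ((TensorProduct.map φ ψ).comp θ.symm.toLinearMap))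
          (θ (x ⊗ₜ y))
  antipode : ∀ (X : FGPMod U.toARing) φ x,
    ∃ (Z : FGPMod U.toARing) (θ : Module.Dual A X.S ≃ₗ[A] Z.S), IsDualMod U X Z θ ∧
      H.S (cmk X φ x) = cmk Z ((Module.Dual.eval A X.S x).comp θ.symm.toLinearMap) (θ φ)

end Tannaka

end HAlgd

end

/-!
The coring `R^•` and everything about it come from a universal property. By currying, a map of
`A`-rings `R → ^*C` is the same as a map `C → R^*` satisfying `(ζ)` (`ofZeta`, `toRDual`), so that a
left adjoint of `^*(-)` at `R` is a terminal object among the corings `C` equipped with such a map,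
the *corings over `R^*`*. This property is called `IsUniv`.

*Existence.* The corings over `R^*` have coproducts and quotients by coideals. If a set of them
covers all of them, the quotient of the coproduct of this set by its largest coideal is terminal
(`exists_isUniv_of_cover`). Such a set exists by a size argument (`SmallOver.cover`): closing an
element of a coring under the operations, the components of `Δ`, and witnesses for the relations
that hold in `C ⊗_A C` and `C ⊗_A C ⊗_A C` gives a subbimodule `D` such that `D ⊗_A D` and
`D ⊗_A D ⊗_A D` embed into those of `C`; hence `D` is a coring, and it is a quotient of a fixed set
of terms. No flatness over `A` is needed.

*Bisimulation.* A terminal coring has no nonzero coideals, because the quotient by a coideal would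
map back. This gives the principle `IsUniv.bisim`: two families of elements of `U^•` are equal if
they agree under `ξ` and their comultiplications agree modulo the identification of the two
families. It replaces the injectivity of `ξ`, which is not available, and proves all the identities
of the Hopf algebroid structure on `U^•` from those of `U^*`.

*Structure.* The product of `U^•` is induced by the convolution product of `U^*`, from the coring
`U^• ⊙ U^•`, the tensor product over `A ⊗ A` (`IsUniv.exists_mul`); the antipode by
`φ ↦ [u ↦ ε(φ(u₋) u₊)]`, from the co-opposite coring (`IsUniv.exists_antipode`); the unit is the
image of the unit of `U°`. The identity `S(x₁) x₂ = t(ε(x))` (`IsUniv.antipode_mul`) rests on the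
invariance of the evaluation of the dual of a module. A coring map into `U^•` whose composite with
`ξ` is an algebra map is a morphism of Hopf algebroids (`IsUniv.exists_chopfHom`); this contains the
uniqueness of the structure, the universal property, and the functoriality.

*The finite dual.* The operations of `U°` are those of matrix coefficients: the duals, tensor
products and the unit of the category of right `U`-modules give the antipode, the product and the
unit, and all identities come from `U`-linear maps between such modules (`circHopf`). To compare it
with `U^•`, it is enough to know when `U°` is itself terminal. If `U_A` is finitely generated and
projective, `ζ` is bijective, since every matrix coefficient comes from the regular module
(`isUniv_circ_of_finite`). If `A` is a field, every element of a coring over `U^*` lies in a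
finite-dimensional submodule, whose matrix coefficients provide the map to `U°`
(`isUniv_circ_of_isField`).
-/

noncomputable section

namespace HAlgd

/-! ### Balanced tensor products -/

section Balanced

variable {k A M N P M' N' P' M'' N'' P'' : Type*} [Field k] [CommRing A] [Algebra k A]
variable [AddCommGroup M] [Module k M] [AddCommGroup N] [Module k N]
variable [AddCommGroup P] [Module k P] [AddCommGroup M'] [Module k M']
variable [AddCommGroup N'] [Module k N'] [AddCommGroup P'] [Module k P']
variable [AddCommGroup M''] [Module k M''] [AddCommGroup N''] [Module k N'']
variable [AddCommGroup P''] [Module k P'']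

@[simp] theorem bt_zero_left (ρ : Act k A M) (σ : Act k A N) (n : N) : bt ρ σ 0 n = 0 := by
  simp [bt]

@[simp] theorem bt_zero_right (ρ : Act k A M) (σ : Act k A N) (m : M) : bt ρ σ m 0 = 0 := by
  simp [bt]

theorem bt_sum_left {ι : Type*} (s : Finset ι) (ρ : Act k A M) (σ : Act k A N) (f : ι → M)
    (n : N) : bt ρ σ (∑ i ∈ s, f i) n = ∑ i ∈ s, bt ρ σ (f i) n := by
  rw [← btL_apply, map_sum, LinearMap.sum_apply]; rfl

theorem bt_sum_right {ι : Type*} (s : Finset ι) (ρ : Act k A M) (σ : Act k A N) (m : M)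
    (f : ι → N) : bt ρ σ m (∑ i ∈ s, f i) = ∑ i ∈ s, bt ρ σ m (f i) := by
  rw [← btL_apply, map_sum]; rfl

theorem Bal.exists_sum {ρ : Act k A M} {σ : Act k A N} (z : Bal ρ σ) :
    ∃ (n : ℕ) (x : Fin n → M) (y : Fin n → N), z = ∑ i, bt ρ σ (x i) (y i) := by
  induction z using Bal.ind with
  | h0 => exact ⟨0, Fin.elim0, Fin.elim0, by simp⟩
  | ht m n => exact ⟨1, fun _ => m, fun _ => n, by simp⟩
  | ha x y hx hy =>
    obtain ⟨n, a, b, rfl⟩ := hx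
    obtain ⟨n', a', b', rfl⟩ := hy
    exact ⟨n + n', Fin.append a a', Fin.append b b', by simp [Fin.sum_univ_add]⟩

theorem Bal.map_map {ρ : Act k A M} {σ : Act k A N} {ρ' : Act k A M'} {σ' : Act k A N'}
    {ρ'' : Act k A M''} {σ'' : Act k A N''} {f : M →ₗ[k] M'} {g : N →ₗ[k] N'}
    (hf : IsALin ρ ρ' f) (hg : IsALin σ σ' g) {f' : M' →ₗ[k] M''} {g' : N' →ₗ[k] N''}
    (hf' : IsALin ρ' ρ'' f') (hg' : IsALin σ' σ'' g') (z : Bal ρ σ) :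
    Bal.map f' g' hf' hg' (Bal.map f g hf hg z) =
      Bal.map (f'.comp f) (g'.comp g) ⟨fun a m => by simp [hf.lin, hf'.lin]⟩
        ⟨fun a m => by simp [hg.lin, hg'.lin]⟩ z := by
  induction z using Bal.ind with
  | h0 => simp
  | ht m n => simp
  | ha x y hx hy => simp only [map_add, hx, hy]

/-- The map `(m ⊗ n, m' ⊗ n') ↦ f(m, m') ⊗ g(n, n')` induced by two bilinear maps which are
`A`-linear in each variable. -/
def Bal.bilMap {ρ : Act k A M} {σ : Act k A N} {ρ' : Act k A M'} {σ' : Act k A N'}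
    {ρ'' : Act k A M''} {σ'' : Act k A N''} (f : M →ₗ[k] M' →ₗ[k] M'') (g : N →ₗ[k] N' →ₗ[k] N'')
    (hf : ∀ a m m', f (ρ a m) m' = ρ'' a (f m m'))
    (hf' : ∀ a m m', f m (ρ' a m') = ρ'' a (f m m'))
    (hg : ∀ a n n', g (σ a n) n' = σ'' a (g n n'))
    (hg' : ∀ a n n', g n (σ' a n') = σ'' a (g n n')) :
    Bal ρ σ →ₗ[k] Bal ρ' σ' →ₗ[k] Bal ρ'' σ'' :=
  Bal.lift
    (LinearMap.mk₂ k
      (fun m n => Bal.map (f m) (g n) ⟨fun a => hf' a m⟩ ⟨fun a => hg' a n⟩)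
      (fun _ _ _ => Bal.hom_ext fun _ _ => by simp [bt_add_left])
      (fun _ _ _ => Bal.hom_ext fun _ _ => by simp [bt_smul_left])
      (fun _ _ _ => Bal.hom_ext fun _ _ => by simp [bt_add_right])
      (fun _ _ _ => Bal.hom_ext fun _ _ => by simp [bt_smul_right]))
    ⟨fun a m n => Bal.hom_ext fun _ _ => by simp [hf, hg, bt_bal]⟩

@[simp] theorem Bal.bilMap_bt {ρ : Act k A M} {σ : Act k A N} {ρ' : Act k A M'} {σ' : Act k A N'}
    {ρ'' : Act k A M''} {σ'' : Act k A N''} (f : M →ₗ[k] M' →ₗ[k] M'') (g : N →ₗ[k] N' →ₗ[k] N'')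
    (hf : ∀ a m m', f (ρ a m) m' = ρ'' a (f m m'))
    (hf' : ∀ a m m', f m (ρ' a m') = ρ'' a (f m m'))
    (hg : ∀ a n n', g (σ a n) n' = σ'' a (g n n'))
    (hg' : ∀ a n n', g n (σ' a n') = σ'' a (g n n')) (m : M) (n : N) (m' : M') (n' : N') :
    Bal.bilMap f g hf hf' hg hg' (bt ρ σ m n) (bt ρ' σ' m' n') = bt ρ'' σ'' (f m m') (g n n') := by
  simp [Bal.bilMap]

end Balanced

variable {k A : Type u} [Field k] [CommRing A] [Algebra k A]

/-! ### Bimodule maps and constructions of corings -/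

/-- Maps of `A`-bimodules. -/
structure BiLin (M N : ABimod k A) where
  toLin : M.carrier →ₗ[k] N.carrier
  map_l : ∀ a x, toLin (M.l a x) = N.l a (toLin x)
  map_r : ∀ a x, toLin (M.r a x) = N.r a (toLin x)

namespace BiLin

variable {M N Q : ABimod k A}

/-- The composite of two maps of bimodules. -/
def comp (q : BiLin N Q) (p : BiLin M N) : BiLin M Q where
  toLin := q.toLin.comp p.toLin
  map_l a x := by simp [p.map_l, q.map_l]
  map_r a x := by simp [p.map_r, q.map_r]

/-- The map `p ⊗_A p`. -/
def bal (p : BiLin M N) : Bal M.r M.l →ₗ[k] Bal N.r N.l :=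
  Bal.map p.toLin p.toLin ⟨p.map_r⟩ ⟨p.map_l⟩

@[simp] theorem bal_bt (p : BiLin M N) (x y : M.carrier) :
    p.bal (bt M.r M.l x y) = bt N.r N.l (p.toLin x) (p.toLin y) := by simp [bal]

theorem bal_comp (q : BiLin N Q) (p : BiLin M N) (z : Bal M.r M.l) :
    (q.comp p).bal z = q.bal (p.bal z) := (Bal.map_map _ _ _ _ z).symm

theorem bal_actL (p : BiLin M N) (a : A) (z : Bal M.r M.l) :
    p.bal (Bal.actL M.l M.l M.comm a z) = Bal.actL N.l N.l N.comm a (p.bal z) := by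
  induction z using Bal.ind with
  | h0 => simp
  | ht m n => simp [p.map_l]
  | ha x y hx hy => simp only [map_add, hx, hy]

theorem bal_actR (p : BiLin M N) (a : A) (z : Bal M.r M.l) :
    p.bal (Bal.actR M.r M.r (fun a b x => (M.comm b a x).symm) a z) =
      Bal.actR N.r N.r (fun a b x => (N.comm b a x).symm) a (p.bal z) := by
  induction z using Bal.ind with
  | h0 => simp
  | ht m n => simp [p.map_r]
  | ha x y hx hy => simp only [map_add, hx, hy]

/-- The map `p ⊗_A (p ⊗_A p)`. -/
def bal3 (p : BiLin M N) : Bal M.r (Bal.actL M.l M.l M.comm) →ₗ[k]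
    Bal N.r (Bal.actL N.l N.l N.comm) :=
  Bal.map p.toLin p.bal ⟨p.map_r⟩ ⟨p.bal_actL⟩

theorem assoc_bal (p : BiLin M N) (z : Bal M.r M.l) (y : M.carrier) :
    Bal.assoc N.r N.l N.r N.l (fun a b x => (N.comm b a x).symm)
      (bt _ N.l (p.bal z) (p.toLin y)) =
    p.bal3 (Bal.assoc M.r M.l M.r M.l (fun a b x => (M.comm b a x).symm) (bt _ M.l z y)) := by
  induction z using Bal.ind with
  | h0 => simp
  | ht m n => simp [bal3]
  | ha x y hx hy => simp only [map_add, bt_add_left, hx, hy]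

end BiLin

/-- A coring map as a map of bimodules. -/
def ACoring.Hom.bi {C D : ACoring k A} (g : C ⟶ D) : BiLin C.toBimod D.toBimod :=
  ⟨g.toLin, g.map_l, g.map_r⟩

theorem ACoring.Hom.comul_bi {C D : ACoring k A} (g : C ⟶ D) (x : C.carrier) :
    D.comul (g.toLin x) = (ACoring.Hom.bi g).bal (C.comul x) := g.comul_map x

section Cover

variable (M : ABimod k A) (Δ : M.carrier →ₗ[k] Bal M.r M.l) (ε : M.carrier →ₗ[k] A)

/-- The images in `M` of the maps from corings that are compatible with `Δ` and `ε`. -/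
def coverSet : Set M.carrier :=
  {x | ∃ (G : ACoring k A) (ι : BiLin G.toBimod M), (∀ g, ε (ι.toLin g) = G.counit g) ∧
    (∀ g, Δ (ι.toLin g) = ι.bal (G.comul g)) ∧ ∃ y, ι.toLin y = x}

variable {M Δ ε}

theorem cover_ext (h : Submodule.span k (coverSet M Δ ε) = ⊤) {V : Type*} [AddCommGroup V]
    [Module k V] {f g : M.carrier →ₗ[k] V}
    (hfg : ∀ (G : ACoring k A) (ι : BiLin G.toBimod M), (∀ g, ε (ι.toLin g) = G.counit g) →
      (∀ g, Δ (ι.toLin g) = ι.bal (G.comul g)) → ∀ y, f (ι.toLin y) = g (ι.toLin y))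
    (x : M.carrier) : f x = g x := by
  have : f = g := LinearMap.ext_on h (by
    rintro _ ⟨G, ι, h1, h2, y, rfl⟩
    exact hfg G ι h1 h2 y)
  rw [this]

/-- A comultiplication and a counit on a bimodule make it a coring as soon as the bimodule is
spanned by the images of compatible maps from corings. -/
def coringOfCover (h : Submodule.span k (coverSet M Δ ε) = ⊤) : CoringStr M :=
  have hl : ∀ a x, Δ (M.l a x) = Bal.actL M.l M.l M.comm a (Δ x) := fun a x =>
    cover_ext h (f := Δ.comp (M.l a)) (g := (Bal.actL M.l M.l M.comm a).comp Δ)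
      (fun G ι _ h2 y => by
        simp only [LinearMap.comp_apply]
        rw [← ι.map_l, h2, h2, G.str.comul_l, ι.bal_actL]) x
  have hr : ∀ a x, Δ (M.r a x) =
      Bal.actR M.r M.r (fun a b x => (M.comm b a x).symm) a (Δ x) := fun a x =>
    cover_ext h (f := Δ.comp (M.r a))
      (g := (Bal.actR M.r M.r (fun a b x => (M.comm b a x).symm) a).comp Δ)
      (fun G ι _ h2 y => by
        simp only [LinearMap.comp_apply]
        rw [← ι.map_r, h2, h2, G.str.comul_r, ι.bal_actR]) x
  have el : ∀ a x, ε (M.l a x) = a * ε x := fun a x =>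
    cover_ext h (f := ε.comp (M.l a)) (g := (LinearMap.mulLeft k a).comp ε)
      (fun G ι h1 _ y => by
        simp only [LinearMap.comp_apply, LinearMap.mulLeft_apply]
        rw [← ι.map_l, h1, h1, G.str.counit_l]) x
  have er : ∀ a x, ε (M.r a x) = ε x * a := fun a x =>
    cover_ext h (f := ε.comp (M.r a)) (g := (LinearMap.mulRight k a).comp ε)
      (fun G ι h1 _ y => by
        simp only [LinearMap.comp_apply, LinearMap.mulRight_apply]
        rw [← ι.map_r, h1, h1, G.str.counit_r]) x
  { comul := Δ
    counit := ε
    comul_l := hl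
    comul_r := hr
    counit_l := el
    counit_r := er
    coassoc := fun x =>
      cover_ext h
        (f := (Bal.assoc M.r M.l M.r M.l (fun a b x => (M.comm b a x).symm)).comp
          ((Bal.map Δ LinearMap.id ⟨hr⟩ ⟨fun _ _ => rfl⟩).comp Δ))
        (g := (Bal.map LinearMap.id Δ ⟨fun _ _ => rfl⟩ ⟨hl⟩).comp Δ)
        (fun G ι _ h2 y => by
          simp only [LinearMap.comp_apply]
          have e1 : ∀ z, Bal.assoc M.r M.l M.r M.l (fun a b x => (M.comm b a x).symm)
              (Bal.map Δ LinearMap.id ⟨hr⟩ ⟨fun _ _ => rfl⟩ (ι.bal z)) =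
              ι.bal3 (Bal.assoc G.r G.l G.r G.l (fun a b x => (G.toBimod.comm b a x).symm)
                (Bal.map G.comul LinearMap.id ⟨G.str.comul_r⟩ ⟨fun _ _ => rfl⟩ z)) := by
            intro z
            induction z using Bal.ind with
            | h0 => simp
            | ht m n =>
              rw [ι.bal_bt, Bal.map_bt, Bal.map_bt, h2]
              exact ι.assoc_bal _ _
            | ha x y hx hy => simp only [map_add, hx, hy]
          have e2 : ∀ z, Bal.map LinearMap.id Δ ⟨fun _ _ => rfl⟩ ⟨hl⟩ (ι.bal z) =
              ι.bal3 (Bal.map LinearMap.id G.comul ⟨fun _ _ => rfl⟩ ⟨G.str.comul_l⟩ z) := by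
            intro z
            induction z using Bal.ind with
            | h0 => simp
            | ht m n =>
              rw [ι.bal_bt, Bal.map_bt, Bal.map_bt, h2]
              simp [BiLin.bal3]
            | ha x y hx hy => simp only [map_add, hx, hy]
          rw [h2, e1, e2]
          exact congrArg ι.bal3 (G.str.coassoc y)) x
    counit_comul := fun x =>
      cover_ext h
        (f := (Bal.lift (P := M.carrier) (M.l.toLinearMap.comp ε)
          ⟨fun a m n => by simp [er]⟩).comp Δ) (g := LinearMap.id)
        (fun G ι h1 h2 y => by
          simp only [LinearMap.comp_apply, LinearMap.id_apply]
          conv_rhs => rw [← G.str.counit_comul y]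
          rw [h2]
          generalize G.str.comul y = z
          induction z using Bal.ind with
          | h0 => simp
          | ht m n => simp [h1, ι.map_l]
          | ha x y hx hy => simp only [map_add, hx, hy]) x
    comul_counit := fun x =>
      cover_ext h
        (f := (Bal.lift (P := M.carrier) (M.r.toLinearMap.comp ε).flip
          ⟨fun a m n => by simp [el, mul_comm a]⟩).comp Δ) (g := LinearMap.id)
        (fun G ι h1 h2 y => by
          simp only [LinearMap.comp_apply, LinearMap.id_apply]
          conv_rhs => rw [← G.str.comul_counit y]
          rw [h2]
          generalize G.str.comul y = z
          induction z using Bal.ind with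
          | h0 => simp
          | ht m n => simp [h1, ι.map_r]
          | ha x y hx hy => simp only [map_add, hx, hy]) x }

end Cover

/-- A bimodule with an injective map `ι` to a coring such that `ι ⊗ ι` and `ι ⊗ ι ⊗ ι` are
injective and the comultiplication restricts is itself a coring, and `ι` is a coring map. -/
theorem exists_coringOfInj {C : ACoring k A} {M : ABimod k A} (ι : BiLin M C.toBimod)
    (h1 : Function.Injective ι.toLin) (h2 : Function.Injective ι.bal)
    (h3 : Function.Injective ι.bal3) (h : ∀ x, ∃ z, ι.bal z = C.comul (ι.toLin x)) :
    ∃ (c : CoringStr M) (g : (⟨M, c⟩ : ACoring k A) ⟶ C), g.toLin = ι.toLin := by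
  let Δ : M.carrier →ₗ[k] Bal M.r M.l :=
    (LinearEquiv.ofInjective ι.bal h2).symm.toLinearMap.comp
      ((C.comul.comp ι.toLin).codRestrict (LinearMap.range ι.bal) h)
  have hΔ : ∀ x, ι.bal (Δ x) = C.comul (ι.toLin x) := fun x => by
    have := LinearEquiv.apply_symm_apply (LinearEquiv.ofInjective ι.bal h2)
      (((C.comul.comp ι.toLin).codRestrict (LinearMap.range ι.bal) h) x)
    exact congrArg Subtype.val this
  have hl : ∀ a x, Δ (M.l a x) = Bal.actL M.l M.l M.comm a (Δ x) := fun a x => h2 (by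
    rw [hΔ, ι.map_l, C.str.comul_l, ι.bal_actL, hΔ])
  have hr : ∀ a x, Δ (M.r a x) =
      Bal.actR M.r M.r (fun a b x => (M.comm b a x).symm) a (Δ x) := fun a x => h2 (by
    rw [hΔ, ι.map_r, C.str.comul_r, ι.bal_actR, hΔ])
  have el : ∀ a x, C.counit (ι.toLin (M.l a x)) = a * C.counit (ι.toLin x) := fun a x => by
    rw [ι.map_l, C.str.counit_l]
  have er : ∀ a x, C.counit (ι.toLin (M.r a x)) = C.counit (ι.toLin x) * a := fun a x => by
    rw [ι.map_r, C.str.counit_r]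
  refine ⟨
    { comul := Δ
      counit := C.counit.comp ι.toLin
      comul_l := hl
      comul_r := hr
      counit_l := el
      counit_r := er
      coassoc := fun x => h3 ?_
      counit_comul := fun x => h1 ?_
      comul_counit := fun x => h1 ?_ },
    { toLin := ι.toLin
      map_l := ι.map_l
      map_r := ι.map_r
      counit_map := fun x => rfl
      comul_map := fun x => (hΔ x).symm }, rfl⟩
  · have e1 : ∀ z, ι.bal3 (Bal.assoc M.r M.l M.r M.l (fun a b x => (M.comm b a x).symm)
        (Bal.map Δ LinearMap.id ⟨hr⟩ ⟨fun _ _ => rfl⟩ z)) =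
        (Bal.assoc C.r C.l C.r C.l (fun a b x => (C.toBimod.comm b a x).symm)
          (Bal.map C.comul LinearMap.id ⟨C.str.comul_r⟩ ⟨fun _ _ => rfl⟩ (ι.bal z))) := by
      intro z
      induction z using Bal.ind with
      | h0 => simp
      | ht m n =>
        rw [ι.bal_bt, Bal.map_bt, Bal.map_bt, ← hΔ]
        exact (ι.assoc_bal _ _).symm
      | ha x y hx hy => simp only [map_add, hx, hy]
    have e2 : ∀ z, ι.bal3 (Bal.map LinearMap.id Δ ⟨fun _ _ => rfl⟩ ⟨hl⟩ z) =
        (Bal.map LinearMap.id C.comul ⟨fun _ _ => rfl⟩ ⟨C.str.comul_l⟩ (ι.bal z)) := by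
      intro z
      induction z using Bal.ind with
      | h0 => simp
      | ht m n =>
        rw [ι.bal_bt, Bal.map_bt, Bal.map_bt]
        simp [BiLin.bal3, hΔ]
      | ha x y hx hy => simp only [map_add, hx, hy]
    rw [e1, e2, hΔ]
    exact C.str.coassoc _
  · conv_rhs => rw [← C.str.counit_comul (ι.toLin x)]
    change _ = Bal.lift _ _ (C.comul (ι.toLin x))
    rw [← hΔ]
    generalize Δ x = z
    induction z using Bal.ind with
    | h0 => simp
    | ht m n => simp [ι.map_l]
    | ha x y hx hy => simp only [map_add, hx, hy]
  · conv_rhs => rw [← C.str.comul_counit (ι.toLin x)]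
    change _ = Bal.lift _ _ (C.comul (ι.toLin x))
    rw [← hΔ]
    generalize Δ x = z
    induction z using Bal.ind with
    | h0 => simp
    | ht m n => simp [ι.map_r]
    | ha x y hx hy => simp only [map_add, hx, hy]

/-! ### Coideals, quotients and coproducts of corings over `R^*` -/

theorem exists_linear_factor {M N V : Type*} [AddCommGroup M] [Module k M] [AddCommGroup N]
    [Module k N] [AddCommGroup V] [Module k V] {p : M →ₗ[k] N} (hp : Function.Surjective p)
    (f : M →ₗ[k] V) (h : ∀ x, p x = 0 → f x = 0) : ∃ q : N →ₗ[k] V, ∀ x, q (p x) = f x := by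
  have hker : LinearMap.ker p ≤ LinearMap.ker f := fun y hy => h y hy
  refine ⟨((LinearMap.ker p).liftQ f hker).comp
    (LinearMap.quotKerEquivOfSurjective p hp).symm.toLinearMap, fun y => ?_⟩
  have : (LinearMap.quotKerEquivOfSurjective p hp).symm (p y) = Submodule.Quotient.mk y := by
    rw [LinearEquiv.symm_apply_eq]; rfl
  rw [LinearMap.comp_apply, LinearEquiv.coe_coe, this, Submodule.liftQ_apply]

/-- Bimodule maps out of `M` which kill the kernel of a surjection `p` factor through `p`. -/
theorem BiLin.exists_factor {M N Q : ABimod k A} {p : BiLin M N}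
    (hp : Function.Surjective p.toLin) (f : BiLin M Q)
    (h : ∀ x, p.toLin x = 0 → f.toLin x = 0) : ∃ q : BiLin N Q, q.comp p = f := by
  obtain ⟨q, hq⟩ := exists_linear_factor hp f.toLin h
  refine ⟨
    { toLin := q
      map_l := fun a y => by
        obtain ⟨y, rfl⟩ := hp y
        rw [← p.map_l, hq, hq, f.map_l]
      map_r := fun a y => by
        obtain ⟨y, rfl⟩ := hp y
        rw [← p.map_r, hq, hq, f.map_r] }, ?_⟩
  have : q.comp p.toLin = f.toLin := LinearMap.ext hq
  change BiLin.mk _ _ _ = BiLin.mk _ _ _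
  congr 1

theorem zetaPair_bt {R : ARing k A} {C : ACoring k A} (f : C.carrier →ₗ[k] R.RDual) (hl hr)
    (x y : R.carrier) (z w : C.carrier) :
    zetaPair f hl hr x y (bt C.r C.l z w) = (f z).1 (R.s ((f w).1 x) * y) :=
  Bal.lift_bt _ _ _ _

theorem zetaPair_bal {R : ARing k A} {C D : ACoring k A} (g : C ⟶ D)
    {f : D.carrier →ₗ[k] R.RDual} {f' : C.carrier →ₗ[k] R.RDual}
    (e : ∀ x, f (g.toLin x) = f' x) (hl hr hl' hr') (x y : R.carrier) (z : Bal C.r C.l) :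
    zetaPair f hl hr x y ((ACoring.Hom.bi g).bal z) = zetaPair f' hl' hr' x y z := by
  induction z using Bal.ind with
  | h0 => simp
  | ht m n =>
    rw [BiLin.bal_bt]
    change (f (g.toLin m)).1 (R.s ((f (g.toLin n)).1 x) * y) = (f' m).1 (R.s ((f' n).1 x) * y)
    rw [e, e]
  | ha x y hx hy => simp only [map_add, hx, hy]

theorem ZetaProp.comp {R : ARing k A} {C D : ACoring k A} {f : D.carrier →ₗ[k] R.RDual}
    (hf : ZetaProp f) (g : C ⟶ D) : ZetaProp (C := C) (f.comp g.toLin) :=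
  have hl : ∀ a z u, ((f.comp g.toLin) (C.l a z)).1 u = a * ((f.comp g.toLin) z).1 u := by
    intro a z u; simp only [LinearMap.comp_apply, g.map_l, hf.map_l]
  have hr : ∀ a z u, ((f.comp g.toLin) (C.r a z)).1 u = ((f.comp g.toLin) z).1 (R.s a * u) := by
    intro a z u; simp only [LinearMap.comp_apply, g.map_r, hf.map_r]
  { map_l := hl
    map_r := hr
    map_one := fun z => by rw [LinearMap.comp_apply, hf.map_one, g.counit_map]
    map_mul := fun z x y => by
      rw [LinearMap.comp_apply, hf.map_mul, ACoring.Hom.comul_bi]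
      exact zetaPair_bal g (fun _ => rfl) _ _ _ _ x y _ }

/-- The property `(ζ)` can be checked on a spanning set of images of coring maps. -/
theorem ZetaProp.of_span {R : ARing k A} {D : ACoring k A} {f : D.carrier →ₗ[k] R.RDual}
    {S : Set D.carrier} (hS : Submodule.span k S = ⊤)
    (h : ∀ x ∈ S, ∃ (C : ACoring k A) (g : C ⟶ D) (y : C.carrier),
      ZetaProp (C := C) (f.comp g.toLin) ∧ g.toLin y = x) : ZetaProp f := by
  have hl : ∀ a z u, (f (D.l a z)).1 u = a * (f z).1 u := fun a z u => by
    let ev : R.RDual →ₗ[k] A := (LinearMap.applyₗ u).comp R.RDual.subtype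
    have : (ev.comp f).comp (D.l a) = (LinearMap.mulLeft k a).comp (ev.comp f) :=
      LinearMap.ext_on hS (by
        intro x hx
        obtain ⟨C, g, y, hz, rfl⟩ := h x hx
        have := hz.map_l a y u
        simp only [LinearMap.comp_apply, g.map_l] at this
        exact this)
    exact LinearMap.congr_fun this z
  have hr : ∀ a z u, (f (D.r a z)).1 u = (f z).1 (R.s a * u) := fun a z u => by
    let ev : R.carrier → R.RDual →ₗ[k] A := fun u => (LinearMap.applyₗ u).comp R.RDual.subtype
    have : ((ev u).comp f).comp (D.r a) = ((ev (R.s a * u)).comp f) :=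
      LinearMap.ext_on hS (by
        intro x hx
        obtain ⟨C, g, y, hz, rfl⟩ := h x hx
        have := hz.map_r a y u
        simp only [LinearMap.comp_apply, g.map_r] at this
        exact this)
    exact LinearMap.congr_fun this z
  refine ⟨hl, hr, fun z => ?_, fun z x y => ?_⟩
  · let ev : R.RDual →ₗ[k] A := (LinearMap.applyₗ 1).comp R.RDual.subtype
    have : ev.comp f = D.counit :=
      LinearMap.ext_on hS (by
        intro x hx
        obtain ⟨C, g, y, hz, rfl⟩ := h x hx
        have := hz.map_one y
        rw [← g.counit_map] at this
        exact this)
    exact LinearMap.congr_fun this z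
  · let ev : R.RDual →ₗ[k] A := (LinearMap.applyₗ (x * y)).comp R.RDual.subtype
    have : ev.comp f = (zetaPair f hl hr x y).comp D.comul :=
      LinearMap.ext_on hS (by
        intro w hw
        obtain ⟨C, g, v, hz, rfl⟩ := h w hw
        have := hz.map_mul v x y
        change _ = zetaPair f hl hr x y (D.comul (g.toLin v))
        rw [ACoring.Hom.comul_bi,
          zetaPair_bal g (fun _ => rfl) hl hr hz.map_l hz.map_r]
        exact this)
    exact LinearMap.congr_fun this z

/-- Coideals of a coring `C` that are killed by `f : C → R^*`. The condition on the
comultiplication says that `Δ(J)` vanishes in `C/J ⊗_A C/J`; it is stated for all bimodule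
maps that kill `J`, which makes it visibly monotone in `J`. -/
structure IsCoideal {R : ARing k A} {C : ACoring k A} (f : C.carrier →ₗ[k] R.RDual)
    (J : Submodule k C.carrier) : Prop where
  l_mem : ∀ a, ∀ x ∈ J, C.l a x ∈ J
  r_mem : ∀ a, ∀ x ∈ J, C.r a x ∈ J
  counit : ∀ x ∈ J, C.counit x = 0
  map : ∀ x ∈ J, f x = 0
  comul : ∀ (Q : ABimod k A) (p : BiLin C.toBimod Q), (∀ x ∈ J, p.toLin x = 0) →
    ∀ x ∈ J, p.bal (C.comul x) = 0

/-- There is a largest coideal that is killed by `f`. -/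
theorem isCoideal_sSup {R : ARing k A} {C : ACoring k A} (f : C.carrier →ₗ[k] R.RDual) :
    IsCoideal f (sSup {J | IsCoideal f J}) where
  l_mem a := by
    change sSup _ ≤ Submodule.comap (C.l a) (sSup _)
    exact sSup_le fun J hJ x hx => (le_sSup hJ : J ≤ _) (IsCoideal.l_mem hJ a x hx)
  r_mem a := by
    change sSup _ ≤ Submodule.comap (C.r a) (sSup _)
    exact sSup_le fun J hJ x hx => (le_sSup hJ : J ≤ _) (IsCoideal.r_mem hJ a x hx)
  counit := by
    change _ ≤ LinearMap.ker C.counit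
    exact sSup_le fun J hJ x hx => IsCoideal.counit hJ x hx
  map := by
    change _ ≤ LinearMap.ker f
    exact sSup_le fun J hJ x hx => IsCoideal.map hJ x hx
  comul Q p hp := by
    change _ ≤ LinearMap.ker (p.bal.comp C.comul)
    exact sSup_le fun J hJ x hx =>
      IsCoideal.comul hJ Q p (fun y hy => hp y ((le_sSup hJ : J ≤ _) hy)) x hx

/-- The quotient of a bimodule by a subbimodule. -/
def quotBimod (M : ABimod k A) (J : Submodule k M.carrier) (hl : ∀ a, ∀ x ∈ J, M.l a x ∈ J)
    (hr : ∀ a, ∀ x ∈ J, M.r a x ∈ J) : ABimod k A where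
  carrier := M.carrier ⧸ J
  l := AlgHom.ofLinearMap
    { toFun := fun a => J.mapQ J (M.l a) (hl a)
      map_add' := fun a b => by ext x; simp
      map_smul' := fun c a => by ext x; simp }
    (by ext x; simp) (fun a b => by ext x; simp)
  r := AlgHom.ofLinearMap
    { toFun := fun a => J.mapQ J (M.r a) (hr a)
      map_add' := fun a b => by ext x; simp
      map_smul' := fun c a => by ext x; simp }
    (by ext x; simp) (fun a b => by ext x; simp)
  comm a b x := by
    obtain ⟨x, rfl⟩ := J.mkQ_surjective x
    exact congrArg J.mkQ (M.comm a b x)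

/-- The projection to the quotient bimodule. -/
def quotBimodMk (M : ABimod k A) (J : Submodule k M.carrier) (hl : ∀ a, ∀ x ∈ J, M.l a x ∈ J)
    (hr : ∀ a, ∀ x ∈ J, M.r a x ∈ J) : BiLin M (quotBimod M J hl hr) where
  toLin := J.mkQ
  map_l _ _ := rfl
  map_r _ _ := rfl

/-- The quotient of a coring by a coideal `J` that is killed by `f` is a coring over `R^*`: it is
covered by the coring itself, so that the axioms and `(ζ)` are inherited. -/
theorem IsCoideal.exists_quotient {R : ARing k A} {C : ACoring k A}
    {f : C.carrier →ₗ[k] R.RDual} (hf : ZetaProp f) {J : Submodule k C.carrier}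
    (hJ : IsCoideal f J) :
    ∃ (D : ACoring k A) (π : C ⟶ D) (f' : D.carrier →ₗ[k] R.RDual),
      Function.Surjective π.toLin ∧ (∀ x, π.toLin x = 0 ↔ x ∈ J) ∧
      (∀ x, f' (π.toLin x) = f x) ∧ ZetaProp f' := by
  let M := quotBimod C.toBimod J hJ.l_mem hJ.r_mem
  let p : BiLin C.toBimod M := quotBimodMk C.toBimod J hJ.l_mem hJ.r_mem
  have hp : ∀ x ∈ J, p.toLin x = 0 := fun x hx => (Submodule.Quotient.mk_eq_zero J).2 hx
  let Δ : M.carrier →ₗ[k] Bal M.r M.l :=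
    J.liftQ (p.bal.comp C.comul) (fun x hx => hJ.comul M p hp x hx)
  let ε : M.carrier →ₗ[k] A := J.liftQ C.counit (fun x hx => hJ.counit x hx)
  have hΔ : ∀ x, Δ (p.toLin x) = p.bal (C.comul x) := fun x => J.liftQ_apply _ x
  have hε : ∀ x, ε (p.toLin x) = C.counit x := fun x => J.liftQ_apply _ x
  have hs : Function.Surjective p.toLin := J.mkQ_surjective
  have hc : Submodule.span k (coverSet M Δ ε) = ⊤ := by
    rw [eq_top_iff]
    intro x _
    obtain ⟨y, rfl⟩ := hs x
    exact Submodule.subset_span ⟨C, p, hε, hΔ, y, rfl⟩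
  let D : ACoring k A := ⟨M, coringOfCover hc⟩
  let π : C ⟶ D :=
    { toLin := p.toLin
      map_l := p.map_l
      map_r := p.map_r
      counit_map := hε
      comul_map := hΔ }
  have hJf : ∀ x, π.toLin x = 0 → f x = 0 := fun x hx =>
    hJ.map x ((Submodule.Quotient.mk_eq_zero J).1 hx)
  obtain ⟨f', hf'x⟩ := exists_linear_factor (p := π.toLin) (V := R.RDual) hs f hJf
  have hf' : f'.comp π.toLin = f := LinearMap.ext hf'x
  refine ⟨D, π, f', hs, fun x => Submodule.Quotient.mk_eq_zero J,
    hf'x, ?_⟩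
  refine ZetaProp.of_span (S := Set.univ) (by simp) fun x _ => ?_
  obtain ⟨y, rfl⟩ := hs x
  exact ⟨C, π, y, by rw [hf']; exact hf, rfl⟩

section Coprod

open scoped DirectSum Classical

/-- The direct sum of a family of bimodules. -/
def sumBimod {ι : Type u} (G : ι → ABimod k A) : ABimod k A where
  carrier := ⨁ i, (G i).carrier
  l := AlgHom.ofLinearMap
    { toFun := fun a => DirectSum.lmap fun i => (G i).l a
      map_add' := fun a b => by ext i x : 2; simp [DirectSum.lmap_lof]
      map_smul' := fun c a => by ext i x : 2; simp [DirectSum.lmap_lof] }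
    (by ext i x : 2; simp [DirectSum.lmap_lof])
    (fun a b => by ext i x : 2; simp [DirectSum.lmap_lof])
  r := AlgHom.ofLinearMap
    { toFun := fun a => DirectSum.lmap fun i => (G i).r a
      map_add' := fun a b => by ext i x : 2; simp [DirectSum.lmap_lof]
      map_smul' := fun c a => by ext i x : 2; simp [DirectSum.lmap_lof] }
    (by ext i x : 2; simp [DirectSum.lmap_lof])
    (fun a b => by ext i x : 2; simp [DirectSum.lmap_lof])
  comm a b := by
    have : (DirectSum.lmap fun i => (G i).l a).comp (DirectSum.lmap fun i => (G i).r b) =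
        (DirectSum.lmap fun i => (G i).r b).comp
          (DirectSum.lmap fun i => (G i).l a) := by
      ext i x : 2
      simp [DirectSum.lmap_lof, (G i).comm]
    exact fun x => LinearMap.congr_fun this x

/-- Corings have coproducts, carried by the direct sum of the underlying bimodules. Besides the
universal property, the statement says that linear maps out of the coproduct can be defined
componentwise. -/
theorem exists_coprod {ι : Type u} (G : ι → ACoring k A) :
    ∃ (W : ACoring k A) (inc : ∀ i, G i ⟶ W),
      Submodule.span k {x | ∃ i y, (inc i).toLin y = x} = ⊤ ∧
      (∀ (V : Type u) [AddCommGroup V] [Module k V] (f : ∀ i, (G i).carrier →ₗ[k] V),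
        ∃ F : W.carrier →ₗ[k] V, ∀ i x, F ((inc i).toLin x) = f i x) ∧
      ∀ (C : ACoring k A) (g : ∀ i, G i ⟶ C), ∃ h : W ⟶ C,
        ∀ i x, h.toLin ((inc i).toLin x) = (g i).toLin x := by
  let M : ABimod k A := sumBimod fun i => (G i).toBimod
  let inc : ∀ i, BiLin (G i).toBimod M := fun i =>
    { toLin := DirectSum.lof k ι (fun i => (G i).carrier) i
      map_l := fun a x => (DirectSum.lmap_lof (fun i => (G i).l a) i x).symm
      map_r := fun a x => (DirectSum.lmap_lof (fun i => (G i).r a) i x).symm }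
  have lift : ∀ (V : Type u) [AddCommGroup V] [Module k V] (f : ∀ i, (G i).carrier →ₗ[k] V),
      ∃ F : M.carrier →ₗ[k] V, ∀ i x, F ((inc i).toLin x) = f i x := fun V _ _ f =>
    ⟨DirectSum.toModule k ι V f, fun i x =>
      DirectSum.toModule_lof (M := fun i => (G i).carrier) (φ := f) k i x⟩
  have top : Submodule.span k {x | ∃ i y, (inc i).toLin y = x} = ⊤ := by
    rw [eq_top_iff]
    intro x _
    induction x using DirectSum.induction_on with
    | zero => exact zero_mem _
    | of i x => exact Submodule.subset_span ⟨i, x, rfl⟩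
    | add x y hx hy => exact add_mem (hx trivial) (hy trivial)
  obtain ⟨Δ, hΔ⟩ := lift (Bal M.r M.l) fun i => (inc i).bal.comp (G i).comul
  obtain ⟨ε, hε⟩ := lift A fun i => (G i).counit
  have hc : Submodule.span k (coverSet M Δ ε) = ⊤ := by
    rw [eq_top_iff, ← top]
    refine Submodule.span_mono ?_
    rintro _ ⟨i, y, rfl⟩
    exact ⟨G i, inc i, hε i, hΔ i, y, rfl⟩
  let W : ACoring k A := ⟨M, coringOfCover hc⟩
  refine ⟨W, fun i =>
    { toLin := (inc i).toLin
      map_l := (inc i).map_l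
      map_r := (inc i).map_r
      counit_map := hε i
      comul_map := hΔ i }, top, lift, fun C g => ?_⟩
  obtain ⟨h, hh⟩ := lift C.carrier fun i => (g i).toLin
  have hl : ∀ a x, h (M.l a x) = C.l a (h x) := fun a x => by
    have : h.comp (M.l a) = (C.l a).comp h := LinearMap.ext_on top (by
      rintro _ ⟨i, y, rfl⟩
      simp only [LinearMap.comp_apply]
      rw [← (inc i).map_l, hh, hh, (g i).map_l])
    exact LinearMap.congr_fun this x
  have hr : ∀ a x, h (M.r a x) = C.r a (h x) := fun a x => by
    have : h.comp (M.r a) = (C.r a).comp h := LinearMap.ext_on top (by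
      rintro _ ⟨i, y, rfl⟩
      simp only [LinearMap.comp_apply]
      rw [← (inc i).map_r, hh, hh, (g i).map_r])
    exact LinearMap.congr_fun this x
  refine ⟨
    { toLin := h
      map_l := hl
      map_r := hr
      counit_map := fun x => ?_
      comul_map := fun x => ?_ }, hh⟩
  · have : C.counit.comp h = ε := LinearMap.ext_on top (by
      rintro _ ⟨i, y, rfl⟩
      rw [LinearMap.comp_apply, hh, hε, (g i).counit_map])
    exact LinearMap.congr_fun this x
  · let hb : BiLin M C.toBimod := ⟨h, hl, hr⟩
    have : C.comul.comp h = hb.bal.comp Δ := LinearMap.ext_on top (by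
      rintro _ ⟨i, y, rfl⟩
      rw [LinearMap.comp_apply, hh, LinearMap.comp_apply, hΔ, (g i).comul_bi,
        LinearMap.comp_apply, ← BiLin.bal_comp]
      congr 2
      have : (g i).toLin = h.comp (inc i).toLin := LinearMap.ext fun x => (hh i x).symm
      change BiLin.mk _ _ _ = BiLin.mk _ _ _
      congr 1)
    exact LinearMap.congr_fun this x

end Coprod

/-! ### The universal coring over `R^*` -/

/-- The coring `T` with the map `ξ : T → R^*` is universal among the corings over `R^*`. -/
structure IsUniv {R : ARing k A} (T : ACoring k A) (ξ : T.carrier →ₗ[k] R.RDual) : Prop where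
  zeta : ZetaProp ξ
  exists_hom : ∀ (C : ACoring k A) (f : C.carrier →ₗ[k] R.RDual), ZetaProp f →
    ∃ g : C ⟶ T, ∀ x, ξ (g.toLin x) = f x
  uniq : ∀ (C : ACoring k A) (g h : C ⟶ T), (∀ x, ξ (g.toLin x) = ξ (h.toLin x)) → g = h

/-- A universal coring over `R^*` has no nonzero coideals: the quotient by a coideal maps back. -/
theorem IsUniv.coideal_eq_bot {R : ARing k A} {T : ACoring k A} {ξ : T.carrier →ₗ[k] R.RDual}
    (h : IsUniv T ξ) {J : Submodule k T.carrier} (hJ : IsCoideal ξ J) : J = ⊥ := by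
  obtain ⟨D, π, f', -, h0, hf, hz⟩ := hJ.exists_quotient h.zeta
  obtain ⟨g, hg⟩ := h.exists_hom D f' hz
  have e : π ≫ g = 𝟙 T := h.uniq T _ _ fun x => by
    change ξ (g.toLin (π.toLin x)) = ξ x
    rw [hg, hf]
  rw [eq_bot_iff]
  intro x hx
  have e' : g.toLin (π.toLin x) = x := congrArg (fun q : T ⟶ T => q.toLin x) e
  rw [(h0 x).2 hx, map_zero] at e'
  exact e'.symm

/-- If every coring over `R^*` is covered by the images of the members of a set of corings over
`R^*`, then there is a universal one, namely the quotient of the coproduct `W` of this set by its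
largest coideal. A coring `C` over `R^*` is a quotient of a coproduct `V` of members of the set;
the image in `W` of the kernel of `V → C` is a coideal, so that `V → W` induces a map from `C`. -/
theorem exists_isUniv_of_cover {R : ARing k A} {I : Type u} (G : I → ACoring k A)
    (γ : ∀ i, (G i).carrier →ₗ[k] R.RDual) (hγ : ∀ i, ZetaProp (γ i))
    (hgen : ∀ (C : ACoring k A) (f : C.carrier →ₗ[k] R.RDual), ZetaProp f → ∀ x : C.carrier,
      ∃ (i : I) (g : G i ⟶ C), (∀ y, f (g.toLin y) = γ i y) ∧ ∃ y, g.toLin y = x) :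
    ∃ (T : ACoring k A) (ξ : T.carrier →ₗ[k] R.RDual), IsUniv T ξ := by
  obtain ⟨W, inc, hspan, hlift, hdesc⟩ := exists_coprod G
  obtain ⟨ω, hω⟩ := hlift R.RDual γ
  have hωz : ZetaProp ω := ZetaProp.of_span hspan (by
    rintro _ ⟨i, y, rfl⟩
    refine ⟨G i, inc i, y, ?_, rfl⟩
    have : ω.comp (inc i).toLin = γ i := LinearMap.ext fun x => hω i x
    rw [this]; exact hγ i)
  obtain ⟨T, π, ξ, hπs, hπ0, hξ, hξz⟩ := (isCoideal_sSup ω).exists_quotient hωz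
  -- the preimage of a coideal of `T` is a coideal of `W`, so that `T` has no nonzero coideals
  have hbot : ∀ J, IsCoideal ξ J → J = ⊥ := by
    intro J hJ
    have hK : IsCoideal ω (J.comap π.toLin) :=
      { l_mem := fun a x hx => by
          rw [Submodule.mem_comap, π.map_l]; exact hJ.l_mem a _ hx
        r_mem := fun a x hx => by
          rw [Submodule.mem_comap, π.map_r]; exact hJ.r_mem a _ hx
        counit := fun x hx => by rw [← π.counit_map]; exact hJ.counit _ hx
        map := fun x hx => by rw [← hξ]; exact hJ.map _ hx
        comul := fun Q p hp x hx => by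
          obtain ⟨q', e⟩ := BiLin.exists_factor (p := ACoring.Hom.bi π) hπs p fun y hy => hp y (by
            have hy : π.toLin y = 0 := hy
            rw [Submodule.mem_comap, hy]; exact zero_mem _)
          have hq : ∀ y, q'.toLin (π.toLin y) = p.toLin y := fun y =>
            congrArg (fun p => BiLin.toLin p y) e
          have h1 := hJ.comul Q q' (fun y hy => by
            obtain ⟨y, rfl⟩ := hπs y
            rw [hq]; exact hp y hy) (π.toLin x) hx
          rw [π.comul_bi, ← BiLin.bal_comp, e] at h1
          exact h1 }
    rw [eq_bot_iff]
    intro y hy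
    obtain ⟨x, rfl⟩ := hπs y
    exact (hπ0 x).2 ((le_sSup hK : J.comap π.toLin ≤ _) hy)
  refine ⟨T, ξ, hξz, fun C f hf => ?_, fun C g h hgh => ?_⟩
  · obtain ⟨V, inc', hspan', hlift', hdesc'⟩ := exists_coprod
      (ι := Σ i, {g : G i ⟶ C // ∀ y, f (g.toLin y) = γ i y}) (fun j => G j.1)
    obtain ⟨w, hw⟩ := hdesc' W fun j => inc j.1
    obtain ⟨c, hc⟩ := hdesc' C fun j => j.2.1
    have hcs : Function.Surjective c.toLin := fun x => by
      obtain ⟨i, g, hg, y, rfl⟩ := hgen C f hf x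
      exact ⟨(inc' ⟨i, g, hg⟩).toLin y, hc ⟨i, g, hg⟩ y⟩
    have hwc : ω.comp w.toLin = f.comp c.toLin := LinearMap.ext_on hspan' (by
      rintro _ ⟨j, y, rfl⟩
      rw [LinearMap.comp_apply, LinearMap.comp_apply, hw, hc, hω, j.2.2])
    -- maps out of `V` which kill the kernel of `c` factor through `C`
    have factor : ∀ (Q : ABimod k A) (p : BiLin V.toBimod Q),
        (∀ x, c.toLin x = 0 → p.toLin x = 0) →
        ∃ q : BiLin C.toBimod Q, q.comp (ACoring.Hom.bi c) = p := fun Q p hp =>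
      BiLin.exists_factor (p := ACoring.Hom.bi c) hcs p hp
    have hK : IsCoideal ω ((LinearMap.ker c.toLin).map w.toLin) :=
      { l_mem := by
          rintro a _ ⟨x, hx, rfl⟩
          refine ⟨V.l a x, ?_, w.map_l a x⟩
          have hx : c.toLin x = 0 := hx
          change c.toLin (V.l a x) = 0
          rw [c.map_l, hx, map_zero]
        r_mem := by
          rintro a _ ⟨x, hx, rfl⟩
          refine ⟨V.r a x, ?_, w.map_r a x⟩
          have hx : c.toLin x = 0 := hx
          change c.toLin (V.r a x) = 0
          rw [c.map_r, hx, map_zero]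
        counit := by
          rintro _ ⟨x, hx, rfl⟩
          have hx : c.toLin x = 0 := hx
          rw [w.counit_map, ← c.counit_map, hx, map_zero]
        map := by
          rintro _ ⟨x, hx, rfl⟩
          have hx : c.toLin x = 0 := hx
          have := LinearMap.congr_fun hwc x
          rw [LinearMap.comp_apply, LinearMap.comp_apply, hx, map_zero] at this
          exact this
        comul := by
          rintro Q p hp _ ⟨x, hx, rfl⟩
          have hx : c.toLin x = 0 := hx
          obtain ⟨q, hq⟩ := factor Q (p.comp (ACoring.Hom.bi w))
            (fun x hx => hp _ ⟨x, hx, rfl⟩)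
          rw [w.comul_bi, ← BiLin.bal_comp, ← hq, BiLin.bal_comp, ← c.comul_bi, hx, map_zero,
            map_zero] }
    obtain ⟨q, hq⟩ := factor T.toBimod ((ACoring.Hom.bi π).comp (ACoring.Hom.bi w))
      (fun x hx => (hπ0 _).2 ((le_sSup hK : _ ≤ sSup {J | IsCoideal ω J}) ⟨x, hx, rfl⟩))
    have hq' : ∀ x, q.toLin (c.toLin x) = π.toLin (w.toLin x) := fun x =>
      congrArg (fun p => BiLin.toLin p x) hq
    refine ⟨
      { toLin := q.toLin
        map_l := q.map_l
        map_r := q.map_r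
        counit_map := fun x => ?_
        comul_map := fun x => ?_ }, fun x => ?_⟩
    · obtain ⟨x, rfl⟩ := hcs x
      rw [hq', π.counit_map, w.counit_map, c.counit_map]
    · obtain ⟨x, rfl⟩ := hcs x
      rw [hq', π.comul_bi, w.comul_bi, ← BiLin.bal_comp, ← hq, BiLin.bal_comp, ← c.comul_bi]
      rfl
    · obtain ⟨x, rfl⟩ := hcs x
      change ξ (q.toLin (c.toLin x)) = _
      rw [hq', hξ]
      exact LinearMap.congr_fun hwc x
  · have hJ : IsCoideal ξ (LinearMap.range (g.toLin - h.toLin)) :=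
      { l_mem := by
          rintro a _ ⟨x, rfl⟩
          exact ⟨C.l a x, by simp [g.map_l, h.map_l]⟩
        r_mem := by
          rintro a _ ⟨x, rfl⟩
          exact ⟨C.r a x, by simp [g.map_r, h.map_r]⟩
        counit := by
          rintro _ ⟨x, rfl⟩
          simp [g.counit_map, h.counit_map]
        map := by
          rintro _ ⟨x, rfl⟩
          simp [hgh]
        comul := by
          rintro Q p hp _ ⟨x, rfl⟩
          have e : p.comp (ACoring.Hom.bi g) = p.comp (ACoring.Hom.bi h) := by
            have : p.toLin.comp g.toLin = p.toLin.comp h.toLin := LinearMap.ext fun x => by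
              have := hp _ ⟨x, rfl⟩
              rw [LinearMap.sub_apply, map_sub, sub_eq_zero] at this
              exact this
            change BiLin.mk _ _ _ = BiLin.mk _ _ _
            congr 1
          rw [LinearMap.sub_apply, map_sub, map_sub, g.comul_bi, h.comul_bi, ← BiLin.bal_comp,
            ← BiLin.bal_comp, e, sub_self] }
    have h0 := hbot _ hJ
    rw [LinearMap.range_eq_bot, sub_eq_zero] at h0
    exact ACoring.Hom.ext h0

/-! ### Small subcorings -/

section Small

/-- An element of the span of a family `e` lies in the span of finitely many members. If every `e i`
involves only the finitely many elements `supp i` of `C`, these members involve only elements of a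
sequence `w`; sequences instead of finite sets make the witnesses easy to index. -/
theorem exists_seq_mem_span {E C I : Type*} [AddCommGroup E] [Module k E] (c₀ : C) (e : I → E)
    (supp : I → Set C) (hs : ∀ i, (supp i).Finite) {z : E}
    (hz : z ∈ Submodule.span k (Set.range e)) :
    ∃ w : ℕ → C, z ∈ Submodule.span k {y | ∃ i, supp i ⊆ Set.range w ∧ e i = y} := by
  have key : ∃ F : Set C, F.Finite ∧ z ∈ Submodule.span k {y | ∃ i, supp i ⊆ F ∧ e i = y} := by
    have mono : ∀ {F G : Set C}, F ⊆ G → Submodule.span k {y | ∃ i, supp i ⊆ F ∧ e i = y} ≤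
        Submodule.span k {y | ∃ i, supp i ⊆ G ∧ e i = y} := fun h =>
      Submodule.span_mono (by rintro _ ⟨i, hi, rfl⟩; exact ⟨i, hi.trans h, rfl⟩)
    induction hz using Submodule.span_induction with
    | mem x hx =>
      obtain ⟨i, rfl⟩ := hx
      exact ⟨supp i, hs i, Submodule.subset_span ⟨i, subset_rfl, rfl⟩⟩
    | zero => exact ⟨∅, Set.finite_empty, zero_mem _⟩
    | add x y _ _ hx hy =>
      obtain ⟨F, hF, hx⟩ := hx
      obtain ⟨G, hG, hy⟩ := hy
      exact ⟨F ∪ G, hF.union hG, add_mem (mono Set.subset_union_left hx)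
        (mono Set.subset_union_right hy)⟩
    | smul c x _ hx =>
      obtain ⟨F, hF, hx⟩ := hx
      exact ⟨F, hF, Submodule.smul_mem _ c hx⟩
  obtain ⟨F, hF, hz⟩ := key
  obtain ⟨w, hw⟩ := (hF.insert c₀).countable.exists_eq_range (Set.insert_nonempty c₀ F)
  refine ⟨w, Submodule.span_mono ?_ hz⟩
  rintro _ ⟨i, hi, rfl⟩
  exact ⟨i, hi.trans (hw ▸ Set.subset_insert c₀ F), rfl⟩

/-- The generators `x a ⊗ y - x ⊗ a y` of the relations that define `M ⊗_A M`. -/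
def rel2 (M : ABimod k A) (i : A × M.carrier × M.carrier) : M.carrier ⊗[k] M.carrier :=
  M.r i.1 i.2.1 ⊗ₜ i.2.2 - i.2.1 ⊗ₜ M.l i.1 i.2.2

/-- The generators `x a ⊗ y ⊗ z - x ⊗ a y ⊗ z` and `x ⊗ y a ⊗ z - x ⊗ y ⊗ a z` of the relations
that define `M ⊗_A M ⊗_A M`. -/
def rel3 (M : ABimod k A) (i : Bool × A × M.carrier × M.carrier × M.carrier) :
    M.carrier ⊗[k] (M.carrier ⊗[k] M.carrier) :=
  if i.1 then M.r i.2.1 i.2.2.1 ⊗ₜ (i.2.2.2.1 ⊗ₜ i.2.2.2.2) -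
      i.2.2.1 ⊗ₜ (M.l i.2.1 i.2.2.2.1 ⊗ₜ i.2.2.2.2)
  else i.2.2.1 ⊗ₜ (M.r i.2.1 i.2.2.2.1 ⊗ₜ i.2.2.2.2) -
      i.2.2.1 ⊗ₜ (i.2.2.2.1 ⊗ₜ M.l i.2.1 i.2.2.2.2)

theorem mem_span_rel2 (M : ABimod k A) {z : M.carrier ⊗[k] M.carrier} :
    z ∈ Submodule.span k (Set.range (rel2 M)) ↔ (balRel M.r M.l).mkQ z = 0 := by
  rw [Submodule.mkQ_apply, Submodule.Quotient.mk_eq_zero]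
  have : Set.range (rel2 M) = {z | ∃ a m n, z = M.r a m ⊗ₜ[k] n - m ⊗ₜ[k] M.l a n} := by
    ext z
    constructor
    · rintro ⟨⟨a, m, n⟩, rfl⟩; exact ⟨a, m, n, rfl⟩
    · rintro ⟨a, m, n, rfl⟩; exact ⟨⟨a, m, n⟩, rfl⟩
  rw [this]; rfl

/-- The projection from `M ⊗ M ⊗ M` to `M ⊗_A M ⊗_A M`. -/
def toBal3 (M : ABimod k A) : M.carrier ⊗[k] (M.carrier ⊗[k] M.carrier) →ₗ[k]
    Bal M.r (Bal.actL M.l M.l M.comm) :=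
  (balRel M.r (Bal.actL M.l M.l M.comm)).mkQ.comp
    (TensorProduct.map LinearMap.id (balRel M.r M.l).mkQ)

@[simp] theorem toBal3_tmul (M : ABimod k A) (x y z : M.carrier) :
    toBal3 M (x ⊗ₜ (y ⊗ₜ z)) = bt M.r (Bal.actL M.l M.l M.comm) x (bt M.r M.l y z) := rfl

theorem mem_span_rel3 (M : ABimod k A) {z : M.carrier ⊗[k] (M.carrier ⊗[k] M.carrier)} :
    z ∈ Submodule.span k (Set.range (rel3 M)) ↔ toBal3 M z = 0 := by
  constructor
  · intro hz
    have : Submodule.span k (Set.range (rel3 M)) ≤ LinearMap.ker (toBal3 M) := by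
      rw [Submodule.span_le]
      rintro _ ⟨⟨b, a, x, y, z⟩, rfl⟩
      cases b
      · simp [rel3, bt_bal]
      · simp [rel3, bt_bal]
    exact this hz
  · intro hz
    let S := Submodule.span k (Set.range (rel3 M))
    let mk : M.carrier → M.carrier → M.carrier →
        (M.carrier ⊗[k] (M.carrier ⊗[k] M.carrier)) ⧸ S := fun x y z => S.mkQ (x ⊗ₜ (y ⊗ₜ z))
    have e1 : ∀ a x y z, mk (M.r a x) y z = mk x (M.l a y) z := fun a x y z => by
      rw [← sub_eq_zero, ← map_sub]
      exact (Submodule.Quotient.mk_eq_zero _).2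
        (Submodule.subset_span ⟨⟨true, a, x, y, z⟩, rfl⟩)
    have e2 : ∀ a x y z, mk x (M.r a y) z = mk x y (M.l a z) := fun a x y z => by
      rw [← sub_eq_zero, ← map_sub]
      exact (Submodule.Quotient.mk_eq_zero _).2
        (Submodule.subset_span ⟨⟨false, a, x, y, z⟩, rfl⟩)
    let g : Bal M.r M.l →ₗ[k] M.carrier →ₗ[k] (M.carrier ⊗[k] (M.carrier ⊗[k] M.carrier)) ⧸ S :=
      Bal.lift
        (LinearMap.mk₂ k (fun y z => S.mkQ.comp ((TensorProduct.mk k _ _).flip (y ⊗ₜ z)))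
          (fun _ _ _ => by ext; simp [TensorProduct.add_tmul])
          (fun _ _ _ => by ext; simp [← TensorProduct.smul_tmul'])
          (fun _ _ _ => by ext; simp [TensorProduct.tmul_add])
          (fun _ _ _ => by ext; simp))
        ⟨fun a y z => LinearMap.ext fun x => e2 a x y z⟩
    have hg : ∀ x y z, g (bt M.r M.l y z) x = mk x y z := fun x y z => by
      simp only [g, Bal.lift_bt]; rfl
    let G : Bal M.r (Bal.actL M.l M.l M.comm) →ₗ[k]
        (M.carrier ⊗[k] (M.carrier ⊗[k] M.carrier)) ⧸ S :=
      Bal.lift g.flip ⟨fun a x w => by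
        simp only [LinearMap.flip_apply]
        induction w using Bal.ind with
        | h0 => simp
        | ht y z => rw [Bal.actL_bt, hg, hg]; exact e1 a x y z
        | ha p q hp hq => simp only [map_add, LinearMap.add_apply, hp, hq]⟩
    have hG : G.comp (toBal3 M) = S.mkQ := by
      ext x y z
      change G (bt _ _ x (bt _ _ y z)) = mk x y z
      rw [Bal.lift_bt, LinearMap.flip_apply, hg]
    have := LinearMap.congr_fun hG z
    rw [LinearMap.comp_apply, hz, map_zero] at this
    exact (Submodule.Quotient.mk_eq_zero S).1 this.symm

theorem exists_fin_sum3 {M : Type*} [AddCommGroup M] [Module k M] (z : M ⊗[k] (M ⊗[k] M)) :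
    ∃ (n : ℕ) (x y w : Fin n → M), z = ∑ i, x i ⊗ₜ (y i ⊗ₜ w i) := by
  induction z using TensorProduct.induction_on with
  | zero => exact ⟨0, Fin.elim0, Fin.elim0, Fin.elim0, by simp⟩
  | tmul x t =>
    induction t using TensorProduct.induction_on with
    | zero => exact ⟨0, Fin.elim0, Fin.elim0, Fin.elim0, by simp⟩
    | tmul y w => exact ⟨1, fun _ => x, fun _ => y, fun _ => w, by simp⟩
    | add p q hp hq =>
      obtain ⟨n, a, b, c, hp⟩ := hp
      obtain ⟨n', a', b', c', hq⟩ := hq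
      exact ⟨n + n', Fin.append a a', Fin.append b b', Fin.append c c', by
        simp [Fin.sum_univ_add, TensorProduct.tmul_add, hp, hq]⟩
  | add p q hp hq =>
    obtain ⟨n, a, b, c, rfl⟩ := hp
    obtain ⟨n', a', b', c', rfl⟩ := hq
    exact ⟨n + n', Fin.append a a', Fin.append b b', Fin.append c c', by
      simp [Fin.sum_univ_add]⟩

/-- `ι ⊗_A ι` is injective if every relation in `C ⊗_A C` between elements of the image of `ι` is a
consequence of relations between elements of the image. -/
theorem BiLin.bal_injective {M C : ABimod k A} (ι : BiLin M C) (hι : Function.Injective ι.toLin)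
    (H : ∀ n (x y : Fin n → M.carrier), (∑ i, bt C.r C.l (ι.toLin (x i)) (ι.toLin (y i))) = 0 →
      ∃ w : ℕ → M.carrier, (∑ i, ι.toLin (x i) ⊗ₜ[k] ι.toLin (y i)) ∈ Submodule.span k
        {z | ∃ i : A × C.carrier × C.carrier,
          {i.2.1, i.2.2} ⊆ Set.range (fun j => ι.toLin (w j)) ∧ rel2 C i = z}) :
    Function.Injective ι.bal := by
  rw [injective_iff_map_eq_zero]
  intro z hz
  obtain ⟨n, x, y, rfl⟩ := z.exists_sum
  simp only [map_sum, bal_bt] at hz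
  obtain ⟨w, hw⟩ := H n x y hz
  have hle : Submodule.span k {z | ∃ i : A × C.carrier × C.carrier,
      {i.2.1, i.2.2} ⊆ Set.range (fun j => ι.toLin (w j)) ∧ rel2 C i = z} ≤
      (Submodule.span k (Set.range (rel2 M))).map (TensorProduct.map ι.toLin ι.toLin) := by
    rw [Submodule.span_le]
    rintro _ ⟨⟨a, m, n⟩, h, rfl⟩
    obtain ⟨j, hj⟩ := h (Set.mem_insert m {n})
    obtain ⟨j', hj'⟩ := h (Set.mem_insert_of_mem m rfl)
    refine ⟨rel2 M ⟨a, w j, w j'⟩, Submodule.subset_span ⟨_, rfl⟩, ?_⟩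
    dsimp only at hj hj'
    simp [rel2, ι.map_l, ι.map_r, hj, hj']
  obtain ⟨v, hv, hvw⟩ := hle hw
  have hinj : Function.Injective (TensorProduct.map ι.toLin ι.toLin) :=
    TensorProduct.map_injective_of_flat_flat _ _ hι hι
  have : v = ∑ i, x i ⊗ₜ y i := hinj (by rw [hvw]; simp)
  rw [this] at hv
  have := (mem_span_rel2 M).1 hv
  rw [map_sum] at this
  exact this

/-- `ι ⊗_A ι ⊗_A ι` is injective if every relation in `C ⊗_A C ⊗_A C` between elements of the image
of `ι` is a consequence of relations between elements of the image. -/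
theorem BiLin.bal3_injective {M C : ABimod k A} (ι : BiLin M C)
    (hι : Function.Injective ι.toLin)
    (H : ∀ n (x y z : Fin n → M.carrier),
      (∑ i, bt C.r (Bal.actL C.l C.l C.comm) (ι.toLin (x i))
        (bt C.r C.l (ι.toLin (y i)) (ι.toLin (z i)))) = 0 →
      ∃ w : ℕ → M.carrier,
        (∑ i, ι.toLin (x i) ⊗ₜ[k] (ι.toLin (y i) ⊗ₜ[k] ι.toLin (z i))) ∈ Submodule.span k
        {v | ∃ i : Bool × A × C.carrier × C.carrier × C.carrier,
          {i.2.2.1, i.2.2.2.1, i.2.2.2.2} ⊆ Set.range (fun j => ι.toLin (w j)) ∧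
            rel3 C i = v}) :
    Function.Injective ι.bal3 := by
  rw [injective_iff_map_eq_zero]
  intro z hz
  have hsurj : Function.Surjective (toBal3 M) :=
    (Submodule.mkQ_surjective _).comp
      (TensorProduct.map_surjective Function.surjective_id (Submodule.mkQ_surjective _))
  obtain ⟨t, rfl⟩ := hsurj z
  obtain ⟨n, x, y, z, rfl⟩ := exists_fin_sum3 t
  simp only [map_sum, toBal3_tmul, bal3, Bal.map_bt, bal_bt] at hz
  obtain ⟨w, hw⟩ := H n x y z hz
  let Φ := TensorProduct.map ι.toLin (TensorProduct.map ι.toLin ι.toLin)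
  have hle : Submodule.span k {v | ∃ i : Bool × A × C.carrier × C.carrier × C.carrier,
      {i.2.2.1, i.2.2.2.1, i.2.2.2.2} ⊆ Set.range (fun j => ι.toLin (w j)) ∧ rel3 C i = v} ≤
      (Submodule.span k (Set.range (rel3 M))).map Φ := by
    rw [Submodule.span_le]
    rintro _ ⟨⟨b, a, m, n, p⟩, h, rfl⟩
    obtain ⟨j, hj⟩ := h (Set.mem_insert m {n, p})
    obtain ⟨j', hj'⟩ := h (Set.mem_insert_of_mem m (Set.mem_insert n {p}))
    obtain ⟨j'', hj''⟩ := h (Set.mem_insert_of_mem m (Set.mem_insert_of_mem n rfl))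
    refine ⟨rel3 M ⟨b, a, w j, w j', w j''⟩, Submodule.subset_span ⟨_, rfl⟩, ?_⟩
    dsimp only at hj hj' hj''
    cases b <;> simp [Φ, rel3, ι.map_l, ι.map_r, hj, hj', hj'']
  obtain ⟨v, hv, hvw⟩ := hle hw
  have hinj : Function.Injective Φ :=
    TensorProduct.map_injective_of_flat_flat _ _ hι
      (TensorProduct.map_injective_of_flat_flat _ _ hι hι)
  have : v = ∑ i, x i ⊗ₜ (y i ⊗ₜ z i) := hinj (by rw [hvw]; simp [Φ])
  rw [this] at hv
  exact (mem_span_rel3 M).1 hv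

/-- Terms for the elements of the smallest subset of a coring that contains a given element, is
closed under the operations of a bimodule, and contains chosen witnesses: the components of the
comultiplication, and the elements involved in the vanishing of sums in `C ⊗_A C` and
`C ⊗_A C ⊗_A C`. All these subsets are quotients of one fixed set. -/
inductive CoTerm (k A : Type u) : Type u
  | base : CoTerm k A
  | l (a : A) (t : CoTerm k A) : CoTerm k A
  | r (a : A) (t : CoTerm k A) : CoTerm k A
  | smul (c : k) (t : CoTerm k A) : CoTerm k A
  | add (t t' : CoTerm k A) : CoTerm k A
  | comul (j : ℕ) (b : Bool) (t : CoTerm k A) : CoTerm k A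
  | wit2 (n : ℕ) (x y : Fin n → CoTerm k A) (j : ℕ) : CoTerm k A
  | wit3 (n : ℕ) (x y z : Fin n → CoTerm k A) (j : ℕ) : CoTerm k A

/-- The value of a term in a coring, for given witness functions. -/
def CoTerm.eval (C : ACoring k A) (x₀ : C.carrier) (d : C.carrier → ℕ → Bool → C.carrier)
    (w₂ : ∀ n, (Fin n → C.carrier) → (Fin n → C.carrier) → ℕ → C.carrier)
    (w₃ : ∀ n, (Fin n → C.carrier) → (Fin n → C.carrier) → (Fin n → C.carrier) → ℕ → C.carrier) :
    CoTerm k A → C.carrier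
  | base => x₀
  | l a t => C.l a (eval C x₀ d w₂ w₃ t)
  | r a t => C.r a (eval C x₀ d w₂ w₃ t)
  | smul c t => c • eval C x₀ d w₂ w₃ t
  | add t t' => eval C x₀ d w₂ w₃ t + eval C x₀ d w₂ w₃ t'
  | comul j b t => d (eval C x₀ d w₂ w₃ t) j b
  | wit2 n x y j => w₂ n (fun i => eval C x₀ d w₂ w₃ (x i)) (fun i => eval C x₀ d w₂ w₃ (y i)) j
  | wit3 n x y z j => w₃ n (fun i => eval C x₀ d w₂ w₃ (x i))
      (fun i => eval C x₀ d w₂ w₃ (y i)) (fun i => eval C x₀ d w₂ w₃ (z i)) j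

/-- The corings over `R^*` that are carried by quotients of the set of terms. -/
structure SmallOver (R : ARing k A) : Type u where
  s : Setoid (CoTerm k A)
  [grp : AddCommGroup (Quotient s)]
  [mod : Module k (Quotient s)]
  l : Act k A (Quotient s)
  r : Act k A (Quotient s)
  comm : ∀ a b x, l a (r b x) = r b (l a x)
  str : CoringStr (⟨Quotient s, l, r, comm⟩ : ABimod k A)
  f : (Quotient s) →ₗ[k] R.RDual
  zeta : ZetaProp (C := ⟨⟨Quotient s, l, r, comm⟩, str⟩) f

/-- The coring underlying an object of `SmallOver R`. -/
def SmallOver.coring {R : ARing k A} (G : SmallOver R) : ACoring k A :=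
  letI := G.grp
  letI := G.mod
  ⟨⟨Quotient G.s, G.l, G.r, G.comm⟩, G.str⟩

/-- The bimodule structure on a set `X` which injects into a bimodule onto a subbimodule. -/
theorem exists_bimod_of_range {X : Type u} {C : ABimod k A} (e : X → C.carrier)
    (he : Function.Injective e) (D : Submodule k C.carrier) (hD : ∀ x, x ∈ D ↔ ∃ t, e t = x)
    (hl : ∀ a, ∀ x ∈ D, C.l a x ∈ D) (hr : ∀ a, ∀ x ∈ D, C.r a x ∈ D) :
    ∃ (_ : AddCommGroup X) (_ : Module k X) (l r : Act k A X)
      (comm : ∀ a b x, l a (r b x) = r b (l a x)) (ι : BiLin ⟨X, l, r, comm⟩ C),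
      ⇑ι.toLin = e := by
  let E : X ≃ D := Equiv.ofBijective (fun x => ⟨e x, (hD _).2 ⟨x, rfl⟩⟩)
    ⟨fun x y h => he (congrArg Subtype.val h), fun ⟨x, hx⟩ => by
      obtain ⟨t, rfl⟩ := (hD x).1 hx
      exact ⟨t, rfl⟩⟩
  let _ : AddCommGroup X := E.addCommGroup
  let _ : Module k X := E.module k
  let eL : X →ₗ[k] C.carrier := D.subtype.comp (E.linearEquiv k).toLinearMap
  have heL : Function.Injective eL := he
  have act : ∀ ρ : Act k A C.carrier, (∀ a, ∀ x ∈ D, ρ a x ∈ D) →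
      ∃ σ : Act k A X, ∀ a x, eL (σ a x) = ρ a (eL x) := fun ρ h => by
    let F : A → X →ₗ[k] X := fun a =>
      (E.linearEquiv k).symm.toLinearMap.comp
        (((ρ a).restrict (h a)).comp (E.linearEquiv k).toLinearMap)
    have hF : ∀ a x, eL (F a x) = ρ a (eL x) := fun a x => by
      simp [F, eL]
    exact ⟨AlgHom.ofLinearMap
      { toFun := F
        map_add' := fun a b => LinearMap.ext fun x => heL (by simp [hF])
        map_smul' := fun c a => LinearMap.ext fun x => heL (by simp [hF]) }
      (LinearMap.ext fun x => heL ((hF 1 x).trans (by simp)))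
      (fun a b => LinearMap.ext fun x => heL (by
        change eL (F (a * b) x) = eL (F a (F b x))
        simp [hF])), hF⟩
  obtain ⟨l, hl'⟩ := act C.l hl
  obtain ⟨r, hr'⟩ := act C.r hr
  exact ⟨inferInstance, inferInstance, l, r, fun a b x => heL (by simp [hl', hr', C.comm]),
    ⟨eL, hl', hr'⟩, rfl⟩

/-- Every element `x₀` of a coring `C` over `R^*` lies in the image of a map from a member of the
set `SmallOver R`. Starting from `x₀`, one closes up under the bimodule operations, under chosen
components of `Δ`, and under chosen witnesses for the relations that hold in `C ⊗_A C` and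
`C ⊗_A C ⊗_A C`. The comultiplication restricts to the resulting subbimodule `D` because of the
components, and `D ⊗_A D → C ⊗_A C` and its threefold analogue are injective because of the
witnesses, so that `D` is a coring. Every element of `D` is the value of a term in
`CoTerm k A`. -/
theorem SmallOver.cover {R : ARing k A} (C : ACoring k A) (f : C.carrier →ₗ[k] R.RDual)
    (hf : ZetaProp f) (x₀ : C.carrier) :
    ∃ (G : SmallOver R) (g : G.coring ⟶ C), (∀ y, f (g.toLin y) = G.f y) ∧
      ∃ y, g.toLin y = x₀ := by
  have hd : ∀ x : C.carrier, ∃ (d : ℕ → Bool → C.carrier) (n : ℕ),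
      C.comul x = ∑ i : Fin n, bt C.r C.l (d i true) (d i false) := fun x => by
    obtain ⟨n, a, b, h⟩ := (C.comul x).exists_sum
    refine ⟨fun j c => if h : j < n then (if c then a ⟨j, h⟩ else b ⟨j, h⟩) else 0, n, ?_⟩
    rw [h]
    simp
  choose d N hd using hd
  -- the witnesses for the relations; where there is no relation to witness, any sequence will do
  have h2 : ∀ n (x y : Fin n → C.carrier), ∃ w : ℕ → C.carrier,
      (∑ i, bt C.r C.l (x i) (y i)) = 0 →
      (∑ i, x i ⊗ₜ[k] y i) ∈ Submodule.span k
        {z | ∃ i : A × C.carrier × C.carrier,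
          {i.2.1, i.2.2} ⊆ Set.range w ∧ rel2 C.toBimod i = z} := fun n x y => by
    by_cases h : (∑ i, bt C.r C.l (x i) (y i)) = 0
    · obtain ⟨w, hw⟩ := exists_seq_mem_span (k := k) x₀ (rel2 C.toBimod)
        (fun i => {i.2.1, i.2.2}) (fun i => by simp) (z := ∑ i, x i ⊗ₜ[k] y i)
        ((mem_span_rel2 C.toBimod).2 (by rw [map_sum]; exact h))
      exact ⟨w, fun _ => hw⟩
    · exact ⟨fun _ => x₀, fun h' => absurd h' h⟩
  choose w₂ h2 using h2
  have h3 : ∀ n (x y z : Fin n → C.carrier), ∃ w : ℕ → C.carrier,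
      (∑ i, bt C.r (Bal.actL C.l C.l C.toBimod.comm) (x i) (bt C.r C.l (y i) (z i))) = 0 →
      (∑ i, x i ⊗ₜ[k] (y i ⊗ₜ[k] z i)) ∈ Submodule.span k
        {v | ∃ i : Bool × A × C.carrier × C.carrier × C.carrier,
          {i.2.2.1, i.2.2.2.1, i.2.2.2.2} ⊆ Set.range w ∧ rel3 C.toBimod i = v} :=
      fun n x y z => by
    by_cases h : (∑ i, bt C.r (Bal.actL C.l C.l C.toBimod.comm) (x i)
        (bt C.r C.l (y i) (z i))) = 0
    · obtain ⟨w, hw⟩ := exists_seq_mem_span (k := k) x₀ (rel3 C.toBimod)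
        (fun i => {i.2.2.1, i.2.2.2.1, i.2.2.2.2}) (fun i => by simp)
        (z := ∑ i, x i ⊗ₜ[k] (y i ⊗ₜ[k] z i))
        ((mem_span_rel3 C.toBimod).2 (by rw [map_sum]; exact h))
      exact ⟨w, fun _ => hw⟩
    · exact ⟨fun _ => x₀, fun h' => absurd h' h⟩
  choose w₃ h3 using h3
  let ev : CoTerm k A → C.carrier := CoTerm.eval C x₀ d w₂ w₃
  let s : Setoid (CoTerm k A) := Setoid.ker ev
  let e : Quotient s → C.carrier := Quotient.lift ev fun _ _ h => h
  have he : Function.Injective e := by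
    rintro ⟨t⟩ ⟨t'⟩ h
    exact Quotient.sound h
  let D : Submodule k C.carrier :=
    { carrier := {x | ∃ t, e t = x}
      add_mem' := by
        rintro _ _ ⟨⟨t⟩, rfl⟩ ⟨⟨t'⟩, rfl⟩
        exact ⟨Quotient.mk s (.add t t'), rfl⟩
      zero_mem' := ⟨Quotient.mk s (.smul 0 .base), zero_smul k x₀⟩
      smul_mem' := by
        rintro c _ ⟨⟨t⟩, rfl⟩
        exact ⟨Quotient.mk s (.smul c t), rfl⟩ }
  obtain ⟨grp, mod, l, r, comm, ι, hι⟩ := exists_bimod_of_range (C := C.toBimod) e he D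
    (fun x => Iff.rfl)
    (by
      rintro a _ ⟨⟨t⟩, rfl⟩
      exact ⟨Quotient.mk s (.l a t), rfl⟩)
    (by
      rintro a _ ⟨⟨t⟩, rfl⟩
      exact ⟨Quotient.mk s (.r a t), rfl⟩)
  have hιe : ∀ t, ι.toLin t = e t := fun t => congrFun hι t
  have hinj : Function.Injective ι.toLin := by rw [hι]; exact he
  obtain ⟨c, g, hg⟩ := exists_coringOfInj ι hinj
    -- the terms `wit2` and `wit3` provide the sequences of witnesses inside the image
    (ι.bal_injective hinj fun n x y hxy => by
      choose tx htx using fun i => Quotient.exists_rep (x i)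
      choose ty hty using fun i => Quotient.exists_rep (y i)
      refine ⟨fun j => Quotient.mk s (.wit2 n tx ty j), ?_⟩
      have hw := h2 n _ _ hxy
      convert hw using 5
      rename_i i
      have : (fun j => ι.toLin (Quotient.mk s (.wit2 n tx ty j))) =
          w₂ n (fun i => ι.toLin (x i)) (fun i => ι.toLin (y i)) := by
        funext j
        rw [hιe]
        change w₂ n _ _ j = _
        congr 1
        · funext i; rw [hιe, ← htx]; rfl
        · funext i; rw [hιe, ← hty]; rfl
      rw [this])
    (ι.bal3_injective hinj fun n x y z hxyz => by
      choose tx htx using fun i => Quotient.exists_rep (x i)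
      choose ty hty using fun i => Quotient.exists_rep (y i)
      choose tz htz using fun i => Quotient.exists_rep (z i)
      refine ⟨fun j => Quotient.mk s (.wit3 n tx ty tz j), ?_⟩
      have hw := h3 n _ _ _ hxyz
      convert hw using 5
      rename_i i
      have : (fun j => ι.toLin (Quotient.mk s (.wit3 n tx ty tz j))) =
          w₃ n (fun i => ι.toLin (x i)) (fun i => ι.toLin (y i)) (fun i => ι.toLin (z i)) := by
        funext j
        rw [hιe]
        change w₃ n _ _ _ j = _
        congr 1
        · funext i; rw [hιe, ← htx]; rfl
        · funext i; rw [hιe, ← hty]; rfl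
        · funext i; rw [hιe, ← htz]; rfl
      rw [this])
    (by
      intro x
      obtain ⟨t, rfl⟩ := Quotient.exists_rep x
      refine ⟨∑ i : Fin (N (ev t)), bt _ _ (Quotient.mk s (.comul i true t))
        (Quotient.mk s (.comul i false t)), ?_⟩
      rw [hιe (Quotient.mk s t), map_sum]
      exact (Finset.sum_congr rfl fun i _ => (ι.bal_bt _ _).trans
        (by rw [hιe, hιe]; rfl)).trans (hd (ev t)).symm)
  have hz := hf.comp g
  refine ⟨⟨s, l, r, comm, c, f.comp g.toLin, hz⟩, g, fun y => rfl, Quotient.mk s .base, ?_⟩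
  exact (LinearMap.congr_fun hg _).trans (hιe _)

/-- The universal coring over `R^*` exists, since the terms bound the size of the corings needed. -/
theorem exists_isUniv (R : ARing k A) :
    ∃ (T : ACoring k A) (ξ : T.carrier →ₗ[k] R.RDual), IsUniv T ξ :=
  exists_isUniv_of_cover SmallOver.coring SmallOver.f SmallOver.zeta SmallOver.cover

end Small

/-! ### The left adjoint -/

/-- The map of `A`-rings `R → ^*C` attached to a map `C → R^*` that satisfies `(ζ)`. -/
def ofZeta {R : ARing k A} {C : ACoring k A} (f : C.carrier →ₗ[k] R.RDual) (hf : ZetaProp f) :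
    R ⟶ C.ldual where
  toAlgHom := AlgHom.ofLinearMap (B := C.LDual)
    { toFun := fun r => ⟨(LinearMap.applyₗ r).comp (R.RDual.subtype.comp f),
        fun a x => hf.map_l a x r⟩
      map_add' := fun x y => by apply Subtype.ext; ext z; simp
      map_smul' := fun x y => by apply Subtype.ext; ext z; exact map_smul (f z).1 x y }
    (by apply Subtype.ext; ext z; exact hf.map_one z)
    (fun x y => by
      apply Subtype.ext; ext z
      change (f z).1 (x * y) = (f (C.contr _ (C.comul z))).1 y
      rw [hf.map_mul]
      generalize C.comul z = w
      induction w using Bal.ind with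
      | h0 => simp
      | ht m n =>
        rw [ACoring.contr_bt, hf.map_r]
        exact Bal.lift_bt _ _ _ _
      | ha p q hp hq => simp only [map_add, hp, hq]; simp)
  map_s a := by
    apply Subtype.ext; ext z
    change (f z).1 (R.s a) = C.counit z * a
    rw [← hf.map_one, ← (f z).2, one_mul]

theorem toRDual_apply {R : ARing k A} {C : ACoring k A} (h : R ⟶ C.ldual) (z : C.carrier)
    (x : R.carrier) : (toRDual h z).1 x = (show C.LDual from h.toAlgHom x).1 z := rfl

theorem toRDual_injective {R : ARing k A} {C : ACoring k A} {g h : R ⟶ C.ldual}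
    (e : toRDual g = toRDual h) : g = h := by
  apply ARing.Hom.ext
  ext x
  apply Subtype.ext
  ext z
  exact congrArg (fun f : C.carrier →ₗ[k] R.RDual => (f z).1 x) e

theorem zetaProp_toRDual {R : ARing k A} {C : ACoring k A} (h : R ⟶ C.ldual) :
    ZetaProp (toRDual h) :=
  have hl : ∀ a z u, (toRDual h (C.l a z)).1 u = a * (toRDual h z).1 u := fun a z u =>
    (show C.LDual from h.toAlgHom u).2 a z
  have hr : ∀ a z u, (toRDual h (C.r a z)).1 u = (toRDual h z).1 (R.s a * u) := fun a z u => by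
    have : (show C.LDual from h.toAlgHom (R.s a * u)) =
        C.ldualUnit a * (show C.LDual from h.toAlgHom u) := by
      rw [map_mul, h.map_s]; rfl
    rw [toRDual_apply, toRDual_apply, this, ACoring.mul_apply]
    congr 1
    conv_lhs => rw [← C.str.comul_counit z]
    change C.r a _ = C.contr (C.ldualUnit a) (C.str.comul z)
    generalize C.str.comul z = w
    induction w using Bal.ind with
    | h0 => simp
    | ht m n => simp [mul_comm]
    | ha p q hp hq => simp only [map_add, hp, hq]
  { map_l := hl
    map_r := hr
    map_one := fun z => by
      rw [toRDual_apply, map_one]; rfl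
    map_mul := fun z x y => by
      rw [toRDual_apply, map_mul]
      let hx : C.LDual := h.toAlgHom x
      let hy : C.LDual := h.toAlgHom y
      change hy.1 (C.contr hx (C.comul z)) = _
      generalize C.comul z = w
      induction w using Bal.ind with
      | h0 => simp
      | ht m n =>
        rw [ACoring.contr_bt]
        refine (hr (hx.1 n) m y).trans ?_
        exact (zetaPair_bt _ _ _ _ _ _ _).symm
      | ha p q hp hq => simp only [map_add, hp, hq] }

theorem ldualFunctor_isRightAdjoint : (ldualFunctor k A).IsRightAdjoint := by
  choose T ξ hT using exists_isUniv (k := k) (A := A)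
  let η : ∀ R : ARing k A, R ⟶ (T R).ldual := fun R => ofZeta (ξ R) (hT R).zeta
  have hη : ∀ (R : ARing k A) (C : ACoring k A) (g : C ⟶ T R) (z : C.carrier),
      toRDual (η R ≫ ACoring.ldualMap g) z = ξ R (g.toLin z) := fun R C g z => rfl
  let e : ∀ (R : ARing k A) (C : (ACoring k A)ᵒᵖ),
      (op (T R) ⟶ C) ≃ (R ⟶ (ldualFunctor k A).obj C) := fun R C =>
    Equiv.ofBijective (fun g => η R ≫ (ldualFunctor k A).map g)
      ⟨fun g h hgh => by
        refine Quiver.Hom.unop_inj ((hT R).uniq C.unop g.unop h.unop fun x => ?_)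
        rw [← hη, ← hη]
        exact congrArg (fun f : R ⟶ C.unop.ldual => toRDual f x) hgh,
      fun h => by
        obtain ⟨g, hg⟩ := (hT R).exists_hom C.unop (toRDual h) (zetaProp_toRDual h)
        refine ⟨g.op, toRDual_injective (C := C.unop) (LinearMap.ext fun z => ?_)⟩
        exact (hη R C.unop g z).trans (hg z)⟩
  have he : ∀ R C C' g h, e R C' (h ≫ g) = e R C h ≫ (ldualFunctor k A).map g :=
    fun R C C' g h => by
      exact (congrArg (fun t => η R ≫ t) ((ldualFunctor k A).map_comp h g)).trans
        (Category.assoc _ _ _).symm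
  exact ⟨_, ⟨Adjunction.adjunctionOfEquivLeft e he⟩⟩

/-- The coring `R^•` is universal among the corings over `R^*`. -/
theorem isUniv_bullet {L : ARing k A ⥤ (ACoring k A)ᵒᵖ} (adj : L ⊣ ldualFunctor k A)
    (R : ARing k A) : IsUniv (bullet L R) (xi adj R) := by
  have key : ∀ (C : ACoring k A) (g : C ⟶ bullet L R),
      toRDual (C := C) (adj.homEquiv R (op C) g.op) = (xi adj R).comp g.toLin := fun C g => by
    rw [Adjunction.homEquiv_unit]; rfl
  refine ⟨zetaProp_toRDual _, fun C f hf => ?_, fun C g h hgh => ?_⟩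
  · refine ⟨((adj.homEquiv R (op C)).symm (ofZeta f hf)).unop, fun x => ?_⟩
    have e := Equiv.apply_symm_apply (adj.homEquiv R (op C)) (ofZeta f hf)
    exact (LinearMap.congr_fun (key C _) x).symm.trans
      (congrArg (fun q : R ⟶ C.ldual => toRDual q x) e)
  · have : adj.homEquiv R (op C) g.op = adj.homEquiv R (op C) h.op :=
      toRDual_injective (C := C) (by
        rw [key, key]; exact LinearMap.ext hgh)
    exact Quiver.Hom.op_inj ((adj.homEquiv R (op C)).injective this)

/-! ### Right modules over an `A`-ring -/

/-- Right multiplication makes an `A`-ring an `A`-module. -/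
instance ARing.instModule (R : ARing k A) : Module A R.carrier :=
  Module.compHom R.carrier R.r.toRingHom

theorem ARing.smul_def (R : ARing k A) (a : A) (x : R.carrier) : a • x = x * R.s a := rfl

instance ARing.instTower (R : ARing k A) : IsScalarTower k A R.carrier :=
  ⟨fun c a x => by simp [ARing.smul_def]⟩

/-- Right modules over the `A`-ring `R`, on a type that already carries the induced structure of
`A`-module. -/
class RAct (R : ARing k A) (X : Type*) [AddCommGroup X] [Module k X] [Module A X] where
  /-- The action. -/
  act' : X →ₗ[k] R.carrier →ₗ[k] X
  act_one' : ∀ p, act' p 1 = p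
  act_mul' : ∀ p x y, act' p (x * y) = act' (act' p x) y
  act_s' : ∀ p a, act' p (R.s a) = a • p

section RAct

variable (R : ARing k A)
variable {X Y Z : Type*} [AddCommGroup X] [Module k X] [Module A X] [RAct R X]
variable [AddCommGroup Y] [Module k Y] [Module A Y] [RAct R Y]
variable [AddCommGroup Z] [Module k Z] [Module A Z] [RAct R Z]

/-- The action of `R` on a right module. -/
def act : X →ₗ[k] R.carrier →ₗ[k] X := RAct.act'

theorem act_one (p : X) : act R p 1 = p := RAct.act_one' p
theorem act_mul (p : X) (x y : R.carrier) : act R p (x * y) = act R (act R p x) y :=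
  RAct.act_mul' p x y
theorem act_s (p : X) (a : A) : act R p (R.s a) = a • p := RAct.act_s' p a

theorem act_r (p : X) (x : R.carrier) (a : A) : act R p (x * R.s a) = a • act R p x := by
  rw [act_mul, act_s]

theorem act_smul_left (p : X) (x : R.carrier) (a : A) :
    act R (a • p) x = act R p (R.s a * x) := by
  rw [act_mul, act_s]

/-- `R`-linear maps. -/
def IsRLin (t : X →ₗ[A] Y) : Prop := ∀ p x, t (act R p x) = act R (t p) x

variable {R}

theorem IsRLin.comp {t' : Y →ₗ[A] Z} {t : X →ₗ[A] Y} (h' : IsRLin R t') (h : IsRLin R t) :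
    IsRLin R (t'.comp t) := fun p x => by
  rw [LinearMap.comp_apply, h, h', LinearMap.comp_apply]

theorem IsRLin.symm {t : X ≃ₗ[A] Y} (h : IsRLin R t.toLinearMap) :
    IsRLin R t.symm.toLinearMap := fun p x => by
  apply t.injective
  have := h (t.symm p) x
  simp only [LinearEquiv.coe_coe, LinearEquiv.apply_symm_apply] at this ⊢
  exact this.symm

variable (R)

instance FGPMod.instRAct (P : FGPMod R) : RAct R P.S where
  act' := P.act
  act_one' := P.act_one
  act_mul' := P.act_mul
  act_s' := P.act_s

/-- The regular module. -/
instance regularAct : RAct R R.carrier where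
  act' := LinearMap.mul k R.carrier
  act_one' p := by simp
  act_mul' p x y := by simp [mul_assoc]
  act_s' p a := rfl

@[simp] theorem regular_act (x y : R.carrier) : act R x y = x * y := rfl

variable [IsScalarTower k A X] [IsScalarTower k A Y]

/-- The matrix coefficient `x ↦ φ(p x)`. -/
def mcoeff (φ : Module.Dual A X) (p : X) : R.RDual :=
  ⟨(φ.restrictScalars k).comp (act R p), fun v a => by simp [act_r, mul_comm]⟩

@[simp] theorem mcoeff_apply (φ : Module.Dual A X) (p : X) (x : R.carrier) :
    (mcoeff R φ p).1 x = φ (act R p x) := rfl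

theorem mcoeff_comp {t : X →ₗ[A] Y} (ht : IsRLin R t) (ψ : Module.Dual A Y) (p : X) :
    mcoeff R (ψ.comp t) p = mcoeff R ψ (t p) := by
  apply Subtype.ext; ext x
  simp [ht p x]

/-- An element of `R^*`, as an `A`-linear map on the regular module. -/
def rdualToDual (f : R.RDual) : Module.Dual A R.carrier where
  toFun := f.1
  map_add' := map_add f.1
  map_smul' a x := by rw [ARing.smul_def, f.2, mul_comm]; rfl

@[simp] theorem rdualToDual_apply (f : R.RDual) (x : R.carrier) : rdualToDual R f x = f.1 x := rfl

theorem mcoeff_regular (f : R.RDual) : mcoeff R (rdualToDual R f) 1 = f := by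
  apply Subtype.ext; ext x
  simp

end RAct

/-! ### Tensor products of modules over a cocommutative bialgebroid -/

section TensorAct

variable (U : CCBialgd k A)
variable {X Y Z : Type*} [AddCommGroup X] [Module k X] [Module A X] [IsScalarTower k A X]
variable [RAct U.toARing X]
variable [AddCommGroup Y] [Module k Y] [Module A Y] [IsScalarTower k A Y] [RAct U.toARing Y]
variable [AddCommGroup Z] [Module k Z] [Module A Z] [IsScalarTower k A Z] [RAct U.toARing Z]

/-- The map `u ⊗ v ↦ x u ⊗ y v`. -/
def tpair (x : X) (y : Y) : U.TRR →ₗ[k] X ⊗[A] Y :=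
  Bal.lift
    (LinearMap.mk₂ k (fun u v => act U.toARing x u ⊗ₜ[A] act U.toARing y v)
      (by intros; simp [TensorProduct.add_tmul])
      (by intros; simp [TensorProduct.smul_tmul'])
      (by intros; simp [TensorProduct.tmul_add])
      (by intros; simp))
    ⟨fun a u v => by
      change act U.toARing x (u * U.s a) ⊗ₜ[A] act U.toARing y v =
        act U.toARing x u ⊗ₜ[A] act U.toARing y (v * U.s a)
      rw [act_r, act_r, TensorProduct.smul_tmul]⟩

@[simp] theorem tpair_bt (x : X) (y : Y) (u v : U.carrier) :
    tpair U x y (bt U.r U.r u v) = act U.toARing x u ⊗ₜ[A] act U.toARing y v := by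
  rw [tpair, Bal.lift_bt]; rfl

theorem tpair_add_left (x x' : X) (y : Y) (w : U.TRR) :
    tpair U (x + x') y w = tpair U x y w + tpair U x' y w := by
  induction w using Bal.ind with
  | h0 => simp
  | ht u v => simp [TensorProduct.add_tmul]
  | ha p q hp hq => simp only [map_add, hp, hq]; abel

theorem tpair_add_right (x : X) (y y' : Y) (w : U.TRR) :
    tpair U x (y + y') w = tpair U x y w + tpair U x y' w := by
  induction w using Bal.ind with
  | h0 => simp
  | ht u v => simp [TensorProduct.tmul_add]
  | ha p q hp hq => simp only [map_add, hp, hq]; abel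

theorem tpair_act (x : X) (y : Y) (u v : U.carrier) (w : U.TRR) :
    tpair U (act U.toARing x u) (act U.toARing y v) w = tpair U x y (U.mulLL u v w) := by
  induction w using Bal.ind with
  | h0 => simp
  | ht u v => simp [act_mul]
  | ha p q hp hq => simp only [map_add, hp, hq]

theorem tpair_smul_left (a : A) (x : X) (y : Y) (w : U.TRR) :
    tpair U (a • x) y w = tpair U x y (U.mulLL (U.s a) 1 w) := by
  rw [← tpair_act, act_s, act_one]

theorem tpair_smul_right (a : A) (x : X) (y : Y) (w : U.TRR) :
    tpair U x (a • y) w = tpair U x y (U.mulLL 1 (U.s a) w) := by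
  rw [← tpair_act, act_s, act_one]

theorem tpair_actL (a : A) (x : X) (y : Y) (w : U.TRR) :
    tpair U x y (Bal.actL U.r U.r U.rr a w) = a • tpair U x y w := by
  induction w using Bal.ind with
  | h0 => simp
  | ht u v => simp [act_r, TensorProduct.smul_tmul']
  | ha p q hp hq => simp only [map_add, hp, hq, smul_add]

/-- The action of `u` on a tensor product: `(x ⊗ y) u = x u₁ ⊗ y u₂`. -/
def tensorActAux (u : U.carrier) : X ⊗[A] Y →+ X ⊗[A] Y :=
  TensorProduct.liftAddHom
    (AddMonoidHom.mk'
      (fun x => AddMonoidHom.mk' (fun y => tpair U x y (U.comul u))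
        (fun y y' => tpair_add_right U x y y' _))
      (fun x x' => by ext y; exact tpair_add_left U x x' y _))
    (fun a x y => by
      change tpair U (a • x) y _ = tpair U x (a • y) _
      rw [tpair_smul_left, tpair_smul_right, U.comul_tak u a])

theorem tensorActAux_tmul (u : U.carrier) (x : X) (y : Y) :
    tensorActAux U u (x ⊗ₜ[A] y) = tpair U x y (U.comul u) :=
  TensorProduct.liftAddHom_tmul _ _ _ _

theorem tensorActAux_smul (c : k) (u : U.carrier) (t : X ⊗[A] Y) :
    tensorActAux U u (c • t) = c • tensorActAux U u t := by
  induction t using TensorProduct.induction_on with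
  | zero => simp
  | tmul x y =>
    rw [TensorProduct.smul_tmul', tensorActAux_tmul, tensorActAux_tmul]
    generalize U.comul u = w
    induction w using Bal.ind with
    | h0 => simp
    | ht u v => simp [TensorProduct.smul_tmul']
    | ha p q hp hq => simp only [map_add, hp, hq, smul_add]
  | add p q hp hq => simp only [smul_add, map_add, hp, hq]

/-- The tensor product of two right `U`-modules, with the action `(x ⊗ y) u = x u₁ ⊗ y u₂`. -/
instance tensorAct : RAct U.toARing (X ⊗[A] Y) where
  act' := LinearMap.mk₂ k (fun t u => tensorActAux U u t)
    (fun t t' u => map_add _ t t')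
    (fun c t u => tensorActAux_smul U c u t)
    (fun t u v => by
      induction t using TensorProduct.induction_on with
      | zero => simp
      | tmul x y => simp [tensorActAux_tmul]
      | add p q hp hq => simp only [map_add, hp, hq]; abel)
    (fun c t u => by
      induction t using TensorProduct.induction_on with
      | zero => simp
      | tmul x y => simp [tensorActAux_tmul]
      | add p q hp hq => simp only [map_add, hp, hq, smul_add])
  act_one' t := by
    induction t using TensorProduct.induction_on with
    | zero => simp
    | tmul x y =>
      simp [tensorActAux_tmul, U.comul_one, act_one]
    | add p q hp hq => simp only [map_add, LinearMap.add_apply, hp, hq]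
  act_mul' t u v := by
    induction t using TensorProduct.induction_on with
    | zero => simp
    | tmul x y =>
      simp only [LinearMap.mk₂_apply, tensorActAux_tmul, U.comul_mul]
      generalize U.comul u = w
      induction w using Bal.ind with
      | h0 => simp
      | ht p q => simp [tensorActAux_tmul, tpair_act]
      | ha p q hp hq => simp only [map_add, hp, hq]
    | add p q hp hq => simp only [map_add, LinearMap.add_apply, hp, hq]
  act_s' t a := by
    induction t using TensorProduct.induction_on with
    | zero => simp
    | tmul x y =>
      simp [tensorActAux_tmul, U.comul_s, act_one, act_s, TensorProduct.smul_tmul']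
    | add p q hp hq => simp only [map_add, LinearMap.add_apply, hp, hq, smul_add]

theorem act_tmul (x : X) (y : Y) (u : U.carrier) :
    act U.toARing (x ⊗ₜ[A] y) u = tpair U x y (U.comul u) := tensorActAux_tmul U u x y

/-- The base algebra, with the action `a · u = ε(a u)`. -/
instance baseAct : RAct U.toARing A where
  act' := LinearMap.mk₂ k (fun a u => U.counit (U.s a * u))
    (by intros; simp [add_mul]) (by intros; simp) (by intros; simp [mul_add]) (by intros; simp)
  act_one' a := by
    have := U.counit_r 1 a
    rw [one_mul, U.counit_one, one_mul] at this
    simp [this]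
  act_mul' a u v := by
    simp only [LinearMap.mk₂_apply]
    rw [← mul_assoc, U.counit_mul]
  act_s' a b := by
    have := U.counit_r 1 (a * b)
    rw [one_mul, U.counit_one, one_mul] at this
    simp [← map_mul, this, mul_comm]

theorem act_base (a : A) (u : U.carrier) : act U.toARing a u = U.counit (U.s a * u) := rfl

theorem counit_s (a : A) : U.counit (U.s a) = a := by
  have := U.counit_r 1 a
  rwa [one_mul, U.counit_one, one_mul] at this

variable {U}

theorem isRLin_tensor {t : X ⊗[A] Y →ₗ[A] Z}
    (h : ∀ x y u, t (tpair U x y (U.comul u)) = act U.toARing (t (x ⊗ₜ y)) u) :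
    IsRLin U.toARing t := fun p u => by
  induction p using TensorProduct.induction_on with
  | zero => simp
  | tmul x y => rw [act_tmul, h]
  | add p q hp hq => simp only [map_add, LinearMap.add_apply, hp, hq]

variable (U) (X Y Z)

theorem isRLin_assoc : IsRLin U.toARing (TensorProduct.assoc A X Y Z).toLinearMap := by
  have key : ∀ (x : X) (y : Y) (z : Z) (u : U.carrier),
      TensorProduct.assoc A X Y Z (act U.toARing ((x ⊗ₜ y) ⊗ₜ z) u) =
        act U.toARing (x ⊗ₜ[A] (y ⊗ₜ[A] z)) u := fun x y z u => by
    let T : Bal U.r (Bal.actL U.r U.r U.rr) →ₗ[k] X ⊗[A] (Y ⊗[A] Z) :=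
      Bal.lift
        (LinearMap.mk₂ k (fun p w => act U.toARing x p ⊗ₜ[A] tpair U y z w)
          (by intros; simp [TensorProduct.add_tmul])
          (by intros; simp [TensorProduct.smul_tmul'])
          (by intros; simp [TensorProduct.tmul_add])
          (by intros; simp))
        ⟨fun a p w => by
          change act U.toARing x (p * U.s a) ⊗ₜ[A] tpair U y z w =
            act U.toARing x p ⊗ₜ[A] tpair U y z (Bal.actL U.r U.r U.rr a w)
          rw [act_r, tpair_actL, TensorProduct.smul_tmul]⟩
    have hT : ∀ p w, T (bt _ _ p w) = act U.toARing x p ⊗ₜ[A] tpair U y z w := fun p w => by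
      rw [Bal.lift_bt]; rfl
    have h1 : ∀ w, TensorProduct.assoc A X Y Z (tpair U (x ⊗ₜ y) z w) =
        T (Bal.assoc U.r U.r U.r U.r U.rr
          (Bal.map U.comul LinearMap.id ⟨U.comul_r⟩ ⟨fun _ _ => rfl⟩ w)) := fun w => by
      induction w using Bal.ind with
      | h0 => simp
      | ht p q =>
        rw [tpair_bt, Bal.map_bt, act_tmul]
        generalize U.comul p = w
        induction w using Bal.ind with
        | h0 => simp
        | ht p q => rw [Bal.assoc_bt, hT]; simp
        | ha p q hp hq => simp only [map_add, TensorProduct.add_tmul, bt_add_left, hp, hq]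
      | ha p q hp hq => simp only [map_add, hp, hq]
    rw [act_tmul, act_tmul, h1, U.coassoc]
    generalize U.comul u = w
    induction w using Bal.ind with
    | h0 => simp
    | ht p q => rw [Bal.map_bt, hT, tpair_bt, act_tmul]; rfl
    | ha p q hp hq => simp only [map_add, hp, hq]
  intro t u
  induction t using TensorProduct.induction_on with
  | zero => simp
  | tmul p z =>
    induction p using TensorProduct.induction_on with
    | zero => simp
    | tmul x y => exact key x y z u
    | add p q hp hq =>
      simp only [TensorProduct.add_tmul, map_add, LinearMap.add_apply, hp, hq]
  | add p q hp hq => simp only [map_add, LinearMap.add_apply, hp, hq]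

theorem isRLin_comm : IsRLin U.toARing (TensorProduct.comm A X Y).toLinearMap := by
  refine isRLin_tensor fun x y u => ?_
  rw [LinearEquiv.coe_coe, TensorProduct.comm_tmul, act_tmul]
  conv_rhs => rw [← U.cocomm]
  generalize U.comul u = w
  induction w using Bal.ind with
  | h0 => simp
  | ht p q => simp
  | ha p q hp hq => simp only [map_add, hp, hq]

theorem isRLin_lid : IsRLin U.toARing (TensorProduct.lid A X).toLinearMap := by
  refine isRLin_tensor fun a x u => ?_
  rw [LinearEquiv.coe_coe, TensorProduct.lid_tmul, act_smul_left]
  have : ∀ w, TensorProduct.lid A X (tpair U a x w) =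
      act U.toARing x (Bal.lift (P := U.carrier) (U.r.toLinearMap.comp U.counit)
      ⟨fun a m n => by
        change n * U.s (U.counit (m * U.s a)) = n * U.s a * U.s (U.counit m)
        rw [U.counit_r, mul_comm, map_mul, mul_assoc]⟩ (U.mulLL (U.s a) 1 w)) := fun w => by
    induction w using Bal.ind with
    | h0 => simp
    | ht p q => simp [act_base, act_r]
    | ha p q hp hq => simp only [map_add, hp, hq]
  rw [this, ← U.comul_l, U.counit_comul]

variable {X Y Z}

theorem isRLin_map {X' Y' : Type*} [AddCommGroup X'] [Module k X'] [Module A X']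
    [IsScalarTower k A X'] [RAct U.toARing X'] [AddCommGroup Y'] [Module k Y'] [Module A Y']
    [IsScalarTower k A Y'] [RAct U.toARing Y'] {f : X →ₗ[A] X'} {g : Y →ₗ[A] Y'}
    (hf : IsRLin U.toARing f) (hg : IsRLin U.toARing g) :
    IsRLin U.toARing (TensorProduct.map f g) := by
  refine isRLin_tensor fun x y u => ?_
  rw [TensorProduct.map_tmul, act_tmul]
  generalize U.comul u = w
  induction w using Bal.ind with
  | h0 => simp
  | ht p q => simp [hf x p, hg y q]
  | ha p q hp hq => simp only [map_add, hp, hq]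

/-- The linear form `x ⊗ y ↦ φ(x) ψ(y)`. -/
def dualMul (φ : Module.Dual A X) (ψ : Module.Dual A Y) : Module.Dual A (X ⊗[A] Y) :=
  (LinearMap.mul' A A).comp (TensorProduct.map φ ψ)

@[simp] theorem dualMul_tmul (φ : Module.Dual A X) (ψ : Module.Dual A Y) (x : X) (y : Y) :
    dualMul φ ψ (x ⊗ₜ y) = φ x * ψ y := rfl

theorem dualMul_tpair (φ : Module.Dual A X) (ψ : Module.Dual A Y) (x : X) (y : Y) (w : U.TRR) :
    dualMul φ ψ (tpair U x y w) =
      U.convPair (mcoeff U.toARing φ x) (mcoeff U.toARing ψ y) w := by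
  induction w using Bal.ind with
  | h0 => simp
  | ht p q => simp [CCBialgd.convPair]
  | ha p q hp hq => simp only [map_add, hp, hq]

/-- Products of matrix coefficients are matrix coefficients of tensor products. -/
theorem mcoeff_dualMul (φ : Module.Dual A X) (ψ : Module.Dual A Y) (x : X) (y : Y)
    (u : U.carrier) :
    (mcoeff U.toARing (dualMul φ ψ) (x ⊗ₜ y)).1 u =
      U.conv (mcoeff U.toARing φ x) (mcoeff U.toARing ψ y) u := by
  rw [mcoeff_apply, act_tmul, dualMul_tpair]; rfl

/-- The convolution product of two elements of `U^*`. -/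
def convR (f g : U.RDual) : U.RDual :=
  mcoeff U.toARing (dualMul (rdualToDual U.toARing f) (rdualToDual U.toARing g))
    ((1 : U.carrier) ⊗ₜ[A] (1 : U.carrier))

theorem convR_apply (f g : U.RDual) (u : U.carrier) : (convR U f g).1 u = U.conv f g u := by
  rw [convR, mcoeff_dualMul, mcoeff_regular, mcoeff_regular]

theorem convR_mcoeff (φ : Module.Dual A X) (ψ : Module.Dual A Y) (x : X) (y : Y) :
    convR U (mcoeff U.toARing φ x) (mcoeff U.toARing ψ y) =
      mcoeff U.toARing (dualMul φ ψ) (x ⊗ₜ y) := by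
  apply Subtype.ext; ext u
  rw [convR_apply, mcoeff_dualMul]

theorem convR_comm (f g : U.RDual) : convR U f g = convR U g f := by
  rw [convR, convR]
  have h := isRLin_comm U U.carrier U.carrier
  rw [show (1 : U.carrier) ⊗ₜ[A] (1 : U.carrier) =
    (TensorProduct.comm A U.carrier U.carrier).toLinearMap (1 ⊗ₜ[A] 1) from rfl,
    ← mcoeff_comp U.toARing h]
  congr 1
  ext x y
  simp [mul_comm]

theorem convR_assoc (f g h : U.RDual) : convR U (convR U f g) h = convR U f (convR U g h) := by
  have e := isRLin_assoc U U.carrier U.carrier U.carrier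
  have c : ∀ f g : U.RDual, convR U f g = mcoeff U.toARing
      (dualMul (rdualToDual U.toARing f) (rdualToDual U.toARing g))
      ((1 : U.carrier) ⊗ₜ[A] (1 : U.carrier)) := fun _ _ => rfl
  conv_lhs => rw [← mcoeff_regular U.toARing h, c f g, convR_mcoeff]
  conv_rhs => rw [← mcoeff_regular U.toARing f, c g h, convR_mcoeff]
  rw [show (1 : U.carrier) ⊗ₜ[A] ((1 : U.carrier) ⊗ₜ[A] (1 : U.carrier)) =
    (TensorProduct.assoc A U.carrier U.carrier U.carrier).toLinearMap
      ((1 ⊗ₜ[A] 1) ⊗ₜ[A] 1) from rfl, ← mcoeff_comp U.toARing e]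
  congr 1
  ext x y z
  simp [mul_assoc]

/-- The counit, as an element of `U^*`. -/
def counitR : U.RDual := ⟨U.counit, U.counit_r⟩

theorem counitR_eq : counitR U = mcoeff U.toARing (LinearMap.id : A →ₗ[A] A) 1 := by
  apply Subtype.ext; ext u
  simp [counitR, act_base]

theorem convR_counit (f : U.RDual) : convR U (counitR U) f = f := by
  conv_lhs => rw [counitR_eq, ← mcoeff_regular U.toARing f, convR_mcoeff]
  conv_rhs => rw [← mcoeff_regular U.toARing f]
  have e := isRLin_lid U U.carrier
  rw [show (1 : U.carrier) = (TensorProduct.lid A U.carrier).toLinearMap ((1 : A) ⊗ₜ 1) by simp,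
    ← mcoeff_comp U.toARing e]
  simp only [LinearEquiv.coe_coe, TensorProduct.lid_tmul, one_smul]
  congr 1
  ext x
  simp

end TensorAct

/-! ### The translation map -/

namespace CCHopf

variable (U : CCHopf k A)

theorem beta_bt (u v : U.carrier) :
    U.beta (bt U.r U.l u v) = U.mulLL u 1 (U.comul v) := Bal.lift_bt _ _ _ _

theorem beta_transl (u : U.carrier) : U.beta (U.transl u) = bt U.r U.r 1 u :=
  Equiv.apply_symm_apply (Equiv.ofBijective _ U.beta_bij) _

theorem transl_add (u v : U.carrier) : U.transl (u + v) = U.transl u + U.transl v :=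
  U.beta_bij.1 (by simp only [map_add, beta_transl, bt_add_right])

theorem transl_smul (c : k) (u : U.carrier) : U.transl (c • u) = c • U.transl u :=
  U.beta_bij.1 (by simp only [map_smul, beta_transl, bt_smul_right])

/-- The map `x ⊗ y ↦ m x ⊗ y n` on `U_A ⊗_A (_A U)`. -/
def mulOut (m n : U.carrier) : U.TRL →ₗ[k] U.TRL :=
  Bal.map (LinearMap.mulLeft k m) (LinearMap.mulRight k n)
    ⟨fun a x => by simp [mul_assoc]⟩ ⟨fun a x => by simp [mul_assoc]⟩

@[simp] theorem mulOut_bt (m n x y : U.carrier) :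
    U.mulOut m n (bt U.r U.l x y) = bt U.r U.l (m * x) (y * n) := by
  simp [mulOut]

theorem mulLL_actR (x y : U.carrier) (a : A) (w : U.TRR) :
    U.mulLL x y (Bal.actR U.r U.r U.rr a w) = Bal.actR U.r U.r U.rr a (U.mulLL x y w) := by
  induction w using Bal.ind with
  | h0 => simp
  | ht p q => simp [mul_assoc]
  | ha p q hp hq => simp only [map_add, hp, hq]

theorem beta_mulOut_left (m : U.carrier) (z : U.TRL) :
    U.beta (U.mulOut m 1 z) = U.mulLL m 1 (U.beta z) := by
  induction z using Bal.ind with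
  | h0 => simp
  | ht p q => rw [mulOut_bt, beta_bt, beta_bt, ARing.mulLL_mulLL, mul_one, mul_one]
  | ha p q hp hq => simp only [map_add, hp, hq]

theorem beta_mulOut_s (a : A) (z : U.TRL) :
    U.beta (U.mulOut 1 (U.s a) z) = Bal.actR U.r U.r U.rr a (U.beta z) := by
  induction z using Bal.ind with
  | h0 => simp
  | ht p q =>
    rw [mulOut_bt, beta_bt, beta_bt, one_mul, ← mulLL_actR, ← U.comul_r]; rfl
  | ha p q hp hq => simp only [map_add, hp, hq]

/-- `a u₋ ⊗ u₊ = u₋ ⊗ u₊ a`. -/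
theorem transl_s (a : A) (u : U.carrier) :
    U.mulOut (U.s a) 1 (U.transl u) = U.mulOut 1 (U.s a) (U.transl u) :=
  U.beta_bij.1 (by
    rw [beta_mulOut_left, beta_mulOut_s, beta_transl, ARing.mulLL_bt, Bal.actR_bt, ← bt_bal]
    simp)

/-- The map `x ⊗ y ↦ x ⊗ a y` on `U_A ⊗_A (_A U)`. -/
def mulIn (a : A) : U.TRL →ₗ[k] U.TRL :=
  Bal.actR U.r U.l (fun a b x => by simp [← mul_assoc, ← map_mul, mul_comm])  a

@[simp] theorem mulIn_bt (a : A) (x y : U.carrier) :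
    U.mulIn a (bt U.r U.l x y) = bt U.r U.l x (U.s a * y) := by
  simp [mulIn]

/-- `(a u)₋ ⊗ (a u)₊ = u₋ ⊗ a u₊`. -/
theorem transl_s_mul (a : A) (u : U.carrier) : U.transl (U.s a * u) = U.mulIn a (U.transl u) := by
  have : ∀ z, U.beta (U.mulIn a z) = U.mulLL 1 (U.s a) (U.beta z) := fun z => by
    induction z using Bal.ind with
    | h0 => simp
    | ht p q =>
      rw [mulIn_bt, beta_bt, beta_bt, U.comul_l, U.comul_tak, ARing.mulLL_mulLL,
        ARing.mulLL_mulLL, one_mul, one_mul, mul_one, mul_one]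
    | ha p q hp hq => simp only [map_add, hp, hq]
  exact U.beta_bij.1 (by rw [this, beta_transl, beta_transl, ARing.mulLL_bt, one_mul])

theorem transl_one : U.transl 1 = bt U.r U.l 1 1 :=
  U.beta_bij.1 (by rw [beta_transl, beta_bt, U.comul_one, ARing.mulLL_bt, one_mul])

/-- `(u v)₋ ⊗ (u v)₊ = v₋ u₋ ⊗ u₊ v₊`. -/
theorem transl_mul (u v : U.carrier) {n : ℕ} {x y : Fin n → U.carrier}
    (h : U.transl v = ∑ i, bt U.r U.l (x i) (y i)) :
    U.transl (u * v) = ∑ i, U.mulOut (x i) (y i) (U.transl u) := by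
  have key : ∀ p q z, U.beta (U.mulOut p q z) =
      U.mulLL p 1 (U.takMul (U.comul q) (U.comul_tak q) (U.beta z)) := fun p q z => by
    induction z using Bal.ind with
    | h0 => simp
    | ht a b =>
      rw [mulOut_bt, beta_bt, beta_bt, U.comul_mul]
      generalize U.comul b = w
      induction w using Bal.ind with
      | h0 => simp
      | ht a b =>
        simp only [ARing.takMul_bt, ARing.mulLL_bt, ARing.mulLL_mulLL]
        simp [mul_assoc]
      | ha p q hp hq => simp only [map_add, hp, hq]
    | ha p q hp hq => simp only [map_add, hp, hq]
  apply U.beta_bij.1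
  rw [beta_transl, map_sum]
  simp only [key, beta_transl, ARing.takMul_bt, ARing.mulLL_mulLL, mul_one, one_mul]
  have e : ∀ i, U.mulLL (x i) u (U.comul (y i)) =
      U.mulLL 1 u (U.beta (bt U.r U.l (x i) (y i))) := fun i => by
    rw [beta_bt, ARing.mulLL_mulLL, one_mul, mul_one]
  simp only [e]
  rw [← map_sum, ← map_sum, ← h, beta_transl, ARing.mulLL_bt, mul_one]

@[simp] theorem antiPair_bt (f : U.RDual) (v w : U.carrier) :
    U.antiPair f (bt U.r U.l v w) = U.counit (U.s (f.1 v) * w) := by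
  simp [antiPair]

end CCHopf

/-! ### Dual modules over a cocommutative Hopf algebroid -/

section DualAct

variable (U : CCHopf k A)
variable {X Y : Type*} [AddCommGroup X] [Module k X] [Module A X] [IsScalarTower k A X]
variable [RAct U.toARing X]
variable [AddCommGroup Y] [Module k Y] [Module A Y] [IsScalarTower k A Y] [RAct U.toARing Y]

theorem antiPair_mulOut_s (f : U.RDual) (a : A) (z : U.TRL) :
    U.antiPair f (U.mulOut 1 (U.s a) z) = a * U.antiPair f z := by
  induction z using Bal.ind with
  | h0 => simp
  | ht p q =>
    rw [U.mulOut_bt, U.antiPair_bt, U.antiPair_bt, ← mul_assoc, U.counit_r, one_mul, mul_comm]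
  | ha p q hp hq => simp only [map_add, hp, hq, mul_add]

theorem antiPair_act (φ : Module.Dual A X) (p : X) (m n : U.carrier) (z : U.TRL) :
    U.antiPair (mcoeff U.toARing φ p) (U.mulOut m n z) =
      U.counit (U.s (U.antiPair (mcoeff U.toARing φ (act U.toARing p m)) z) * n) := by
  induction z using Bal.ind with
  | h0 => simp
  | ht x y =>
    rw [U.mulOut_bt, U.antiPair_bt, U.antiPair_bt, ← U.counit_mul, mul_assoc, mcoeff_apply,
      mcoeff_apply, act_mul]
  | ha p q hp hq => simp only [map_add, hp, hq, add_mul]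

theorem mcoeff_add_right (φ : Module.Dual A X) (p q : X) :
    mcoeff U.toARing φ (p + q) = mcoeff U.toARing φ p + mcoeff U.toARing φ q := by
  apply Subtype.ext; ext x; simp

theorem mcoeff_add_left (φ ψ : Module.Dual A X) (p : X) :
    mcoeff U.toARing (φ + ψ) p = mcoeff U.toARing φ p + mcoeff U.toARing ψ p := by
  apply Subtype.ext; ext x; simp

theorem mcoeff_smul_left (c : k) (φ : Module.Dual A X) (p : X) :
    mcoeff U.toARing (c • φ) p = c • mcoeff U.toARing φ p := by
  apply Subtype.ext; ext x; simp

theorem antiPair_add (f g : U.RDual) (z : U.TRL) :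
    U.antiPair (f + g) z = U.antiPair f z + U.antiPair g z := by
  induction z using Bal.ind with
  | h0 => simp
  | ht x y => simp [add_mul]
  | ha p q hp hq => simp only [map_add, hp, hq]; abel

theorem antiPair_smul (c : k) (f : U.RDual) (z : U.TRL) :
    U.antiPair (c • f) z = c • U.antiPair f z := by
  induction z using Bal.ind with
  | h0 => simp
  | ht x y => simp
  | ha p q hp hq => simp only [map_add, hp, hq, smul_add]

/-- The action on the dual module: `(φ u)(p) = ε(φ(p u₋) u₊)`. -/
def dualActAux (φ : Module.Dual A X) (u : U.carrier) : Module.Dual A X where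
  toFun p := U.antiPair (mcoeff U.toARing φ p) (U.transl u)
  map_add' p q := by rw [mcoeff_add_right, antiPair_add]
  map_smul' a p := by
    have := antiPair_act U φ p (U.s a) 1 (U.transl u)
    rw [U.transl_s, antiPair_mulOut_s, act_s, mul_one, counit_s] at this
    exact this.symm

theorem dualActAux_apply (φ : Module.Dual A X) (u : U.carrier) (p : X) :
    dualActAux U φ u p = U.antiPair (mcoeff U.toARing φ p) (U.transl u) := rfl

instance dualAct : RAct U.toARing (Module.Dual A X) where
  act' := LinearMap.mk₂ k (dualActAux U)
    (fun φ ψ u => LinearMap.ext fun p => by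
      rw [LinearMap.add_apply]
      simp only [dualActAux_apply, mcoeff_add_left, antiPair_add])
    (fun c φ u => LinearMap.ext fun p => by
      rw [LinearMap.smul_apply]
      simp only [dualActAux_apply, mcoeff_smul_left, antiPair_smul])
    (fun φ u v => LinearMap.ext fun p => by
      rw [LinearMap.add_apply]
      simp only [dualActAux_apply, U.transl_add, map_add])
    (fun c φ u => LinearMap.ext fun p => by
      rw [LinearMap.smul_apply]
      simp only [dualActAux_apply, U.transl_smul, map_smul])
  act_one' φ := LinearMap.ext fun p => by
    rw [LinearMap.mk₂_apply, dualActAux_apply, U.transl_one, U.antiPair_bt, mul_one, counit_s,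
      mcoeff_apply, act_one]
  act_mul' φ u v := LinearMap.ext fun p => by
    simp only [LinearMap.mk₂_apply, dualActAux_apply]
    obtain ⟨n, x, y, h⟩ := (U.transl v).exists_sum
    rw [U.transl_mul u v h, map_sum, h, map_sum]
    refine Finset.sum_congr rfl fun i _ => ?_
    rw [antiPair_act, U.antiPair_bt, mcoeff_apply]
    rfl
  act_s' φ a := LinearMap.ext fun p => by
    rw [LinearMap.mk₂_apply, dualActAux_apply, ← mul_one (U.s a), U.transl_s_mul, U.transl_one,
      U.mulIn_bt, U.antiPair_bt, mcoeff_apply, act_one, mul_one, ← map_mul, counit_s,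
      LinearMap.smul_apply, smul_eq_mul, mul_comm]

theorem act_dual (φ : Module.Dual A X) (u : U.carrier) (p : X) :
    act U.toARing φ u p = U.antiPair (mcoeff U.toARing φ p) (U.transl u) := rfl

/-- A map to a dual module is `U`-linear if the corresponding pairing is. -/
theorem isRLin_toDual {t : Y →ₗ[A] Module.Dual A X}
    (h : IsRLin U.toARing (TensorProduct.lift t)) : IsRLin U.toARing t := by
  have h' : ∀ y p u, TensorProduct.lift t (tpair U.toCCBialgd y p (U.comul u)) =
      U.counit (U.s (t y p) * u) := fun y p u => by
    rw [← act_tmul, h, TensorProduct.lift.tmul, act_base]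
  intro y u
  ext p
  have e : ∀ w : U.TRL, U.antiPair (mcoeff U.toARing (t y) p) w =
      TensorProduct.lift t (tpair U.toCCBialgd y p (Bal.flip U.r U.r (U.beta w))) := fun w => by
    induction w using Bal.ind with
    | h0 => simp
    | ht a b =>
      rw [U.antiPair_bt, mcoeff_apply, ← h', U.beta_bt]
      conv_lhs => rw [← U.cocomm]
      generalize U.comul b = w
      induction w using Bal.ind with
      | h0 => simp
      | ht a b => simp [act_mul]
      | ha p q hp hq => simp only [map_add, hp, hq]
    | ha p q hp hq => simp only [map_add, hp, hq]
  rw [act_dual, e, U.beta_transl]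
  simp [act_one]

variable (A X) in
/-- The evaluation `X^* ⊗_A X → A`. -/
def evMap : Module.Dual A X ⊗[A] X →ₗ[A] A := TensorProduct.lift LinearMap.id

@[simp] theorem evMap_tmul (φ : Module.Dual A X) (p : X) : evMap A X (φ ⊗ₜ p) = φ p := rfl

/-- The evaluation is invariant, since `u₂ (u₁)₋ ⊗ (u₁)₊ = 1 ⊗ u`. -/
theorem isRLin_evMap : IsRLin (X := Module.Dual A X ⊗[A] X) (Y := A) U.toARing (evMap A X) := by
  refine isRLin_tensor fun φ p u => ?_
  let γ : U.TRR →ₗ[k] U.TRL := (LinearEquiv.ofBijective U.beta U.beta_bij).symm.toLinearMap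
  have hγ : ∀ w, γ (U.beta w) = w := fun w =>
    LinearEquiv.symm_apply_apply (LinearEquiv.ofBijective U.beta U.beta_bij) w
  have e : ∀ w : U.TRR, evMap A X (tpair U.toCCBialgd φ p w) =
      U.antiPair (mcoeff U.toARing φ p) (γ (Bal.flip U.r U.r w)) := fun w => by
    induction w using Bal.ind with
    | h0 => simp
    | ht a b =>
      have h1 : bt U.r U.r b a = U.beta (U.mulOut b 1 (U.transl a)) := by
        rw [U.beta_mulOut_left, U.beta_transl, ARing.mulLL_bt, mul_one, one_mul]
      rw [Bal.flip_bt, h1, hγ, antiPair_act, mul_one, counit_s, tpair_bt, evMap_tmul, act_dual]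
    | ha p q hp hq => simp only [map_add, hp, hq]
  have h1 : U.comul u = U.beta (bt U.r U.l 1 u) := by
    rw [U.beta_bt]
    generalize U.comul u = w
    induction w using Bal.ind with
    | h0 => simp
    | ht a b => simp
    | ha p q hp hq => rw [map_add, ← hp, ← hq]
  rw [e, U.cocomm, h1, hγ, U.antiPair_bt, mcoeff_apply, act_one, evMap_tmul, act_base]

variable (X) in
theorem isRLin_eval : IsRLin U.toARing (Module.Dual.eval A X) := by
  refine isRLin_toDual U ?_
  have : TensorProduct.lift (Module.Dual.eval A X) =
      (evMap A X).comp (TensorProduct.comm A X (Module.Dual A X)).toLinearMap := by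
    ext x φ; rfl
  rw [this]
  exact (isRLin_evMap U).comp (isRLin_comm U.toCCBialgd X (Module.Dual A X))

theorem isRLin_mul' : IsRLin U.toARing (LinearMap.mul' A A) := by
  have : LinearMap.mul' A A = (TensorProduct.lid A A).toLinearMap := by ext; simp
  rw [this]
  exact isRLin_lid U.toCCBialgd A

/-- The isomorphism `A ≅ A^*` is `U`-linear. -/
theorem isRLin_mul : IsRLin U.toARing (LinearMap.mul A A : A →ₗ[A] Module.Dual A A) :=
  isRLin_toDual U (isRLin_mul' U)

theorem isRLin_dualMap {t : X →ₗ[A] Y} (ht : IsRLin U.toARing t) :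
    IsRLin U.toARing (LinearMap.dualMap t) := fun ψ u => by
  ext p
  rw [LinearMap.dualMap_apply, act_dual, act_dual]
  exact congrArg (fun f => U.antiPair f (U.transl u)) (mcoeff_comp U.toARing ht ψ p).symm

variable (X Y) in
theorem isRLin_tensorTensorTensorComm {X' Y' : Type*} [AddCommGroup X'] [Module k X']
    [Module A X'] [IsScalarTower k A X'] [RAct U.toARing X'] [AddCommGroup Y'] [Module k Y']
    [Module A Y'] [IsScalarTower k A Y'] [RAct U.toARing Y'] :
    IsRLin U.toARing (TensorProduct.tensorTensorTensorComm A X Y X' Y').toLinearMap := by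
  let f1 := (TensorProduct.assoc A X Y (X' ⊗[A] Y')).toLinearMap
  let f2 := (TensorProduct.assoc A Y X' Y').symm.toLinearMap
  let f3 := TensorProduct.map (TensorProduct.comm A Y X').toLinearMap
    (LinearMap.id : Y' →ₗ[A] Y')
  let f4 := (TensorProduct.assoc A X' Y Y').toLinearMap
  let f5 := (TensorProduct.assoc A X X' (Y ⊗[A] Y')).symm.toLinearMap
  have : (TensorProduct.tensorTensorTensorComm A X Y X' Y').toLinearMap =
      f5.comp ((TensorProduct.map (LinearMap.id : X →ₗ[A] X) (f4.comp (f3.comp f2))).comp f1) := by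
    ext x y x' y'
    simp [f1, f2, f3, f4, f5]
  rw [this]
  have h1 : IsRLin U.toARing f1 := isRLin_assoc U.toCCBialgd X Y (X' ⊗[A] Y')
  have h2 : IsRLin U.toARing f2 := (isRLin_assoc U.toCCBialgd Y X' Y').symm
  have h3 : IsRLin U.toARing f3 :=
    isRLin_map U.toCCBialgd (isRLin_comm U.toCCBialgd Y X') (fun _ _ => rfl)
  have h4 : IsRLin U.toARing f4 := isRLin_assoc U.toCCBialgd X' Y Y'
  have h5 : IsRLin U.toARing f5 := (isRLin_assoc U.toCCBialgd X X' (Y ⊗[A] Y')).symm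
  exact h5.comp ((isRLin_map U.toCCBialgd (fun _ _ => rfl) (h4.comp (h3.comp h2))).comp h1)

/-- The product of two invariant pairings is invariant. -/
theorem isRLin_mulPairing {X' Y' : Type*} [AddCommGroup X'] [Module k X']
    [Module A X'] [IsScalarTower k A X'] [RAct U.toARing X'] [AddCommGroup Y'] [Module k Y']
    [Module A Y'] [IsScalarTower k A Y'] [RAct U.toARing Y'] {P : X ⊗[A] X' →ₗ[A] A}
    {Q : Y ⊗[A] Y' →ₗ[A] A} (hP : IsRLin U.toARing P) (hQ : IsRLin U.toARing Q) :
    IsRLin U.toARing (((LinearMap.mul' A A).comp (TensorProduct.map P Q)).comp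
      (TensorProduct.tensorTensorTensorComm A X Y X' Y').toLinearMap) :=
  ((isRLin_mul' U).comp (isRLin_map U.toCCBialgd hP hQ)).comp
    (isRLin_tensorTensorTensorComm U X Y)

variable (X Y) in
/-- The canonical map `X^* ⊗ Y^* → (X ⊗ Y)^*` is `U`-linear. -/
theorem isRLin_dualDistrib : IsRLin (X := Module.Dual A X ⊗[A] Module.Dual A Y)
    (Y := Module.Dual A (X ⊗[A] Y)) U.toARing (TensorProduct.dualDistrib A X Y) := by
  refine isRLin_toDual U ?_
  have : TensorProduct.lift (TensorProduct.dualDistrib A X Y) =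
      ((LinearMap.mul' A A).comp (TensorProduct.map (evMap A X) (evMap A Y))).comp
        (TensorProduct.tensorTensorTensorComm A (Module.Dual A X) (Module.Dual A Y)
          X Y).toLinearMap := by
    ext φ ψ x y
    simp
  rw [this]
  exact isRLin_mulPairing U (isRLin_evMap U) (isRLin_evMap U)

/-- The antipode of `U^*`: `u ↦ ε(f(u₋) u₊)`. -/
def sigmaR (f : U.RDual) : U.RDual :=
  mcoeff U.toARing (Module.Dual.eval A U.carrier 1) (rdualToDual U.toARing f)

theorem sigmaR_apply (f : U.RDual) (u : U.carrier) :
    (sigmaR U f).1 u = U.antiPair f (U.transl u) := by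
  rw [sigmaR, mcoeff_apply, Module.Dual.eval_apply, act_dual, mcoeff_regular]

theorem sigmaR_mcoeff (φ : Module.Dual A X) (p : X) :
    sigmaR U (mcoeff U.toARing φ p) = mcoeff U.toARing (Module.Dual.eval A X p) φ := by
  apply Subtype.ext; ext u
  rw [sigmaR_apply, mcoeff_apply, Module.Dual.eval_apply, act_dual]

theorem sigmaR_sigmaR (f : U.RDual) : sigmaR U (sigmaR U f) = f := by
  conv_rhs => rw [← mcoeff_regular U.toARing f]
  have c : ∀ f : U.RDual, sigmaR U f = mcoeff U.toARing (Module.Dual.eval A U.carrier 1)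
      (rdualToDual U.toARing f) := fun _ => rfl
  rw [c f, sigmaR_mcoeff, ← mcoeff_comp U.toARing (isRLin_eval U U.carrier)]
  rfl

theorem sigmaR_convR (f g : U.RDual) :
    sigmaR U (convR U.toCCBialgd f g) = convR U.toCCBialgd (sigmaR U f) (sigmaR U g) := by
  have h := isRLin_dualDistrib U U.carrier U.carrier
  rw [convR, sigmaR_mcoeff, sigmaR, sigmaR, convR_mcoeff]
  rw [show dualMul (rdualToDual U.toARing f) (rdualToDual U.toARing g) =
    TensorProduct.dualDistrib A U.carrier U.carrier
      (rdualToDual U.toARing f ⊗ₜ rdualToDual U.toARing g) by ext; simp,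
    ← mcoeff_comp U.toARing h]
  congr 1
  ext φ ψ
  simp

theorem sigmaR_counit : sigmaR U (counitR U.toCCBialgd) = counitR U.toCCBialgd := by
  rw [counitR_eq, sigmaR_mcoeff]
  rw [show (LinearMap.id : A →ₗ[A] A) = LinearMap.mul A A 1 by ext; simp,
    ← mcoeff_comp U.toARing (isRLin_mul U)]
  congr 1
  ext
  simp

end DualAct

/-! ### Representatives of matrix coefficients -/

section OfMod

variable (R : ARing k A)
variable (X : Type*) [AddCommGroup X] [Module k X] [Module A X] [IsScalarTower k A X] [RAct R X]
variable {Y : Type*} [AddCommGroup Y] [Module k Y] [Module A Y] [IsScalarTower k A Y] [RAct R Y]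
variable [Module.Finite A X] [Module.Projective A X] [Module.Finite A Y] [Module.Projective A Y]

theorem exists_ofMod : ∃ (P : FGPMod R) (e : X ≃ₗ[A] P.S),
    ∀ p x, e (act R p x) = P.act (e p) x := by
  obtain ⟨n, f, hf⟩ := Module.Finite.exists_fin' A X
  obtain ⟨g, hg⟩ := Module.projective_lifting_property f LinearMap.id hf
  have hinj : Function.Injective g := fun x y h => by
    have := congrArg f h
    rwa [← LinearMap.comp_apply, ← LinearMap.comp_apply, hg] at this
  let e : X ≃ₗ[A] LinearMap.range g := LinearEquiv.ofInjective g hinj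
  let P : FGPMod R :=
    { n := n
      S := LinearMap.range g
      finite := Module.Finite.equiv e
      proj := Module.Projective.of_equiv e
      act := ((act R).comp (e.symm.toLinearMap.restrictScalars k)).compr₂
        (e.toLinearMap.restrictScalars k)
      act_one := fun p => by simp [act_one]
      act_mul := fun p x y => by simp [act_mul]
      act_s := fun p a => by simp [act_s] }
  exact ⟨P, e, fun p x => by simp [P]⟩

/-- A submodule of some `A^n` isomorphic to the given finitely generated projective module. -/
def ofMod : FGPMod R := (exists_ofMod R X).choose

/-- The isomorphism of `X` with its chosen model. -/
def ofModEquiv : X ≃ₗ[A] (ofMod R X).S := (exists_ofMod R X).choose_spec.choose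

theorem ofModEquiv_act (p : X) (x : R.carrier) :
    ofModEquiv R X (act R p x) = (ofMod R X).act (ofModEquiv R X p) x :=
  (exists_ofMod R X).choose_spec.choose_spec p x

variable {X}

/-- The class of `φ ⊗ p` in `R°`, for a right `R`-module `X` which is finitely generated and
projective over `A`, but not necessarily a submodule of some `A^n`. -/
def gmk (φ : Module.Dual A X) (p : X) : CircCarrier R :=
  cmk (ofMod R X) (φ.comp (ofModEquiv R X).symm.toLinearMap) (ofModEquiv R X p)

/-- The defining relation of `R°`, for arbitrary finitely generated projective modules. -/
theorem gmk_comp {t : X →ₗ[A] Y} (ht : IsRLin R t) (ψ : Module.Dual A Y) (p : X) :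
    gmk R ψ (t p) = gmk R (ψ.comp t) p := by
  let t' : (ofMod R X).S →ₗ[A] (ofMod R Y).S :=
    (ofModEquiv R Y).toLinearMap.comp (t.comp (ofModEquiv R X).symm.toLinearMap)
  have ht' : FGPMod.IsLin t' := fun p x => by
    obtain ⟨p, rfl⟩ := (ofModEquiv R X).surjective p
    simp only [t', LinearMap.comp_apply, LinearEquiv.coe_coe]
    rw [← ofModEquiv_act, LinearEquiv.symm_apply_apply, LinearEquiv.symm_apply_apply, ht,
      ofModEquiv_act]
  have := cmk_rel t' ht' (ψ.comp (ofModEquiv R Y).symm.toLinearMap) (ofModEquiv R X p)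
  unfold gmk
  simp only [t', LinearMap.comp_apply, LinearEquiv.coe_coe, LinearEquiv.symm_apply_apply] at this
  rw [this]
  congr 1
  ext q
  simp

theorem gmk_cmk (P : FGPMod R) (φ : Module.Dual A P.S) (p : P.S) [Module.Finite A P.S]
    [Module.Projective A P.S] : gmk R φ p = cmk P φ p := by
  refine (cmk_rel (ofModEquiv R P.S).toLinearMap (fun p x => ofModEquiv_act R P.S p x) _ _).trans ?_
  congr 1
  ext q
  simp

theorem gmk_add_left (φ ψ : Module.Dual A X) (p : X) :
    gmk R (φ + ψ) p = gmk R φ p + gmk R ψ p :=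
  (cmkL (ofMod R X)).map_add₂ (φ.comp (ofModEquiv R X).symm.toLinearMap)
    (ψ.comp (ofModEquiv R X).symm.toLinearMap) (ofModEquiv R X p)

theorem gmk_smul_left (c : k) (φ : Module.Dual A X) (p : X) :
    gmk R (c • φ) p = c • gmk R φ p :=
  (cmkL (ofMod R X)).map_smul₂ c (φ.comp (ofModEquiv R X).symm.toLinearMap) (ofModEquiv R X p)

theorem gmk_add_right (φ : Module.Dual A X) (p q : X) :
    gmk R φ (p + q) = gmk R φ p + gmk R φ q := by
  unfold gmk
  rw [map_add]
  exact (cmkL (ofMod R X) (φ.comp (ofModEquiv R X).symm.toLinearMap)).map_add _ _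

theorem gmk_smul_right (c : k) (φ : Module.Dual A X) (p : X) :
    gmk R φ (c • p) = c • gmk R φ p := by
  have : ofModEquiv R X (c • p) = c • ofModEquiv R X p :=
    ((ofModEquiv R X).toLinearMap.restrictScalars k).map_smul c p
  unfold gmk
  rw [this]
  exact (cmkL (ofMod R X) (φ.comp (ofModEquiv R X).symm.toLinearMap)).map_smul _ _

/-- `(φ, p) ↦` the class of `φ ⊗ p`, as a bilinear map. -/
def gmkL : Module.Dual A X →ₗ[k] X →ₗ[k] CircCarrier R :=
  LinearMap.mk₂ k (gmk R) (gmk_add_left R) (gmk_smul_left R) (gmk_add_right R) (gmk_smul_right R)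

@[simp] theorem gmkL_apply (φ : Module.Dual A X) (p : X) : gmkL R φ p = gmk R φ p := rfl

theorem gmk_sum_left {ι : Type*} (s : Finset ι) (φ : ι → Module.Dual A X) (p : X) :
    gmk R (∑ i ∈ s, φ i) p = ∑ i ∈ s, gmk R (φ i) p := by
  rw [← gmkL_apply, map_sum, LinearMap.sum_apply]; rfl

theorem gmk_sum_right {ι : Type*} (s : Finset ι) (φ : Module.Dual A X) (p : ι → X) :
    gmk R φ (∑ i ∈ s, p i) = ∑ i ∈ s, gmk R φ (p i) := by
  rw [← gmkL_apply, map_sum]; rfl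

@[simp] theorem circL_gmk (a : A) (φ : Module.Dual A X) (p : X) :
    circL R a (gmk R φ p) = gmk R (a • φ) p := circL_cmk _ _ _ _ _

@[simp] theorem circR_gmk (a : A) (φ : Module.Dual A X) (p : X) :
    circR R a (gmk R φ p) = gmk R φ (a • p) := by
  unfold gmk
  rw [circR_cmk, map_smul]

@[simp] theorem zeta_cmk (P : FGPMod R) (φ : Module.Dual A P.S) (p : P.S) :
    zeta R (cmk P φ p) = mcoeff R φ p := circLift_cmk _ _ _ _ _

@[simp] theorem zeta_gmk (φ : Module.Dual A X) (p : X) :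
    zeta R (gmk R φ p) = mcoeff R φ p := by
  rw [gmk, zeta_cmk]
  apply Subtype.ext; ext x
  rw [mcoeff_apply, mcoeff_apply, LinearMap.comp_apply]
  change φ ((ofModEquiv R X).symm ((ofMod R X).act _ _)) = _
  rw [← ofModEquiv_act, LinearEquiv.symm_apply_apply]

end OfMod

section DualBasis

variable (X : Type*) [AddCommGroup X] [Module A X]

/-- The families `e` of elements and `e'` of linear forms are a dual basis of `X`. -/
def IsDualBasis {X : Type*} [AddCommGroup X] [Module A X] {ι : Type*} [Fintype ι] (e : ι → X)
    (e' : ι → Module.Dual A X) : Prop := ∀ y, ∑ i, e' i y • e i = y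

theorem exists_isDualBasis [Module.Finite A X] [Module.Projective A X] :
    ∃ (m : ℕ) (e : Fin m → X) (e' : Fin m → Module.Dual A X), IsDualBasis e e' := by
  obtain ⟨n, f, hf⟩ := Module.Finite.exists_fin' A X
  obtain ⟨g, hg⟩ := Module.projective_lifting_property f LinearMap.id hf
  refine ⟨n, fun i => f (Pi.single i 1), fun i => (LinearMap.proj i).comp g, fun y => ?_⟩
  have : f (g y) = y := by rw [← LinearMap.comp_apply, hg]; rfl
  conv_rhs => rw [← this, ← Finset.univ_sum_single (g y), map_sum]
  refine Finset.sum_congr rfl fun i _ => ?_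
  rw [← map_smul, ← Pi.single_smul']
  simp

variable {X}

theorem IsDualBasis.sum_dual {ι : Type*} [Fintype ι] {e : ι → X} {e' : ι → Module.Dual A X}
    (h : IsDualBasis e e') (φ : Module.Dual A X) : ∑ i, φ (e i) • e' i = φ := by
  ext y
  conv_rhs => rw [← h y, map_sum]
  simp [LinearMap.sum_apply, mul_comm]

end DualBasis

/-! ### The coring structure of the finite dual -/

section CircCoring

variable (R : ARing k A)
variable {X : Type*} [AddCommGroup X] [Module k X] [Module A X] [IsScalarTower k A X] [RAct R X]
variable {Y : Type*} [AddCommGroup Y] [Module k Y] [Module A Y] [IsScalarTower k A Y] [RAct R Y]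
variable [Module.Finite A X] [Module.Projective A X] [Module.Finite A Y] [Module.Projective A Y]

attribute [instance] FGPMod.finite FGPMod.proj

/-- The canonical elements of two modules correspond to each other under a linear map. -/
theorem sum_bt_gmk {t : X →ₗ[A] Y} (ht : IsRLin R t) {ι κ : Type*} [Fintype ι] [Fintype κ]
    {e : ι → X} {e' : ι → Module.Dual A X} (h : IsDualBasis e e') {f : κ → Y}
    {f' : κ → Module.Dual A Y} (h' : IsDualBasis f f') (ψ : Module.Dual A Y) (p : X) :
    ∑ i, bt (circR R) (circL R) (gmk R (ψ.comp t) (e i)) (gmk R (e' i) p) =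
      ∑ j, bt (circR R) (circL R) (gmk R ψ (f j)) (gmk R (f' j) (t p)) := by
  have h1 : ∀ i, gmk R (ψ.comp t) (e i) = ∑ j, circR R (f' j (t (e i))) (gmk R ψ (f j)) :=
    fun i => by
      simp only [circR_gmk]
      rw [← gmk_comp R ht, ← gmk_sum_right, h']
  simp only [h1, bt_sum_left, bt_bal]
  rw [Finset.sum_comm]
  refine Finset.sum_congr rfl fun j _ => ?_
  rw [← bt_sum_right]
  simp only [circL_gmk]
  rw [← gmk_sum_left, gmk_comp R ht]
  congr 2
  exact h.sum_dual ((f' j).comp t)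

/-- `φ ⊗ p ↦ Σ (φ ⊗ eᵢ) ⊗_A (eᵢ^* ⊗ p)` on the summand of `P`. -/
def circComulAux (P : FGPMod R) :
    Module.Dual A P.S →ₗ[k] P.S →ₗ[k] Bal (circR R) (circL R) :=
  let B := exists_isDualBasis (A := A) P.S
  ∑ i, (btL (circR R) (circL R)).compl₁₂ ((gmkL R).flip (B.choose_spec.choose i))
    (gmkL R (B.choose_spec.choose_spec.choose i))

theorem circComulAux_apply (P : FGPMod R) {κ : Type*} [Fintype κ] {f : κ → P.S}
    {f' : κ → Module.Dual A P.S} (h' : IsDualBasis f f') (φ : Module.Dual A P.S) (p : P.S) :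
    circComulAux R P φ p =
      ∑ j, bt (circR R) (circL R) (gmk R φ (f j)) (gmk R (f' j) p) := by
  have h := (exists_isDualBasis (A := A) P.S).choose_spec.choose_spec.choose_spec
  simp only [circComulAux, LinearMap.sum_apply]
  exact sum_bt_gmk (X := P.S) (Y := P.S) R (t := LinearMap.id) (fun _ _ => rfl) h h' φ p

/-- The comultiplication `φ ⊗ p ↦ Σ (φ ⊗ eᵢ) ⊗_A (eᵢ^* ⊗ p)` of `R°`. -/
def circComul : CircCarrier R →ₗ[k] Bal (circR R) (circL R) :=
  circLift (circComulAux R) ⟨fun P Q t ψ p ht => by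
    obtain ⟨m, e, e', h⟩ := exists_isDualBasis (A := A) P.S
    obtain ⟨n, f, f', h'⟩ := exists_isDualBasis (A := A) Q.S
    rw [circComulAux_apply R P h, circComulAux_apply R Q h']
    exact (sum_bt_gmk R (X := P.S) (Y := Q.S) ht h h' ψ p).symm⟩

theorem circComul_cmk (P : FGPMod R) {κ : Type*} [Fintype κ] {f : κ → P.S}
    {f' : κ → Module.Dual A P.S} (h' : IsDualBasis f f') (φ : Module.Dual A P.S) (p : P.S) :
    circComul R (cmk P φ p) =
      ∑ j, bt (circR R) (circL R) (cmk P φ (f j)) (cmk P (f' j) p) := by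
  rw [circComul, circLift_cmk, circComulAux_apply R P h']
  simp only [gmk_cmk]

theorem circComul_gmk {κ : Type*} [Fintype κ] {f : κ → X}
    {f' : κ → Module.Dual A X} (h' : IsDualBasis f f') (φ : Module.Dual A X) (p : X) :
    circComul R (gmk R φ p) =
      ∑ j, bt (circR R) (circL R) (gmk R φ (f j)) (gmk R (f' j) p) := by
  rw [gmk]
  obtain ⟨m, e, e', h⟩ := exists_isDualBasis (A := A) (ofMod R X).S
  rw [circComul_cmk R _ h]
  have := sum_bt_gmk R (X := X) (t := (ofModEquiv R X).toLinearMap) (ofModEquiv_act R X) h' h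
    (φ.comp (ofModEquiv R X).symm.toLinearMap) p
  simp only [gmk_cmk] at this
  rw [LinearEquiv.coe_coe] at this
  rw [← this]
  refine Finset.sum_congr rfl fun i _ => ?_
  congr 2
  ext q
  simp

/-- The counit `φ ⊗ p ↦ φ(p)` of `R°`. -/
def circCounit : CircCarrier R →ₗ[k] A :=
  circLift (fun P => LinearMap.mk₂ k (fun φ p => φ p) (by simp) (by simp) (by simp) (by simp))
    ⟨fun P Q t ψ p _ => rfl⟩

@[simp] theorem circCounit_cmk (P : FGPMod R) (φ : Module.Dual A P.S) (p : P.S) :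
    circCounit R (cmk P φ p) = φ p := circLift_cmk _ _ _ _ _

@[simp] theorem circCounit_gmk (φ : Module.Dual A X) (p : X) :
    circCounit R (gmk R φ p) = φ p := by
  simp [gmk]

variable {R} in
theorem circ_ind {p : CircCarrier R → Prop} (h0 : p 0) (hc : ∀ P φ x, p (cmk P φ x))
    (ha : ∀ x y, p x → p y → p (x + y)) (z : CircCarrier R) : p z := by
  let W : Submodule k (CircCarrier R) := Submodule.span k {z | ∃ P φ x, z = cmk P φ x}
  have hW : W.mkQ = 0 := circ_hom_ext fun P φ x =>
    (Submodule.Quotient.mk_eq_zero W).2 (Submodule.subset_span ⟨P, φ, x, rfl⟩)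
  have hz : z ∈ W := (Submodule.Quotient.mk_eq_zero W).1 (congrArg (fun f => f z) hW)
  have key : ∀ c : k, p (c • z) := by
    induction hz using Submodule.span_induction with
    | mem z hz =>
      obtain ⟨P, φ, x, rfl⟩ := hz
      intro c
      have : c • cmk P φ x = cmk P (c • φ) x := ((cmkL P).map_smul₂ c φ x).symm
      rw [this]
      exact hc _ _ _
    | zero => intro c; rwa [smul_zero]
    | add x y _ _ hx hy => intro c; rw [smul_add]; exact ha _ _ (hx c) (hy c)
    | smul a x _ hx => intro c; rw [smul_smul]; exact hx _
  simpa using key 1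

/-- The coring structure of `R°`. -/
def circCoring : CoringStr (circ R) where
  comul := circComul R
  counit := circCounit R
  comul_l a x := by
    induction x using circ_ind with
    | h0 => simp
    | hc P φ p =>
      obtain ⟨m, e, e', h⟩ := exists_isDualBasis (A := A) P.S
      change circComul R (circL R a _) = _
      rw [circL_cmk, circComul_cmk R P h, circComul_cmk R P h, map_sum]
      simp
    | ha x y hx hy => simp only [map_add, hx, hy]
  comul_r a x := by
    induction x using circ_ind with
    | h0 => simp
    | hc P φ p =>
      obtain ⟨m, e, e', h⟩ := exists_isDualBasis (A := A) P.S
      change circComul R (circR R a _) = _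
      rw [circR_cmk, circComul_cmk R P h, circComul_cmk R P h, map_sum]
      simp
    | ha x y hx hy => simp only [map_add, hx, hy]
  counit_l a x := by
    induction x using circ_ind with
    | h0 => simp
    | hc P φ p => simp
    | ha x y hx hy => simp only [map_add, hx, hy, mul_add]
  counit_r a x := by
    induction x using circ_ind with
    | h0 => simp
    | hc P φ p => simp [mul_comm]
    | ha x y hx hy => simp only [map_add, hx, hy, add_mul]
  coassoc x := by
    induction x using circ_ind with
    | h0 => simp
    | hc P φ p =>
      obtain ⟨m, e, e', h⟩ := exists_isDualBasis (A := A) P.S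
      rw [circComul_cmk R P h]
      simp only [map_sum, Bal.map_bt, LinearMap.id_apply, circComul_cmk R P h, bt_sum_left,
        bt_sum_right, Bal.assoc_bt]
      exact Finset.sum_comm
    | ha x y hx hy => simp only [map_add, hx, hy]
  counit_comul x := by
    induction x using circ_ind with
    | h0 => simp
    | hc P φ p =>
      obtain ⟨m, e, e', h⟩ := exists_isDualBasis (A := A) P.S
      rw [circComul_cmk R P h]
      simp only [map_sum, Bal.lift_bt, LinearMap.comp_apply, circCounit_cmk,
        AlgHom.toLinearMap_apply, circL_cmk]
      simp only [← gmk_cmk]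
      rw [← gmk_sum_left, h.sum_dual]
    | ha x y hx hy => simp only [map_add, hx, hy]
  comul_counit x := by
    induction x using circ_ind with
    | h0 => simp
    | hc P φ p =>
      obtain ⟨m, e, e', h⟩ := exists_isDualBasis (A := A) P.S
      rw [circComul_cmk R P h]
      simp only [map_sum, Bal.lift_bt, LinearMap.comp_apply, circCounit_cmk, LinearMap.flip_apply,
        AlgHom.toLinearMap_apply, circR_cmk]
      simp only [← gmk_cmk]
      rw [← gmk_sum_right, h]
    | ha x y hx hy => simp only [map_add, hx, hy]

/-- The coring `R°`. -/
abbrev circC : ACoring k A := ⟨circ R, circCoring R⟩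

end CircCoring

/-! ### The Hopf algebroid structure of the finite dual -/

section DualMul

variable {X Y : Type*} [AddCommGroup X] [Module A X] [AddCommGroup Y] [Module A Y]

theorem dualMul_add_left (φ φ' : Module.Dual A X) (ψ : Module.Dual A Y) :
    dualMul (φ + φ') ψ = dualMul φ ψ + dualMul φ' ψ := by
  ext; simp [add_mul]

theorem dualMul_add_right (φ : Module.Dual A X) (ψ ψ' : Module.Dual A Y) :
    dualMul φ (ψ + ψ') = dualMul φ ψ + dualMul φ ψ' := by
  ext; simp [mul_add]

theorem dualMul_smul_left' (a : A) (φ : Module.Dual A X) (ψ : Module.Dual A Y) :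
    dualMul (a • φ) ψ = a • dualMul φ ψ := by
  ext; simp [mul_assoc]

theorem isDualBasis_tensor {ι κ : Type*} [Fintype ι] [Fintype κ] {e : ι → X}
    {e' : ι → Module.Dual A X} (h : IsDualBasis e e') {f : κ → Y} {f' : κ → Module.Dual A Y}
    (h' : IsDualBasis f f') : IsDualBasis (fun i : ι × κ => e i.1 ⊗ₜ[A] f i.2)
      (fun i => dualMul (e' i.1) (f' i.2)) := fun z => by
  induction z using TensorProduct.induction_on with
  | zero => simp
  | tmul x y =>
    conv_rhs => rw [← h x, ← h' y, TensorProduct.sum_tmul]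
    simp only [TensorProduct.tmul_sum, Fintype.sum_prod_type, dualMul_tmul,
      TensorProduct.smul_tmul_smul]
  | add x y hx hy =>
    simp only [map_add, add_smul, Finset.sum_add_distrib, hx, hy]

theorem dualMul_smul_left (c : k) (φ : Module.Dual A X) (ψ : Module.Dual A Y) :
    dualMul (c • φ) ψ = c • dualMul φ ψ := by
  ext; simp

theorem dualMul_smul_right (c : k) (φ : Module.Dual A X) (ψ : Module.Dual A Y) :
    dualMul φ (c • ψ) = c • dualMul φ ψ := by
  ext; simp

end DualMul

@[simp] theorem AlgStr.mulT_bt {M : ABimod k A} (H : AlgStr M) (x y x' y' : M.carrier) :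
    H.mulT (bt M.r M.l x y) (bt M.r M.l x' y') = bt M.r M.l (H.mul x x') (H.mul y y') := by
  simp [AlgStr.mulT]

/-- The second antipode identity follows from the first one by applying the antipode. -/
theorem AlgStr.id_mul_S {M : ABimod k A} (H : AlgStr M) {S : M.carrier →ₗ[k] M.carrier}
    (S_one : S H.one = H.one) (S_mul : ∀ x y, S (H.mul x y) = H.mul (S x) (S y))
    (S_r : ∀ a x, S (M.r a x) = M.l a (S x)) (S_S : ∀ x, S (S x) = x)
    (h : IsBal M.r M.l (H.mul.comp S)) (h' : IsBal M.r M.l (H.mul.compl₂ S)) {z : Bal M.r M.l}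
    {a : A} (hz : Bal.lift _ h z = H.t a) : Bal.lift _ h' z = H.s a := by
  have e : H.s a = S (H.t a) := by rw [AlgStr.s, AlgStr.t, S_r, S_one]
  rw [e, ← hz]
  clear hz
  induction z using Bal.ind with
  | h0 => simp
  | ht x y => rw [Bal.lift_bt, Bal.lift_bt, LinearMap.comp_apply, S_mul, S_S]; rfl
  | ha x y hx hy => simp only [map_add, hx, hy]

/-- The convolution product of `U^*`, as a bilinear map. -/
def convRL (U : CCHopf k A) : U.RDual →ₗ[k] U.RDual →ₗ[k] U.RDual :=
  LinearMap.mk₂ k (convR U.toCCBialgd)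
    (fun f f' g => by
      simp only [convR]
      rw [← mcoeff_add_left U, ← dualMul_add_left]; rfl)
    (fun c f g => by
      simp only [convR]
      rw [← mcoeff_smul_left U, ← dualMul_smul_left]; rfl)
    (fun f g g' => by
      simp only [convR]
      rw [← mcoeff_add_left U, ← dualMul_add_right]; rfl)
    (fun c f g => by
      simp only [convR]
      rw [← mcoeff_smul_left U, ← dualMul_smul_right]; rfl)

@[simp] theorem convRL_apply (U : CCHopf k A) (f g : U.RDual) :
    convRL U f g = convR U.toCCBialgd f g := rfl

section CircHopf

variable (U : CCHopf k A)
variable {X : Type*} [AddCommGroup X] [Module k X] [Module A X] [IsScalarTower k A X]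
variable [RAct U.toARing X]
variable {Y : Type*} [AddCommGroup Y] [Module k Y] [Module A Y] [IsScalarTower k A Y]
variable [RAct U.toARing Y]
variable [Module.Finite A X] [Module.Projective A X] [Module.Finite A Y] [Module.Projective A Y]

/-- Multiplication by `φ ⊗ p` on the summand of `Q`. -/
def circMulAux (P Q : FGPMod U.toARing) (φ : Module.Dual A P.S) (p : P.S) :
    Module.Dual A Q.S →ₗ[k] Q.S →ₗ[k] CircCarrier U.toARing :=
  LinearMap.mk₂ k (fun ψ q => gmk U.toARing (X := P.S ⊗[A] Q.S) (dualMul φ ψ) (p ⊗ₜ[A] q))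
    (fun ψ ψ' q => by rw [dualMul_add_right, gmk_add_left])
    (fun c ψ q => by rw [dualMul_smul_right, gmk_smul_left])
    (fun ψ q q' => by rw [TensorProduct.tmul_add, gmk_add_right])
    (fun c ψ q => by rw [TensorProduct.tmul_smul, gmk_smul_right])

theorem gmk_tmul_map {X' Y' : Type*} [AddCommGroup X'] [Module k X'] [Module A X']
    [IsScalarTower k A X'] [RAct U.toARing X'] [AddCommGroup Y'] [Module k Y'] [Module A Y']
    [IsScalarTower k A Y'] [RAct U.toARing Y'] [Module.Finite A X'] [Module.Projective A X']
    [Module.Finite A Y'] [Module.Projective A Y'] {f : X →ₗ[A] X'} {g : Y →ₗ[A] Y'}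
    (hf : IsRLin U.toARing f) (hg : IsRLin U.toARing g) (φ : Module.Dual A X')
    (ψ : Module.Dual A Y') (x : X) (y : Y) :
    gmk U.toARing (X := X' ⊗[A] Y') (dualMul φ ψ) (f x ⊗ₜ[A] g y) =
      gmk U.toARing (X := X ⊗[A] Y) (dualMul (φ.comp f) (ψ.comp g)) (x ⊗ₜ[A] y) := by
  rw [← TensorProduct.map_tmul, gmk_comp U.toARing (isRLin_map U.toCCBialgd hf hg)]
  congr 1
  ext x y
  simp

theorem circMulAux_natR (P : FGPMod U.toARing) (φ : Module.Dual A P.S) (p : P.S) :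
    IsNatFam (fun Q => circMulAux U P Q φ p) :=
  ⟨fun Q Q' t ψ q ht => gmk_tmul_map U (X := P.S) (Y := Q.S) (X' := P.S) (Y' := Q'.S)
    (f := LinearMap.id) (g := t) (fun _ _ => rfl) ht φ ψ p q⟩

/-- Multiplication by `φ ⊗ p` on `U°`. -/
def circMulBy (P : FGPMod U.toARing) (φ : Module.Dual A P.S) (p : P.S) :
    CircCarrier U.toARing →ₗ[k] CircCarrier U.toARing :=
  circLift _ (circMulAux_natR U P φ p)

theorem circMulBy_cmk (P Q : FGPMod U.toARing) (φ : Module.Dual A P.S) (p : P.S)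
    (ψ : Module.Dual A Q.S) (q : Q.S) : circMulBy U P φ p (cmk Q ψ q) =
      gmk U.toARing (X := P.S ⊗[A] Q.S) (dualMul φ ψ) (p ⊗ₜ[A] q) := circLift_cmk _ _ _ _ _

/-- The product of `U°`. -/
def circMul : CircCarrier U.toARing →ₗ[k] CircCarrier U.toARing →ₗ[k] CircCarrier U.toARing :=
  circLift
    (fun P => LinearMap.mk₂ k (circMulBy U P)
      (fun φ φ' p => circ_hom_ext fun Q ψ q => by
        simp only [LinearMap.add_apply, circMulBy_cmk, dualMul_add_left, gmk_add_left])
      (fun c φ p => circ_hom_ext fun Q ψ q => by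
        simp only [LinearMap.smul_apply, circMulBy_cmk, dualMul_smul_left, gmk_smul_left])
      (fun φ p p' => circ_hom_ext fun Q ψ q => by
        simp only [LinearMap.add_apply, circMulBy_cmk, TensorProduct.add_tmul, gmk_add_right])
      (fun c φ p => circ_hom_ext fun Q ψ q => by
        simp only [LinearMap.smul_apply, circMulBy_cmk, ← TensorProduct.smul_tmul',
          gmk_smul_right]))
    ⟨fun P P' t φ p ht => circ_hom_ext fun Q ψ q => by
      change circMulBy U P' φ (t p) _ = circMulBy U P (φ.comp t) p _
      rw [circMulBy_cmk, circMulBy_cmk]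
      exact gmk_tmul_map U (X := P.S) (Y := Q.S) (X' := P'.S) (Y' := Q.S)
        (f := t) (g := LinearMap.id) ht (fun _ _ => rfl) φ ψ p q⟩

theorem circMul_cmk (P Q : FGPMod U.toARing) (φ : Module.Dual A P.S) (p : P.S)
    (ψ : Module.Dual A Q.S) (q : Q.S) : circMul U (cmk P φ p) (cmk Q ψ q) =
      gmk U.toARing (X := P.S ⊗[A] Q.S) (dualMul φ ψ) (p ⊗ₜ[A] q) := by
  rw [circMul, circLift_cmk]
  exact circMulBy_cmk U P Q φ p ψ q

theorem circMul_gmk (φ : Module.Dual A X) (x : X) (ψ : Module.Dual A Y) (y : Y) :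
    circMul U (gmk U.toARing φ x) (gmk U.toARing ψ y) =
      gmk U.toARing (X := X ⊗[A] Y) (dualMul φ ψ) (x ⊗ₜ[A] y) := by
  rw [gmk, gmk, circMul_cmk]
  refine (gmk_tmul_map U (f := (ofModEquiv U.toARing X).toLinearMap)
    (g := (ofModEquiv U.toARing Y).toLinearMap) (ofModEquiv_act _ _) (ofModEquiv_act _ _)
    _ _ x y).trans ?_
  congr 2 <;> ext <;> simp

variable {U} in
/-- `circ_ind`, with the generators written as classes at a module with an action. -/
theorem circ_gmk_ind {p : CircCarrier U.toARing → Prop} (h0 : p 0)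
    (hc : ∀ (P : FGPMod U.toARing) (φ : Module.Dual A P.S) x, p (gmk U.toARing φ x))
    (ha : ∀ x y, p x → p y → p (x + y)) (z : CircCarrier U.toARing) : p z :=
  circ_ind h0 (fun P φ x => by rw [← gmk_cmk]; exact hc P φ x) ha z

theorem gmk_comm (φ : Module.Dual A X) (x : X) (ψ : Module.Dual A Y) (y : Y) :
    gmk U.toARing (X := X ⊗[A] Y) (dualMul φ ψ) (x ⊗ₜ[A] y) =
      gmk U.toARing (X := Y ⊗[A] X) (dualMul ψ φ) (y ⊗ₜ[A] x) := by
  have := gmk_comp U.toARing (isRLin_comm U.toCCBialgd X Y) (dualMul ψ φ) (x ⊗ₜ[A] y)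
  rw [LinearEquiv.coe_coe, TensorProduct.comm_tmul] at this
  rw [this]
  congr 1
  ext x y
  simp [mul_comm]

theorem gmk_assoc {Z : Type*} [AddCommGroup Z] [Module k Z] [Module A Z] [IsScalarTower k A Z]
    [RAct U.toARing Z] [Module.Finite A Z] [Module.Projective A Z]
    (φ : Module.Dual A X) (x : X) (ψ : Module.Dual A Y) (y : Y) (χ : Module.Dual A Z) (z : Z) :
    gmk U.toARing (X := (X ⊗[A] Y) ⊗[A] Z) (dualMul (dualMul φ ψ) χ) ((x ⊗ₜ[A] y) ⊗ₜ[A] z) =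
      gmk U.toARing (X := X ⊗[A] (Y ⊗[A] Z)) (dualMul φ (dualMul ψ χ)) (x ⊗ₜ[A] (y ⊗ₜ[A] z)) := by
  have := gmk_comp U.toARing (isRLin_assoc U.toCCBialgd X Y Z) (dualMul φ (dualMul ψ χ))
    ((x ⊗ₜ[A] y) ⊗ₜ[A] z)
  rw [LinearEquiv.coe_coe, TensorProduct.assoc_tmul] at this
  rw [this]
  congr 1
  ext x y z
  simp [mul_assoc]

theorem gmk_one_mul (ψ : Module.Dual A Y) (y : Y) :
    gmk U.toARing (X := A ⊗[A] Y) (dualMul LinearMap.id ψ) (1 ⊗ₜ[A] y) = gmk U.toARing ψ y := by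
  have := gmk_comp U.toARing (isRLin_lid U.toCCBialgd Y) ψ (1 ⊗ₜ[A] y)
  rw [LinearEquiv.coe_coe, TensorProduct.lid_tmul, one_smul] at this
  rw [this]
  congr 1
  ext y
  simp

/-- The commutative algebra structure of `U°`. -/
def circAlg : AlgStr (circ U.toARing) where
  mul := circMul U
  one := gmk U.toARing (LinearMap.id : A →ₗ[A] A) 1
  mul_comm x y := by
    induction x using circ_gmk_ind with
    | h0 => simp
    | hc P φ p =>
      induction y using circ_gmk_ind with
      | h0 => simp
      | hc Q ψ q => rw [circMul_gmk, circMul_gmk, gmk_comm]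
      | ha x y hx hy => simp only [map_add, LinearMap.add_apply, hx, hy]
    | ha x y hx hy => simp only [map_add, LinearMap.add_apply, hx, hy]
  mul_assoc x y z := by
    induction x using circ_gmk_ind with
    | h0 => simp
    | hc P φ p =>
      induction y using circ_gmk_ind with
      | h0 => simp
      | hc Q ψ q =>
        induction z using circ_gmk_ind with
        | h0 => simp
        | hc N χ r =>
          rw [circMul_gmk, circMul_gmk, circMul_gmk, circMul_gmk, gmk_assoc]
        | ha x y hx hy => simp only [map_add, hx, hy]
      | ha x y hx hy => simp only [map_add, LinearMap.add_apply, hx, hy]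
    | ha x y hx hy => simp only [map_add, LinearMap.add_apply, hx, hy]
  one_mul x := by
    induction x using circ_gmk_ind with
    | h0 => simp
    | hc P φ p => rw [circMul_gmk, gmk_one_mul]
    | ha x y hx hy => simp only [map_add, hx, hy]
  l_mul a x y := by
    induction x using circ_gmk_ind with
    | h0 => simp
    | hc P φ p =>
      induction y using circ_gmk_ind with
      | h0 => simp
      | hc Q ψ q =>
        rw [circL_gmk, circMul_gmk, circMul_gmk, circL_gmk, dualMul_smul_left']
      | ha x y hx hy => simp only [map_add, hx, hy]
    | ha x y hx hy => simp only [map_add, LinearMap.add_apply, hx, hy]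
  r_mul a x y := by
    induction x using circ_gmk_ind with
    | h0 => simp
    | hc P φ p =>
      induction y using circ_gmk_ind with
      | h0 => simp
      | hc Q ψ q =>
        rw [circR_gmk, circMul_gmk, circMul_gmk, circR_gmk, TensorProduct.smul_tmul']
      | ha x y hx hy => simp only [map_add, hx, hy]
    | ha x y hx hy => simp only [map_add, LinearMap.add_apply, hx, hy]

theorem gmk_eval {t : X →ₗ[A] Y} (ht : IsRLin U.toARing t) (ψ : Module.Dual A Y) (x : X) :
    gmk U.toARing (Module.Dual.eval A X x) (ψ.comp t) =
      gmk U.toARing (Module.Dual.eval A Y (t x)) ψ :=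
  gmk_comp U.toARing (isRLin_dualMap U ht) (Module.Dual.eval A X x) ψ

/-- The antipode of `U°`. -/
def circS : CircCarrier U.toARing →ₗ[k] CircCarrier U.toARing :=
  circLift
    (fun P => (gmkL (X := Module.Dual A P.S) U.toARing).flip.compl₂
      ((Module.Dual.eval A P.S).restrictScalars k))
    ⟨fun P Q _ ψ p ht => (gmk_eval U (X := P.S) (Y := Q.S) ht ψ p).symm⟩

theorem circS_cmk (P : FGPMod U.toARing) (φ : Module.Dual A P.S) (p : P.S) :
    circS U (cmk P φ p) = gmk U.toARing (Module.Dual.eval A P.S p) φ := circLift_cmk _ _ _ _ _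

theorem circS_gmk (φ : Module.Dual A X) (x : X) :
    circS U (gmk U.toARing φ x) = gmk U.toARing (Module.Dual.eval A X x) φ := by
  rw [gmk, circS_cmk]
  refine (gmk_eval U (t := (ofModEquiv U.toARing X).toLinearMap) (ofModEquiv_act _ _)
    _ x).symm.trans ?_
  congr 1
  ext y
  simp

theorem gmk_eval_dualMul (φ : Module.Dual A X) (x : X) (ψ : Module.Dual A Y) (y : Y) :
    gmk U.toARing (Module.Dual.eval A (X ⊗[A] Y) (x ⊗ₜ[A] y)) (dualMul φ ψ) =
      gmk U.toARing (X := Module.Dual A X ⊗[A] Module.Dual A Y)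
        (dualMul (Module.Dual.eval A X x) (Module.Dual.eval A Y y)) (φ ⊗ₜ[A] ψ) := by
  have := gmk_comp U.toARing (isRLin_dualDistrib U X Y)
    (Module.Dual.eval A (X ⊗[A] Y) (x ⊗ₜ[A] y)) (φ ⊗ₜ[A] ψ)
  have e : dualMul φ ψ = TensorProduct.dualDistrib A X Y (φ ⊗ₜ[A] ψ) := by ext; simp
  rw [e, this]
  congr 1
  ext φ ψ
  simp

theorem circS_one : circS U (circAlg U).one = (circAlg U).one := by
  change circS U (gmk U.toARing (LinearMap.id : A →ₗ[A] A) 1) = gmk U.toARing LinearMap.id 1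
  rw [circS_gmk]
  have := gmk_comp U.toARing (isRLin_mul U) (Module.Dual.eval A A 1) 1
  have e : (LinearMap.id : A →ₗ[A] A) = LinearMap.mul A A 1 := by ext; simp
  conv_lhs => rw [e]
  rw [this]
  congr 1
  ext
  simp

theorem circS_S (x : CircCarrier U.toARing) : circS U (circS U x) = x := by
  induction x using circ_gmk_ind with
  | h0 => simp
  | hc P φ p =>
    rw [circS_gmk, circS_gmk]
    exact gmk_comp U.toARing (isRLin_eval U P.S) (Module.Dual.eval A (Module.Dual A P.S) φ) p
  | ha x y hx hy => simp only [map_add, hx, hy]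

theorem circS_mul (x y : CircCarrier U.toARing) :
    circS U (circMul U x y) = circMul U (circS U x) (circS U y) := by
  induction x using circ_gmk_ind with
  | h0 => simp
  | hc P φ p =>
    induction y using circ_gmk_ind with
    | h0 => simp
    | hc Q ψ q =>
      rw [circMul_gmk, circS_gmk, circS_gmk, circS_gmk, circMul_gmk, gmk_eval_dualMul]
    | ha x y hx hy => simp only [map_add, hx, hy]
  | ha x y hx hy => simp only [map_add, LinearMap.add_apply, hx, hy]

theorem circS_l (a : A) (x : CircCarrier U.toARing) :
    circS U (circL U.toARing a x) = circR U.toARing a (circS U x) := by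
  induction x using circ_gmk_ind with
  | h0 => simp
  | hc P φ p => rw [circL_gmk, circS_gmk, circS_gmk, circR_gmk]
  | ha x y hx hy => simp only [map_add, hx, hy]

theorem circS_r (a : A) (x : CircCarrier U.toARing) :
    circS U (circR U.toARing a x) = circL U.toARing a (circS U x) := by
  induction x using circ_gmk_ind with
  | h0 => simp
  | hc P φ p => rw [circR_gmk, circS_gmk, circS_gmk, circL_gmk, map_smul]
  | ha x y hx hy => simp only [map_add, hx, hy]

theorem sum_dualMul_eval {ι : Type*} [Fintype ι] {e : ι → X} {e' : ι → Module.Dual A X}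
    (h : IsDualBasis e e') : ∑ i, dualMul (Module.Dual.eval A X (e i)) (e' i) = evMap A X := by
  ext φ x
  simp only [TensorProduct.AlgebraTensorModule.curry_apply, LinearMap.restrictScalars_self,
    TensorProduct.curry_apply, LinearMap.sum_apply, dualMul_tmul, Module.Dual.eval_apply,
    evMap_tmul]
  have := LinearMap.congr_fun (h.sum_dual φ) x
  rwa [LinearMap.sum_apply] at this

theorem circComul_mul (x y : CircCarrier U.toARing) :
    circComul U.toARing (circMul U x y) =
      (circAlg U).mulT (circComul U.toARing x) (circComul U.toARing y) := by
  induction x using circ_gmk_ind with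
  | h0 => simp
  | hc P φ p =>
    induction y using circ_gmk_ind with
    | h0 => simp
    | hc Q ψ q =>
      obtain ⟨m, e, e', h⟩ := exists_isDualBasis (A := A) P.S
      obtain ⟨n, f, f', h'⟩ := exists_isDualBasis (A := A) Q.S
      rw [circMul_gmk, circComul_gmk (X := P.S ⊗[A] Q.S) U.toARing (isDualBasis_tensor h h'),
        circComul_gmk (X := P.S) U.toARing h, circComul_gmk (X := Q.S) U.toARing h']
      simp only [map_sum, LinearMap.sum_apply, Fintype.sum_prod_type]
      rw [Finset.sum_comm]
      refine Finset.sum_congr rfl fun j _ => Finset.sum_congr rfl fun i _ => ?_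
      rw [← circMul_gmk, ← circMul_gmk]
      exact ((circAlg U).mulT_bt _ _ _ _).symm
    | ha x y hx hy => simp only [map_add, hx, hy]
  | ha x y hx hy => simp only [map_add, LinearMap.add_apply, hx, hy]

/-- The identity `S(x₁) x₂ = t(ε(x))` in `U°`. For `x = φ ⊗ p`, the left side is the matrix
coefficient of `X^* ⊗_A X` given by the evaluation and `φ ⊗ p`; the evaluation is a `U`-linear map
to the unit module. -/
theorem circS_mul_id (h : IsBal (P := CircCarrier U.toARing) (circR U.toARing) (circL U.toARing)
      ((circMul U).comp (circS U)))
    (x : CircCarrier U.toARing) :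
    Bal.lift _ h (circComul U.toARing x) = (circAlg U).t (circCounit U.toARing x) := by
  induction x using circ_gmk_ind with
  | h0 => simp [AlgStr.t]
  | hc P φ p =>
    obtain ⟨m, e, e', h'⟩ := exists_isDualBasis (A := A) P.S
    rw [circComul_gmk (X := P.S) U.toARing h', map_sum]
    have h1 : ∀ i, Bal.lift _ h (bt (circR U.toARing) (circL U.toARing)
        (gmk (X := P.S) U.toARing φ (e i)) (gmk (X := P.S) U.toARing (e' i) p)) =
        gmk (X := Module.Dual A P.S ⊗[A] P.S) U.toARing
          (dualMul (Module.Dual.eval A P.S (e i)) (e' i)) (φ ⊗ₜ p) := fun i => by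
      rw [Bal.lift_bt, LinearMap.comp_apply, circS_gmk, circMul_gmk]
    simp only [h1]
    rw [← gmk_sum_left, sum_dualMul_eval h', circCounit_gmk]
    have := gmk_comp (X := Module.Dual A P.S ⊗[A] P.S) (Y := A) U.toARing
      (isRLin_evMap (X := P.S) U) (LinearMap.id : A →ₗ[A] A) (φ ⊗ₜ p)
    rw [LinearMap.id_comp, evMap_tmul] at this
    rw [← this]
    change _ = circR U.toARing (φ p) (gmk U.toARing (LinearMap.id : A →ₗ[A] A) 1)
    rw [circR_gmk, smul_eq_mul, mul_one]
  | ha x y hx hy =>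
    simp only [map_add, hx, hy, AlgStr.t, LinearMap.add_apply]

/-- The Hopf algebroid structure of `U°`. -/
def circHopf : HopfStr (circC U.toARing) where
  toAlgStr := circAlg U
  counit_one := circCounit_gmk U.toARing (LinearMap.id : A →ₗ[A] A) 1
  counit_mul x y := by
    change circCounit U.toARing (circMul U x y) = circCounit U.toARing x * circCounit U.toARing y
    induction x using circ_gmk_ind with
    | h0 => simp
    | hc P φ p =>
      induction y using circ_gmk_ind with
      | h0 => simp
      | hc Q ψ q => rw [circMul_gmk, circCounit_gmk, circCounit_gmk, circCounit_gmk, dualMul_tmul]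
      | ha x y hx hy => simp only [map_add, mul_add, hx, hy]
    | ha x y hx hy => simp only [map_add, LinearMap.add_apply, add_mul, hx, hy]
  comul_one := by
    have h : IsDualBasis (fun _ : Fin 1 => (1 : A)) (fun _ => (LinearMap.id : A →ₗ[A] A)) :=
      fun y => by simp
    change circComul U.toARing (gmk U.toARing (LinearMap.id : A →ₗ[A] A) 1) = _
    rw [circComul_gmk U.toARing h]
    simp [circAlg]
  comul_mul := circComul_mul U
  S := circS U
  S_one := circS_one U
  S_mul := circS_mul U
  S_l := circS_l U
  S_r := circS_r U
  S_S := circS_S U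
  S_mul_id := circS_mul_id U _
  id_mul_S x := (circAlg U).id_mul_S (circS_one U) (circS_mul U) (circS_r U) (circS_S U)
    ⟨fun a x y => by
      rw [LinearMap.comp_apply, LinearMap.comp_apply]
      exact (congrArg (fun z => circMul U z y) (circS_r U a x)).trans
        (((circAlg U).l_mul a (circS U x) y).trans ((circAlg U).mul_l a (circS U x) y).symm)⟩
    _ (circS_mul_id U _ x)

theorem isTannaka_circ : IsTannaka U (circCoring U.toARing) (circHopf U) where
  counit X φ x := circCounit_cmk U.toARing X φ x
  comul X φ x m e e' h := circComul_cmk U.toARing X h φ x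
  one := ⟨ofMod U.toARing A, ofModEquiv U.toARing A,
    fun a u => (ofModEquiv_act U.toARing A a u).symm, rfl⟩
  mul X Y φ ψ x y := ⟨ofMod U.toARing (X.S ⊗[A] Y.S), ofModEquiv U.toARing (X.S ⊗[A] Y.S),
    fun x y u => (ofModEquiv_act U.toARing (X.S ⊗[A] Y.S) (x ⊗ₜ y) u).symm,
    circMul_cmk U X Y φ x ψ y⟩
  antipode X φ x := ⟨ofMod U.toARing (Module.Dual A X.S), ofModEquiv U.toARing _,
    fun φ u x => by
      rw [← ofModEquiv_act, LinearEquiv.symm_apply_apply]; rfl,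
    circS_cmk U X φ x⟩

theorem zeta_circMul (x y : CircCarrier U.toARing) : zeta U.toARing (circMul U x y) =
    convR U.toCCBialgd (zeta U.toARing x) (zeta U.toARing y) := by
  rw [← convRL_apply]
  induction x using circ_gmk_ind with
  | h0 => simp
  | hc P φ p =>
    induction y using circ_gmk_ind with
    | h0 => simp only [map_zero]
    | hc Q ψ q => rw [circMul_gmk, zeta_gmk, zeta_gmk, zeta_gmk, convRL_apply, convR_mcoeff]
    | ha x y hx hy => simp only [map_add, hx, hy]
  | ha x y hx hy => simp only [map_add, LinearMap.add_apply, hx, hy]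

theorem isAlgMap_zeta : U.IsAlgMap (circAlg U) (zeta U.toARing) where
  map_eta a b u := by
    have : (circAlg U).eta a b =
        gmk U.toARing (a • (LinearMap.id : A →ₗ[A] A)) (b • (1 : A)) := by
      rw [AlgStr.eta, AlgStr.s, AlgStr.t, AlgStr.l_mul, AlgStr.one_mul]
      change circL U.toARing a (circR U.toARing b (gmk U.toARing (LinearMap.id : A →ₗ[A] A) 1)) = _
      rw [circR_gmk, circL_gmk]
    rw [this, zeta_gmk, mcoeff_apply, act_base]
    simp [mul_comm]
  map_mul x y u := by
    change (zeta U.toARing (circMul U x y)).1 u = _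
    rw [← convR_apply]
    rw [zeta_circMul]

end CircHopf

theorem zetaProp_zeta (R : ARing k A) : ZetaProp (C := circC R) (zeta R) :=
  have hl : ∀ a z u, (zeta R (circL R a z)).1 u = a * (zeta R z).1 u := fun a z u => by
    induction z using circ_ind with
    | h0 => simp
    | hc P φ p => rw [circL_cmk, zeta_cmk, zeta_cmk]; simp
    | ha x y hx hy => rw [map_add, map_add, map_add]; simp [hx, hy, mul_add]
  have hr : ∀ a z u, (zeta R (circR R a z)).1 u = (zeta R z).1 (R.s a * u) := fun a z u => by
    induction z using circ_ind with
    | h0 => simp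
    | hc P φ p => rw [circR_cmk, zeta_cmk, zeta_cmk]; simp [act_smul_left]
    | ha x y hx hy => rw [map_add, map_add, map_add]; simp [hx, hy]
  { map_l := hl
    map_r := hr
    map_one := fun z => by
      induction z using circ_ind with
      | h0 => simp
      | hc P φ p => rw [zeta_cmk, mcoeff_apply, act_one]; exact (circCounit_cmk R P φ p).symm
      | ha x y hx hy => rw [map_add, map_add, ← hx, ← hy]; rfl
    map_mul := fun z x y => by
      induction z using circ_ind with
      | h0 => simp
      | hc P φ p =>
        obtain ⟨m, e, e', h⟩ := exists_isDualBasis (A := A) P.S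
        change _ = zetaPair (C := circC R) (zeta R) hl hr x y (circComul R _)
        rw [circComul_cmk R P h, map_sum]
        rw [zeta_cmk, mcoeff_apply, act_mul]
        conv_lhs => rw [← h (act R p x)]
        rw [map_sum, LinearMap.sum_apply, map_sum]
        refine Finset.sum_congr rfl fun i _ => ?_
        refine Eq.trans ?_ (zetaPair_bt (C := circC R) _ _ _ _ _ _ _).symm
        rw [zeta_cmk, zeta_cmk, mcoeff_apply, mcoeff_apply, act_mul, act_s]
      | ha x y hx hy => rw [map_add, map_add, map_add, ← hx, ← hy]; rfl }

/-! ### The product of two corings -/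

section ProdCoring

/-- A bimodule as a module over `A ⊗ A`. -/
def ABimod.env (M : ABimod k A) : Act k (A ⊗[k] A) M.carrier :=
  Algebra.TensorProduct.lift M.l M.r fun a b =>
    show Commute (M.l a) (M.r b) from LinearMap.ext (M.comm a b)

@[simp] theorem ABimod.env_tmul (M : ABimod k A) (a b : A) (x : M.carrier) :
    M.env (a ⊗ₜ b) x = M.l a (M.r b x) := by
  rw [ABimod.env, Algebra.TensorProduct.lift_tmul]; rfl

theorem ABimod.env_comm (M : ABimod k A) (s t : A ⊗[k] A) (x : M.carrier) :
    M.env s (M.env t x) = M.env t (M.env s x) := by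
  rw [← Module.End.mul_apply, ← map_mul, mul_comm, map_mul, Module.End.mul_apply]

/-- The tensor product over `A ⊗ A` of two bimodules. -/
def prodBimod (M N : ABimod k A) : ABimod k A where
  carrier := Bal M.env N.env
  l := (Bal.actL N.env M.env M.env_comm).comp Algebra.TensorProduct.includeLeft
  r := (Bal.actL N.env M.env M.env_comm).comp Algebra.TensorProduct.includeRight
  comm a b x := by
    simp only [AlgHom.comp_apply]
    rw [← Module.End.mul_apply, ← map_mul, mul_comm, map_mul, Module.End.mul_apply]

/-- The element `x ⊙ y` of the tensor product over `A ⊗ A`, bilinearly. -/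
def prodMk (M N : ABimod k A) : M.carrier →ₗ[k] N.carrier →ₗ[k] (prodBimod M N).carrier :=
  btL M.env N.env

section

variable {M N : ABimod k A}

theorem prodMk_l (a : A) (x : M.carrier) (y : N.carrier) :
    prodMk M N (M.l a x) y = (prodBimod M N).l a (prodMk M N x y) := by
  refine Eq.trans ?_ (Bal.actL_bt N.env M.env M.env_comm (a ⊗ₜ 1) x y).symm
  rw [ABimod.env_tmul, map_one]; rfl

theorem prodMk_r (a : A) (x : M.carrier) (y : N.carrier) :
    prodMk M N (M.r a x) y = (prodBimod M N).r a (prodMk M N x y) := by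
  refine Eq.trans ?_ (Bal.actL_bt N.env M.env M.env_comm (1 ⊗ₜ a) x y).symm
  rw [ABimod.env_tmul, map_one]; rfl

theorem prodMk_l' (a : A) (x : M.carrier) (y : N.carrier) :
    prodMk M N x (N.l a y) = (prodBimod M N).l a (prodMk M N x y) := by
  have := bt_bal M.env N.env (a ⊗ₜ 1) x y
  simp only [ABimod.env_tmul, map_one, Module.End.one_apply] at this
  rw [← prodMk_l]
  exact this.symm

theorem prodMk_r' (a : A) (x : M.carrier) (y : N.carrier) :
    prodMk M N x (N.r a y) = (prodBimod M N).r a (prodMk M N x y) := by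
  have := bt_bal M.env N.env (1 ⊗ₜ a) x y
  simp only [ABimod.env_tmul, map_one, Module.End.one_apply] at this
  rw [← prodMk_r]
  exact this.symm

theorem prodMk_ll (a b : A) (x : M.carrier) (y : N.carrier) :
    prodMk M N (M.l a x) (N.l b y) = (prodBimod M N).l (a * b) (prodMk M N x y) := by
  rw [prodMk_l, prodMk_l', map_mul]; rfl

theorem prodMk_rr (a b : A) (x : M.carrier) (y : N.carrier) :
    prodMk M N (M.r a x) (N.r b y) = (prodBimod M N).r (a * b) (prodMk M N x y) := by
  rw [prodMk_r, prodMk_r', map_mul]; rfl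

theorem prod_ind {p : (prodBimod M N).carrier → Prop} (h0 : p 0) (ht : ∀ x y, p (prodMk M N x y))
    (ha : ∀ x y, p x → p y → p (x + y)) (z : (prodBimod M N).carrier) : p z :=
  Bal.ind h0 ht ha z

/-- A map out of `M ⊙ N` is a bilinear map which is balanced for both actions. -/
theorem exists_prodLift {V : Type*} [AddCommGroup V] [Module k V]
    (f : M.carrier →ₗ[k] N.carrier →ₗ[k] V) (hl : ∀ a x y, f (M.l a x) y = f x (N.l a y))
    (hr : ∀ a x y, f (M.r a x) y = f x (N.r a y)) :
    ∃ F : (prodBimod M N).carrier →ₗ[k] V, ∀ x y, F (prodMk M N x y) = f x y := by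
  refine ⟨Bal.lift f ⟨fun t x y => ?_⟩, fun x y => Bal.lift_bt _ _ x y⟩
  induction t using TensorProduct.induction_on with
  | zero => simp
  | tmul a b => rw [ABimod.env_tmul, ABimod.env_tmul, hl, hr, N.comm]
  | add s t hs ht => simp only [map_add, LinearMap.add_apply, hs, ht]

variable (M N) in
/-- The product `(x ⊗ x') (y ⊗ y') = (x ⊙ y) ⊗ (x' ⊙ y')`. -/
def prodBal : Bal M.r M.l →ₗ[k] Bal N.r N.l →ₗ[k] Bal (prodBimod M N).r (prodBimod M N).l :=
  Bal.bilMap (prodMk M N) (prodMk M N) prodMk_r prodMk_r' prodMk_l prodMk_l'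

@[simp] theorem prodBal_bt (x x' : M.carrier) (y y' : N.carrier) :
    prodBal M N (bt M.r M.l x x') (bt N.r N.l y y') =
      bt (prodBimod M N).r (prodBimod M N).l (prodMk M N x y) (prodMk M N x' y') :=
  Bal.bilMap_bt _ _ _ _ _ _ _ _ _ _

end

/-- The coring `C ⊙ D`, with `Δ(x ⊙ y) = (x₁ ⊙ y₁) ⊗ (x₂ ⊙ y₂)` and `ε(x ⊙ y) = ε(x) ε(y)`. -/
theorem exists_prodCoring (C D : ACoring k A) :
    ∃ c : CoringStr (prodBimod C.toBimod D.toBimod),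
      (∀ x y, c.comul (prodMk _ _ x y) = prodBal C.toBimod D.toBimod (C.comul x) (D.comul y)) ∧
      ∀ x y, c.counit (prodMk _ _ x y) = C.counit x * D.counit y := by
  let M := C.toBimod
  let N := D.toBimod
  let P := prodBimod M N
  have bl : ∀ a z w, prodBal M N (Bal.actL M.l M.l M.comm a z) w =
      Bal.actL P.l P.l P.comm a (prodBal M N z w) := fun a z w => by
    induction z using Bal.ind with
    | h0 => simp
    | ht x x' =>
      induction w using Bal.ind with
      | h0 => simp
      | ht y y' => rw [Bal.actL_bt, prodBal_bt, prodBal_bt, Bal.actL_bt, prodMk_l]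
      | ha p q hp hq => simp only [map_add, hp, hq]
    | ha p q hp hq => simp only [map_add, LinearMap.add_apply, hp, hq]
  have bl' : ∀ a z w, prodBal M N z (Bal.actL N.l N.l N.comm a w) =
      Bal.actL P.l P.l P.comm a (prodBal M N z w) := fun a z w => by
    induction z using Bal.ind with
    | h0 => simp
    | ht x x' =>
      induction w using Bal.ind with
      | h0 => simp
      | ht y y' => rw [Bal.actL_bt, prodBal_bt, prodBal_bt, Bal.actL_bt, prodMk_l']
      | ha p q hp hq => simp only [map_add, hp, hq]
    | ha p q hp hq => simp only [map_add, LinearMap.add_apply, hp, hq]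
  have br : ∀ a z w, prodBal M N (Bal.actR M.r M.r (fun a b x => (M.comm b a x).symm) a z) w =
      Bal.actR P.r P.r (fun a b x => (P.comm b a x).symm) a (prodBal M N z w) := fun a z w => by
    induction z using Bal.ind with
    | h0 => simp
    | ht x x' =>
      induction w using Bal.ind with
      | h0 => simp
      | ht y y' => rw [Bal.actR_bt, prodBal_bt, prodBal_bt, Bal.actR_bt, prodMk_r]
      | ha p q hp hq => simp only [map_add, hp, hq]
    | ha p q hp hq => simp only [map_add, LinearMap.add_apply, hp, hq]
  have br' : ∀ a z w, prodBal M N z (Bal.actR N.r N.r (fun a b x => (N.comm b a x).symm) a w) =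
      Bal.actR P.r P.r (fun a b x => (P.comm b a x).symm) a (prodBal M N z w) := fun a z w => by
    induction z using Bal.ind with
    | h0 => simp
    | ht x x' =>
      induction w using Bal.ind with
      | h0 => simp
      | ht y y' => rw [Bal.actR_bt, prodBal_bt, prodBal_bt, Bal.actR_bt, prodMk_r']
      | ha p q hp hq => simp only [map_add, hp, hq]
    | ha p q hp hq => simp only [map_add, LinearMap.add_apply, hp, hq]
  obtain ⟨Δ, hΔ⟩ := exists_prodLift (M := M) (N := N) ((prodBal M N).compl₁₂ C.comul D.comul)
    (fun a x y => by
      simp only [LinearMap.compl₁₂_apply]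
      rw [C.str.comul_l, D.str.comul_l, bl, bl'])
    (fun a x y => by
      simp only [LinearMap.compl₁₂_apply]
      rw [C.str.comul_r, D.str.comul_r, br, br'])
  obtain ⟨ε, hε⟩ := exists_prodLift (M := M) (N := N)
    ((LinearMap.mul k A).compl₁₂ C.counit D.counit)
    (fun a x y => by
      simp only [LinearMap.compl₁₂_apply, LinearMap.mul_apply']
      rw [C.str.counit_l, D.str.counit_l]; ring)
    (fun a x y => by
      simp only [LinearMap.compl₁₂_apply, LinearMap.mul_apply']
      rw [C.str.counit_r, D.str.counit_r]; ring)
  simp only [LinearMap.compl₁₂_apply, LinearMap.mul_apply'] at hΔ hε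
  have hl : ∀ a x, Δ (P.l a x) = Bal.actL P.l P.l P.comm a (Δ x) := fun a x => by
    induction x using prod_ind with
    | h0 => simp
    | ht x y => rw [← prodMk_l, hΔ, hΔ, C.str.comul_l, bl]
    | ha p q hp hq => simp only [map_add, hp, hq]
  have hr : ∀ a x, Δ (P.r a x) =
      Bal.actR P.r P.r (fun a b x => (P.comm b a x).symm) a (Δ x) := fun a x => by
    induction x using prod_ind with
    | h0 => simp
    | ht x y => rw [← prodMk_r, hΔ, hΔ, C.str.comul_r, br]
    | ha p q hp hq => simp only [map_add, hp, hq]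
  have el : ∀ a x, ε (P.l a x) = a * ε x := fun a x => by
    induction x using prod_ind with
    | h0 => simp
    | ht x y => rw [← prodMk_l, hε, hε, C.str.counit_l]; ring
    | ha p q hp hq => simp only [map_add, hp, hq, mul_add]
  have er : ∀ a x, ε (P.r a x) = ε x * a := fun a x => by
    induction x using prod_ind with
    | h0 => simp
    | ht x y => rw [← prodMk_r, hε, hε, C.str.counit_r]; ring
    | ha p q hp hq => simp only [map_add, hp, hq, add_mul]
  refine ⟨
    { comul := Δ
      counit := ε
      comul_l := hl
      comul_r := hr
      counit_l := el
      counit_r := er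
      coassoc := fun x => ?_
      counit_comul := fun x => ?_
      comul_counit := fun x => ?_ }, hΔ, hε⟩
  · let B3 : Bal M.r (Bal.actL M.l M.l M.comm) →ₗ[k] Bal N.r (Bal.actL N.l N.l N.comm) →ₗ[k]
        Bal P.r (Bal.actL P.l P.l P.comm) :=
      Bal.bilMap (prodMk M N) (prodBal M N) prodMk_r prodMk_r' bl bl'
    have hB3 : ∀ x z y w, B3 (bt _ _ x z) (bt _ _ y w) =
        bt _ _ (prodMk M N x y) (prodBal M N z w) := fun x z y w =>
      Bal.bilMap_bt _ _ _ _ _ _ _ _ _ _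
    have key : ∀ z w x' y', Bal.assoc P.r P.l P.r P.l (fun a b x => (P.comm b a x).symm)
        (bt _ P.l (prodBal M N z w) (prodMk M N x' y')) =
        B3 (Bal.assoc M.r M.l M.r M.l (fun a b x => (M.comm b a x).symm) (bt _ M.l z x'))
          (Bal.assoc N.r N.l N.r N.l (fun a b x => (N.comm b a x).symm) (bt _ N.l w y')) :=
      fun z w x' y' => by
        induction z using Bal.ind with
        | h0 => simp
        | ht x x' =>
          induction w using Bal.ind with
          | h0 => simp
          | ht y y' => rw [prodBal_bt, Bal.assoc_bt, Bal.assoc_bt, Bal.assoc_bt, hB3, prodBal_bt]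
          | ha p q hp hq => simp only [map_add, bt_add_left, hp, hq]
        | ha p q hp hq => simp only [map_add, LinearMap.add_apply, bt_add_left, hp, hq]
    have e1 : ∀ z w, Bal.assoc P.r P.l P.r P.l (fun a b x => (P.comm b a x).symm)
        (Bal.map Δ LinearMap.id ⟨hr⟩ ⟨fun _ _ => rfl⟩ (prodBal M N z w)) =
        B3 (Bal.assoc M.r M.l M.r M.l (fun a b x => (M.comm b a x).symm)
            (Bal.map C.comul LinearMap.id ⟨C.str.comul_r⟩ ⟨fun _ _ => rfl⟩ z))
          (Bal.assoc N.r N.l N.r N.l (fun a b x => (N.comm b a x).symm)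
            (Bal.map D.comul LinearMap.id ⟨D.str.comul_r⟩ ⟨fun _ _ => rfl⟩ w)) := fun z w => by
      induction z using Bal.ind with
      | h0 => simp
      | ht x x' =>
        induction w using Bal.ind with
        | h0 => simp
        | ht y y' =>
          rw [prodBal_bt, Bal.map_bt, Bal.map_bt, Bal.map_bt, hΔ, LinearMap.id_apply, key]; rfl
        | ha p q hp hq => simp only [map_add, hp, hq]
      | ha p q hp hq => simp only [map_add, LinearMap.add_apply, hp, hq]
    have e2 : ∀ z w, Bal.map LinearMap.id Δ ⟨fun _ _ => rfl⟩ ⟨hl⟩ (prodBal M N z w) =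
        B3 (Bal.map LinearMap.id C.comul ⟨fun _ _ => rfl⟩ ⟨C.str.comul_l⟩ z)
          (Bal.map LinearMap.id D.comul ⟨fun _ _ => rfl⟩ ⟨D.str.comul_l⟩ w) := fun z w => by
      induction z using Bal.ind with
      | h0 => simp
      | ht x x' =>
        induction w using Bal.ind with
        | h0 => simp
        | ht y y' => rw [prodBal_bt, Bal.map_bt, Bal.map_bt, Bal.map_bt, hΔ, hB3]; rfl
        | ha p q hp hq => simp only [map_add, hp, hq]
      | ha p q hp hq => simp only [map_add, LinearMap.add_apply, hp, hq]
    induction x using prod_ind with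
    | h0 => simp
    | ht x y => rw [hΔ, e1, e2, C.str.coassoc, D.str.coassoc]
    | ha p q hp hq => simp only [map_add, hp, hq]
  · have key : ∀ (G : Bal P.r P.l →ₗ[k] P.carrier) (g : Bal M.r M.l →ₗ[k] M.carrier)
        (h : Bal N.r N.l →ₗ[k] N.carrier), (∀ x y, G (bt P.r P.l x y) = P.l (ε x) y) →
        (∀ x y, g (bt M.r M.l x y) = M.l (C.counit x) y) →
        (∀ x y, h (bt N.r N.l x y) = N.l (D.counit x) y) →
        ∀ z w, G (prodBal M N z w) = prodMk M N (g z) (h w) := fun G g h hG hg hh z w => by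
      induction z using Bal.ind with
      | h0 => simp
      | ht x x' =>
        induction w using Bal.ind with
        | h0 => simp
        | ht y y' => rw [prodBal_bt, hG, hg, hh, hε, prodMk_ll]
        | ha p q hp hq => simp only [map_add, hp, hq]
      | ha p q hp hq => simp only [map_add, LinearMap.add_apply, hp, hq]
    induction x using prod_ind with
    | h0 => simp
    | ht x y =>
      rw [hΔ]
      refine Eq.trans ?_
        (congrArg₂ (fun x y => prodMk M N x y) (C.str.counit_comul x) (D.str.counit_comul y))
      refine key _ _ _ ?_ ?_ ?_ _ _
      all_goals exact fun x y => Bal.lift_bt _ _ _ _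
    | ha p q hp hq => simp only [map_add, hp, hq]
  · have key : ∀ (G : Bal P.r P.l →ₗ[k] P.carrier) (g : Bal M.r M.l →ₗ[k] M.carrier)
        (h : Bal N.r N.l →ₗ[k] N.carrier), (∀ x y, G (bt P.r P.l x y) = P.r (ε y) x) →
        (∀ x y, g (bt M.r M.l x y) = M.r (C.counit y) x) →
        (∀ x y, h (bt N.r N.l x y) = N.r (D.counit y) x) →
        ∀ z w, G (prodBal M N z w) = prodMk M N (g z) (h w) := fun G g h hG hg hh z w => by
      induction z using Bal.ind with
      | h0 => simp
      | ht x x' =>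
        induction w using Bal.ind with
        | h0 => simp
        | ht y y' => rw [prodBal_bt, hG, hg, hh, hε, prodMk_rr]
        | ha p q hp hq => simp only [map_add, hp, hq]
      | ha p q hp hq => simp only [map_add, LinearMap.add_apply, hp, hq]
    induction x using prod_ind with
    | h0 => simp
    | ht x y =>
      rw [hΔ]
      refine Eq.trans ?_
        (congrArg₂ (fun x y => prodMk M N x y) (C.str.comul_counit x) (D.str.comul_counit y))
      refine key _ _ _ ?_ ?_ ?_ _ _
      all_goals exact fun x y => Bal.lift_bt _ _ _ _
    | ha p q hp hq => simp only [map_add, hp, hq]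

end ProdCoring

/-! ### The opposite of a coring -/

section CopCoring

/-- The opposite bimodule. -/
abbrev copBimod (M : ABimod k A) : ABimod k A where
  carrier := M.carrier
  l := M.r
  r := M.l
  comm a b x := (M.comm b a x).symm

/-- The co-opposite coring, with the comultiplication `x ↦ x₂ ⊗ x₁`. -/
abbrev copCoring (C : ACoring k A) : ACoring k A where
  toBimod := copBimod C.toBimod
  str :=
    have hl : ∀ a (x : C.carrier), ((Bal.flip C.r C.l).comp C.comul) (C.r a x) =
        Bal.actL C.r C.r (fun a b x => (C.toBimod.comm b a x).symm) a
          (((Bal.flip C.r C.l).comp C.comul) x) := fun a x => by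
      simp only [LinearMap.comp_apply]
      rw [C.str.comul_r]
      generalize C.str.comul x = z
      induction z using Bal.ind with
      | h0 => simp
      | ht x x' => simp
      | ha p q hp hq => simp only [map_add, hp, hq]
    have hr : ∀ a x, ((Bal.flip C.r C.l).comp C.comul) (C.l a x) =
        Bal.actR C.l C.l C.toBimod.comm a
          (((Bal.flip C.r C.l).comp C.comul) x) := fun a x => by
      simp only [LinearMap.comp_apply]
      rw [C.str.comul_l]
      generalize C.str.comul x = z
      induction z using Bal.ind with
      | h0 => simp
      | ht x x' => simp
      | ha p q hp hq => simp only [map_add, hp, hq]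
    { comul := (Bal.flip C.r C.l).comp C.comul
      counit := C.counit
      comul_l := hl
      comul_r := hr
      counit_l := fun a x => (C.str.counit_r a x).trans (mul_comm _ _)
      counit_r := fun a x => (C.str.counit_l a x).trans (mul_comm _ _)
      coassoc := fun (x : C.carrier) => by
        -- the reversal `x ⊗ (y ⊗ z) ↦ z ⊗ (y ⊗ x)`
        let Ψ : Bal C.r (Bal.actL C.l C.l C.toBimod.comm) →ₗ[k]
            Bal C.l (Bal.actL C.r C.r (fun a b x => (C.toBimod.comm b a x).symm)) :=
          Bal.lift
            (LinearMap.mk₂ k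
              (fun x w => Bal.assoc C.l C.r C.l C.r C.toBimod.comm
                (bt _ C.r (Bal.flip C.r C.l w) x))
              (fun x x' w => by rw [bt_add_right, map_add])
              (fun c x w => by rw [bt_smul_right, map_smul])
              (fun x w w' => by rw [map_add, bt_add_left, map_add])
              (fun c x w => by rw [map_smul, bt_smul_left, map_smul]))
            ⟨fun a x w => by
              change Bal.assoc C.l C.r C.l C.r C.toBimod.comm
                (bt _ C.r (Bal.flip C.r C.l w) (C.r a x)) =
                Bal.assoc C.l C.r C.l C.r C.toBimod.comm
                (bt _ C.r (Bal.flip C.r C.l (Bal.actL C.l C.l C.toBimod.comm a w)) x)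
              rw [← bt_bal]
              congr 2
              induction w using Bal.ind with
              | h0 => simp
              | ht x x' => simp
              | ha p q hp hq => simp only [map_add, hp, hq]⟩
        have hΨ : ∀ x w, Ψ (bt _ _ x w) = Bal.assoc C.l C.r C.l C.r C.toBimod.comm
            (bt _ C.r (Bal.flip C.r C.l w) x) := fun x w => Bal.lift_bt _ _ _ _
        have e1 : ∀ z, Bal.assoc C.l C.r C.l C.r C.toBimod.comm
            (Bal.map ((Bal.flip C.r C.l).comp C.comul) LinearMap.id ⟨hr⟩ ⟨fun _ _ => rfl⟩
              (Bal.flip C.r C.l z)) =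
            Ψ (Bal.map LinearMap.id C.comul ⟨fun _ _ => rfl⟩ ⟨C.str.comul_l⟩ z) := fun z => by
          induction z using Bal.ind with
          | h0 => simp
          | ht x x' => rw [Bal.flip_bt, Bal.map_bt, Bal.map_bt, hΨ]; rfl
          | ha p q hp hq => simp only [map_add, hp, hq]
        have e2 : ∀ z, Bal.map LinearMap.id ((Bal.flip C.r C.l).comp C.comul)
            ⟨fun _ _ => rfl⟩ ⟨hl⟩ (Bal.flip C.r C.l z) =
            Ψ (Bal.assoc C.r C.l C.r C.l (fun a b x => (C.toBimod.comm b a x).symm)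
              (Bal.map C.comul LinearMap.id ⟨C.str.comul_r⟩ ⟨fun _ _ => rfl⟩ z)) := fun z => by
          induction z using Bal.ind with
          | h0 => simp
          | ht x x' =>
            rw [Bal.flip_bt, Bal.map_bt, Bal.map_bt, LinearMap.comp_apply]
            generalize C.comul x = w
            induction w using Bal.ind with
            | h0 => simp
            | ht p q => rw [Bal.assoc_bt, hΨ, Bal.flip_bt, Bal.flip_bt, Bal.assoc_bt]
            | ha p q hp hq => simp only [map_add, bt_add_left, bt_add_right, hp, hq]
          | ha p q hp hq => simp only [map_add, hp, hq]
        exact (e1 (C.comul x)).trans ((congrArg Ψ (C.str.coassoc x).symm).trans (e2 _).symm)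
      counit_comul := fun (x : C.carrier) => by
        have key : ∀ (g : Bal C.l C.r →ₗ[k] C.carrier) (h : Bal C.r C.l →ₗ[k] C.carrier),
            (∀ x y, g (bt C.l C.r y x) = h (bt C.r C.l x y)) →
            ∀ z, g (Bal.flip C.r C.l z) = h z := fun g h e z => by
          induction z using Bal.ind with
          | h0 => simp
          | ht x x' => rw [Bal.flip_bt, e]
          | ha p q hp hq => simp only [map_add, hp, hq]
        refine Eq.trans ?_ (C.str.comul_counit x)
        refine key _ _ ?_ (C.comul x)
        intro x y
        rw [Bal.lift_bt, Bal.lift_bt]; rfl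
      comul_counit := fun (x : C.carrier) => by
        have key : ∀ (g : Bal C.l C.r →ₗ[k] C.carrier) (h : Bal C.r C.l →ₗ[k] C.carrier),
            (∀ x y, g (bt C.l C.r y x) = h (bt C.r C.l x y)) →
            ∀ z, g (Bal.flip C.r C.l z) = h z := fun g h e z => by
          induction z using Bal.ind with
          | h0 => simp
          | ht x x' => rw [Bal.flip_bt, e]
          | ha p q hp hq => simp only [map_add, hp, hq]
        refine Eq.trans ?_ (C.str.counit_comul x)
        refine key _ _ ?_ (C.comul x)
        intro x y
        rw [Bal.lift_bt, Bal.lift_bt]; rfl }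

end CopCoring

/-! ### The product and the antipode of a universal coring -/

/-- The principle of bisimulation: two families of elements of a universal coring agree if they
agree under `ξ` and if their comultiplications agree modulo the relations `F x = G x`. -/
theorem IsUniv.bisim {R : ARing k A} {T : ACoring k A} {ξ : T.carrier →ₗ[k] R.RDual}
    (hT : IsUniv T ξ) {X : Type*} {F G : X → T.carrier} (h1 : ∀ x, ξ (F x) = ξ (G x))
    (h2 : ∀ (Q : ABimod k A) (p : BiLin T.toBimod Q), (∀ x, p.toLin (F x) = p.toLin (G x)) →
      ∀ x, p.bal (T.comul (F x)) = p.bal (T.comul (G x))) (x : X) : F x = G x := by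
  let J : Submodule k T.carrier :=
    Submodule.span k {z | ∃ a b x, z = T.l a (T.r b (F x - G x))}
  have hJ : IsCoideal ξ J :=
    { l_mem := fun a => by
        change J ≤ J.comap (T.l a)
        refine Submodule.span_le.2 ?_
        rintro _ ⟨b, c, x, rfl⟩
        exact Submodule.subset_span ⟨a * b, c, x, by rw [map_mul]; rfl⟩
      r_mem := fun a => by
        change J ≤ J.comap (T.r a)
        refine Submodule.span_le.2 ?_
        rintro _ ⟨b, c, x, rfl⟩
        refine Submodule.subset_span ⟨b, a * c, x, ?_⟩
        rw [map_mul, ← T.toBimod.comm]; rfl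
      counit := by
        change J ≤ LinearMap.ker T.counit
        refine Submodule.span_le.2 ?_
        rintro _ ⟨b, c, x, rfl⟩
        change T.counit _ = 0
        rw [T.str.counit_l, T.str.counit_r, map_sub, ← hT.zeta.map_one, ← hT.zeta.map_one, h1,
          sub_self, zero_mul, mul_zero]
      map := by
        change J ≤ LinearMap.ker ξ
        refine Submodule.span_le.2 ?_
        rintro _ ⟨b, c, x, rfl⟩
        change ξ _ = 0
        apply Subtype.ext; ext u
        rw [hT.zeta.map_l, hT.zeta.map_r, map_sub, h1, sub_self]
        simp
      comul := fun Q p hp => by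
        change J ≤ LinearMap.ker (p.bal.comp T.comul)
        refine Submodule.span_le.2 ?_
        rintro _ ⟨b, c, x, rfl⟩
        change p.bal (T.comul _) = 0
        have h0 : ∀ x, p.toLin (F x) = p.toLin (G x) := fun x => by
          have := hp _ (Submodule.subset_span ⟨1, 1, x, rfl⟩)
          rw [map_one, map_one, Module.End.one_apply, Module.End.one_apply, map_sub,
            sub_eq_zero] at this
          exact this
        rw [T.str.comul_l, T.str.comul_r, p.bal_actL, p.bal_actR, map_sub, map_sub, h2 Q p h0,
          sub_self, map_zero, map_zero] }
  have hx : F x - G x ∈ J := Submodule.subset_span ⟨1, 1, x, by simp⟩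
  rw [hT.coideal_eq_bot hJ, Submodule.mem_bot, sub_eq_zero] at hx
  exact hx

section UnivHopf

variable {U : CCHopf k A} {T : ACoring k A} {ξ : T.carrier →ₗ[k] U.RDual}

theorem ZetaProp.map_mul_sum {R : ARing k A} {C : ACoring k A} {f : C.carrier →ₗ[k] R.RDual}
    (hf : ZetaProp f) {z : C.carrier} {ι : Type*} [Fintype ι] {x y : ι → C.carrier}
    (h : C.comul z = ∑ i, bt C.r C.l (x i) (y i)) (u v : R.carrier) :
    (f z).1 (u * v) = ∑ i, (f (x i)).1 (R.s ((f (y i)).1 u) * v) := by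
  rw [hf.map_mul, h, map_sum]
  exact Finset.sum_congr rfl fun i _ => zetaPair_bt _ _ _ _ _ _ _

theorem convPair_bt (f g : U.RDual) (u v : U.carrier) :
    U.convPair f g (bt U.r U.r u v) = f.1 u * g.1 v := Bal.lift_bt _ _ _ _

theorem convPair_mulLL_s (f g : U.RDual) (a b : A) (v : U.carrier) :
    U.convPair f g (U.mulLL (U.s a) (U.s b) (U.comul v)) = U.conv f g (U.s (a * b) * v) := by
  rw [CCBialgd.conv, map_mul U.s, mul_assoc, U.comul_l, U.comul_l, U.comul_tak v b,
    ARing.mulLL_mulLL, one_mul, mul_one]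

/-- The map `x ⊙ y ↦ ξ(x) * ξ(y)` on `T ⊙ T` satisfies `(ζ)`, as `Δ` is multiplicative on `U` and
takes values in `U ×_A U`. -/
theorem exists_zetaProp_prod (hξ : ZetaProp ξ) (c : CoringStr (prodBimod T.toBimod T.toBimod))
    (hc : ∀ x y, c.comul (prodMk _ _ x y) = prodBal T.toBimod T.toBimod (T.comul x) (T.comul y))
    (hε : ∀ x y, c.counit (prodMk _ _ x y) = T.counit x * T.counit y) :
    ∃ f : (prodBimod T.toBimod T.toBimod).carrier →ₗ[k] U.RDual,
      (∀ x y, f (prodMk _ _ x y) = convR U.toCCBialgd (ξ x) (ξ y)) ∧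
        ZetaProp (C := ⟨prodBimod T.toBimod T.toBimod, c⟩) f := by
  have kl : ∀ a x y u, (convR U.toCCBialgd (ξ (T.l a x)) (ξ y)).1 u =
      a * (convR U.toCCBialgd (ξ x) (ξ y)).1 u := fun a x y u => by
    rw [convR_apply, convR_apply, CCBialgd.conv, CCBialgd.conv]
    generalize U.comul u = w
    induction w using Bal.ind with
    | h0 => simp
    | ht u v => rw [convPair_bt, convPair_bt, hξ.map_l, mul_assoc]
    | ha p q hp hq => simp only [map_add, mul_add, hp, hq]
  have kr : ∀ a x y u, (convR U.toCCBialgd (ξ (T.r a x)) (ξ y)).1 u =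
      (convR U.toCCBialgd (ξ x) (ξ y)).1 (U.s a * u) := fun a x y u => by
    rw [convR_apply, convR_apply, CCBialgd.conv, CCBialgd.conv, U.comul_l]
    generalize U.comul u = w
    induction w using Bal.ind with
    | h0 => simp
    | ht u v => rw [ARing.mulLL_bt, convPair_bt, convPair_bt, hξ.map_r, one_mul]
    | ha p q hp hq => simp only [map_add, hp, hq]
  obtain ⟨f, hf⟩ := exists_prodLift (M := T.toBimod) (N := T.toBimod) (V := U.RDual)
    ((convRL U).compl₁₂ ξ ξ)
    (fun a x y => Subtype.ext (LinearMap.ext fun u => by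
      simp only [LinearMap.compl₁₂_apply, convRL_apply]
      rw [kl, convR_comm, convR_comm _ (ξ x), kl]))
    (fun a x y => Subtype.ext (LinearMap.ext fun u => by
      simp only [LinearMap.compl₁₂_apply, convRL_apply]
      rw [kr, convR_comm, convR_comm _ (ξ x), kr]))
  simp only [LinearMap.compl₁₂_apply, convRL_apply] at hf
  have hl : ∀ a z u, (f ((prodBimod T.toBimod T.toBimod).l a z)).1 u = a * (f z).1 u :=
    fun a z u => by
      induction z using prod_ind with
      | h0 => simp
      | ht x y => rw [← prodMk_l, hf, hf, kl]
      | ha p q hp hq =>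
        rw [map_add, map_add, map_add, Submodule.coe_add, Submodule.coe_add, LinearMap.add_apply,
          LinearMap.add_apply, hp, hq, mul_add]
  have hr : ∀ a z u, (f ((prodBimod T.toBimod T.toBimod).r a z)).1 u = (f z).1 (U.s a * u) :=
    fun a z u => by
      induction z using prod_ind with
      | h0 => simp
      | ht x y => rw [← prodMk_r, hf, hf, kr]
      | ha p q hp hq =>
        rw [map_add, map_add, map_add, Submodule.coe_add, Submodule.coe_add, LinearMap.add_apply,
          LinearMap.add_apply, hp, hq]
  refine ⟨f, hf, hl, hr, fun z => ?_, fun z u v => ?_⟩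
  · induction z using prod_ind with
    | h0 => simp
    | ht x y =>
      rw [hf, convR_apply, CCBialgd.conv, U.comul_one, convPair_bt, hξ.map_one, hξ.map_one]
      exact (hε x y).symm
    | ha p q hp hq =>
      rw [map_add, map_add, Submodule.coe_add, LinearMap.add_apply, hp, hq]
  · induction z using prod_ind with
    | h0 => simp
    | ht x y =>
      obtain ⟨n, x1, x2, hx⟩ := (T.comul x).exists_sum
      obtain ⟨m, y1, y2, hy⟩ := (T.comul y).exists_sum
      have key1 : ∀ u1 u2 w, U.convPair (ξ x) (ξ y) (U.mulLL u1 u2 w) =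
          ∑ i, ∑ j, U.convPair (ξ (x1 i)) (ξ (y1 j))
            (U.mulLL (U.s ((ξ (x2 i)).1 u1)) (U.s ((ξ (y2 j)).1 u2)) w) := fun u1 u2 w => by
        induction w using Bal.ind with
        | h0 => simp
        | ht v1 v2 =>
          simp only [ARing.mulLL_bt, convPair_bt]
          rw [hξ.map_mul_sum hx, hξ.map_mul_sum hy, Finset.sum_mul_sum]
        | ha p q hp hq => simp only [map_add, Finset.sum_add_distrib, hp, hq]
      have key2 : ∀ w, U.convPair (ξ x) (ξ y) (U.takMul (U.comul v) (U.comul_tak v) w) =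
          ∑ i, ∑ j, U.conv (ξ (x1 i)) (ξ (y1 j))
            (U.s (U.convPair (ξ (x2 i)) (ξ (y2 j)) w) * v) := fun w => by
        induction w using Bal.ind with
        | h0 => simp [CCBialgd.conv]
        | ht u1 u2 =>
          rw [ARing.takMul_bt, key1]
          simp only [convPair_mulLL_s, convPair_bt]
        | ha p q hp hq =>
          simp only [map_add, add_mul, CCBialgd.conv, Finset.sum_add_distrib] at hp hq ⊢
          rw [hp, hq]
      change _ = zetaPair (C := ⟨prodBimod T.toBimod T.toBimod, c⟩) f hl hr u v
        (c.comul (prodMk _ _ x y))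
      rw [hc, hx, hy]
      simp only [map_sum, LinearMap.sum_apply]
      rw [hf, convR_apply, CCBialgd.conv, U.comul_mul, key2]
      rw [Finset.sum_comm]
      refine Finset.sum_congr rfl fun j _ => Finset.sum_congr rfl fun i _ => ?_
      rw [prodBal_bt]
      refine Eq.trans ?_
        (zetaPair_bt (C := ⟨prodBimod T.toBimod T.toBimod, c⟩) _ _ _ _ _ _ _).symm
      rw [hf, hf, convR_apply, convR_apply]; rfl
    | ha p q hp hq =>
      rw [map_add, map_add, map_add, Submodule.coe_add, LinearMap.add_apply, hp, hq]

/-- The product of a universal coring, induced by the convolution product of `U^*`. -/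
theorem IsUniv.exists_mul (hT : IsUniv T ξ) :
    ∃ m : T.carrier →ₗ[k] T.carrier →ₗ[k] T.carrier,
      (∀ x y, ξ (m x y) = convR U.toCCBialgd (ξ x) (ξ y)) ∧
      (∀ a x y, m (T.l a x) y = T.l a (m x y)) ∧
      (∀ a x y, m (T.r a x) y = T.r a (m x y)) ∧
      (∀ x y, T.counit (m x y) = T.counit x * T.counit y) ∧
      ∀ (x y : T.carrier) (ι κ : Type) [Fintype ι] [Fintype κ] (x1 x2 : ι → T.carrier)
        (y1 y2 : κ → T.carrier), T.comul x = ∑ i, bt T.r T.l (x1 i) (x2 i) →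
          T.comul y = ∑ j, bt T.r T.l (y1 j) (y2 j) →
          T.comul (m x y) = ∑ i, ∑ j, bt T.r T.l (m (x1 i) (y1 j)) (m (x2 i) (y2 j)) := by
  obtain ⟨c, hc, hε⟩ := exists_prodCoring T T
  obtain ⟨f, hf, hfz⟩ := exists_zetaProp_prod hT.zeta c hc hε
  obtain ⟨g, hg⟩ := hT.exists_hom ⟨_, c⟩ f hfz
  refine ⟨(prodMk T.toBimod T.toBimod).compr₂ g.toLin, fun x y => ?_, fun a x y => ?_,
    fun a x y => ?_, fun x y => ?_, fun x y ι κ _ _ x1 x2 y1 y2 hx hy => ?_⟩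
  · exact (hg _).trans (hf x y)
  · change g.toLin (prodMk _ _ (T.l a x) y) = _
    rw [prodMk_l]
    exact g.map_l a _
  · change g.toLin (prodMk _ _ (T.r a x) y) = _
    rw [prodMk_r]
    exact g.map_r a _
  · exact (g.counit_map _).trans (hε x y)
  · change T.comul (g.toLin (prodMk _ _ x y)) = _
    rw [g.comul_bi]
    change (ACoring.Hom.bi g).bal (c.comul (prodMk _ _ x y)) = _
    rw [hc, hx, hy]
    simp only [map_sum, LinearMap.sum_apply]
    rw [Finset.sum_comm]
    refine Finset.sum_congr rfl fun i _ => Finset.sum_congr rfl fun j _ => ?_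
    rw [prodBal_bt]
    exact BiLin.bal_bt (ACoring.Hom.bi g) _ _

/-- The antipode of `U^*`, as a linear map. -/
def sigmaRL (U : CCHopf k A) : U.RDual →ₗ[k] U.RDual where
  toFun := sigmaR U
  map_add' f g := Subtype.ext (LinearMap.ext fun u => by
    rw [sigmaR_apply, antiPair_add, ← sigmaR_apply, ← sigmaR_apply]; rfl)
  map_smul' c f := Subtype.ext (LinearMap.ext fun u => by
    rw [sigmaR_apply, antiPair_smul, ← sigmaR_apply]; rfl)

theorem antiPair_mulOut_one (f : U.RDual) (n : U.carrier) (z : U.TRL) :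
    U.antiPair f (U.mulOut 1 n z) = U.counit (U.s (U.antiPair f z) * n) := by
  induction z using Bal.ind with
  | h0 => simp
  | ht p q => rw [U.mulOut_bt, U.antiPair_bt, U.antiPair_bt, one_mul, ← U.counit_mul, mul_assoc]
  | ha p q hp hq => simp only [map_add, add_mul, hp, hq]

theorem mulOut_mulOut (m n m' n' : U.carrier) (z : U.TRL) :
    U.mulOut m n (U.mulOut m' n' z) = U.mulOut (m * m') (n' * n) z := by
  induction z using Bal.ind with
  | h0 => simp
  | ht p q => simp [mul_assoc]
  | ha p q hp hq => simp only [map_add, hp, hq]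

theorem antiPair_map_mul (hξ : ZetaProp ξ) {z : T.carrier} {ι : Type*} [Fintype ι]
    {x y : ι → T.carrier} (h : T.comul z = ∑ i, bt T.r T.l (x i) (y i)) (m n : U.carrier)
    (w : U.TRL) : U.antiPair (ξ z) (U.mulOut m n w) =
      ∑ i, U.antiPair (ξ (x i)) (U.mulOut (U.s ((ξ (y i)).1 m)) n w) := by
  induction w using Bal.ind with
  | h0 => simp
  | ht p q =>
    simp only [U.mulOut_bt, U.antiPair_bt]
    rw [hξ.map_mul_sum h, map_sum, Finset.sum_mul, map_sum]
  | ha p q hp hq => simp only [map_add, Finset.sum_add_distrib, hp, hq]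

/-- The map `x ↦ σ(ξ(x))` on the co-opposite coring satisfies `(ζ)`, as the translation map is
antimultiplicative in its first component. -/
theorem zetaProp_cop (hξ : ZetaProp ξ) : ZetaProp (C := copCoring T) ((sigmaRL U).comp ξ) :=
  have e : ∀ x u, (((sigmaRL U).comp ξ) x).1 u = U.antiPair (ξ x) (U.transl u) :=
    fun x u => sigmaR_apply U (ξ x) u
  have hl : ∀ a (z : T.carrier) u, (((sigmaRL U).comp ξ) (T.r a z)).1 u =
      a * (((sigmaRL U).comp ξ) z).1 u := fun a z u => by
    rw [e, e, ← antiPair_mulOut_s, ← U.transl_s]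
    generalize U.transl u = w
    induction w using Bal.ind with
    | h0 => simp
    | ht p q => rw [U.mulOut_bt, U.antiPair_bt, U.antiPair_bt, hξ.map_r, mul_one]
    | ha p q hp hq => simp only [map_add, hp, hq]
  have hr : ∀ a (z : T.carrier) u, (((sigmaRL U).comp ξ) (T.l a z)).1 u =
      (((sigmaRL U).comp ξ) z).1 (U.s a * u) := fun a z u => by
    rw [e, e, U.transl_s_mul]
    generalize U.transl u = w
    induction w using Bal.ind with
    | h0 => simp
    | ht p q =>
      rw [U.mulIn_bt, U.antiPair_bt, U.antiPair_bt, hξ.map_l, mul_comm a, map_mul U.s, mul_assoc]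
    | ha p q hp hq => simp only [map_add, hp, hq]
  { map_l := hl
    map_r := hr
    map_one := fun (z : T.carrier) => by
      refine (e z 1).trans ?_
      rw [U.transl_one, U.antiPair_bt, mul_one, counit_s, hξ.map_one]
    map_mul := fun (z : T.carrier) u v => by
      obtain ⟨n, x, y, hz⟩ := (T.comul z).exists_sum
      obtain ⟨m, p, q, hv⟩ := (U.transl v).exists_sum
      refine (e z _).trans ?_
      rw [U.transl_mul u v hv, map_sum]
      have hc : (copCoring T).comul z = ∑ i, bt T.l T.r (y i) (x i) := by
        change Bal.flip T.r T.l (T.comul z) = _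
        rw [hz, map_sum]
        simp only [Bal.flip_bt]
      rw [hc, map_sum]
      simp only [antiPair_map_mul hξ hz]
      rw [Finset.sum_comm]
      refine Finset.sum_congr rfl fun i _ => ?_
      refine Eq.trans ?_ (zetaPair_bt (C := copCoring T) _ _ _ _ _ _ _).symm
      refine Eq.trans ?_ (e (y i) _).symm
      rw [e, U.transl_s_mul, hv, map_sum, map_sum]
      refine Finset.sum_congr rfl fun j _ => ?_
      -- the element `ξ(z₂)(v₋)` moves past the translation of `u`
      have h1 : U.mulOut (U.s ((ξ (y i)).1 (p j))) (q j) (U.transl u) =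
          U.mulOut 1 (U.s ((ξ (y i)).1 (p j)) * q j) (U.transl u) := by
        have := U.transl_s ((ξ (y i)).1 (p j)) u
        have := congrArg (U.mulOut 1 (q j)) this
        rwa [mulOut_mulOut, mulOut_mulOut, one_mul, one_mul, one_mul] at this
      rw [h1, antiPair_mulOut_one, U.mulIn_bt, U.antiPair_bt, ← mul_assoc, ← mul_assoc, ← map_mul,
        ← map_mul, mul_comm] }

/-- The antipode of a universal coring, induced by the one of `U^*`. -/
theorem IsUniv.exists_antipode (hT : IsUniv T ξ) :
    ∃ S : T.carrier →ₗ[k] T.carrier, (∀ x, ξ (S x) = sigmaR U (ξ x)) ∧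
      (∀ a x, S (T.l a x) = T.r a (S x)) ∧ (∀ a x, S (T.r a x) = T.l a (S x)) ∧
      ∀ (x : T.carrier) (ι : Type) [Fintype ι] (x1 x2 : ι → T.carrier),
        T.comul x = ∑ i, bt T.r T.l (x1 i) (x2 i) →
          T.comul (S x) = ∑ i, bt T.r T.l (S (x2 i)) (S (x1 i)) := by
  obtain ⟨g, hg⟩ := hT.exists_hom (copCoring T) _ (zetaProp_cop hT.zeta)
  refine ⟨g.toLin, hg, fun a x => g.map_r a x, fun a x => g.map_l a x,
    fun x ι _ x1 x2 hx => ?_⟩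
  refine (g.comul_bi x).trans ?_
  change (ACoring.Hom.bi g).bal (Bal.flip T.r T.l (T.comul x)) = _
  rw [hx, map_sum, map_sum]
  refine Finset.sum_congr rfl fun i _ => ?_
  rw [Bal.flip_bt]
  exact BiLin.bal_bt (ACoring.Hom.bi g) _ _

end UnivHopf

/-! ### The Hopf algebroid structure of a universal coring -/

section UnivHopf

variable {U : CCHopf k A} {T : ACoring k A} {ξ : T.carrier →ₗ[k] U.RDual}

/-- The unit of a universal coring is the image of the unit of `U°`. -/
theorem IsUniv.exists_one (hT : IsUniv T ξ) : ∃ o : T.carrier,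
    ξ o = counitR U.toCCBialgd ∧ T.counit o = 1 ∧ T.comul o = bt T.r T.l o o := by
  obtain ⟨g, hg⟩ := hT.exists_hom (circC U.toARing) _ (zetaProp_zeta U.toARing)
  refine ⟨g.toLin (circHopf U).one, ?_, ?_, ?_⟩
  · rw [hg]
    refine (zeta_gmk U.toARing (LinearMap.id : A →ₗ[A] A) 1).trans ?_
    rw [counitR_eq]
  · rw [g.counit_map, (circHopf U).counit_one]
  · rw [g.comul_bi, (circHopf U).comul_one]
    exact BiLin.bal_bt _ _ _

/-- The convolution of `σ(ξ(x₁))` and `ξ(x₂)`: it is `u ↦ (φ · u₁)(u₂)` for `φ = ξ(x)` in the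
module `U^*`, so that the evaluation being invariant gives the claim. -/
theorem sum_conv_sigmaR (hξ : ZetaProp ξ) {x : T.carrier} {ι : Type*} [Fintype ι]
    {x1 x2 : ι → T.carrier} (hx : T.comul x = ∑ i, bt T.r T.l (x1 i) (x2 i)) (u : U.carrier) :
    ∑ i, U.conv (sigmaR U (ξ (x1 i))) (ξ (x2 i)) u = U.counit (U.s (T.counit x) * u) := by
  let φ : Module.Dual A U.carrier := rdualToDual U.toARing (ξ x)
  have key : ∀ w, ∑ i, U.convPair (sigmaR U (ξ (x1 i))) (ξ (x2 i)) w =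
      evMap A U.carrier (tpair U.toCCBialgd φ 1 w) := fun w => by
    induction w using Bal.ind with
    | h0 => simp
    | ht u v =>
      rw [tpair_bt, evMap_tmul, act_dual]
      have h1 := antiPair_act U φ 1 v 1 (U.transl u)
      rw [mcoeff_regular, mul_one, counit_s] at h1
      rw [← h1, antiPair_map_mul hξ hx]
      refine Finset.sum_congr rfl fun i _ => ?_
      rw [U.transl_s, antiPair_mulOut_s, convPair_bt, sigmaR_apply, mul_comm]
    | ha p q hp hq => simp only [map_add, Finset.sum_add_distrib, hp, hq]
  have h2 := isRLin_evMap (X := U.carrier) U (φ ⊗ₜ 1) u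
  rw [act_tmul, evMap_tmul, act_base] at h2
  refine (key _).trans (h2.trans ?_)
  rw [← hξ.map_one]; rfl

/-- The identity `S(x₁) x₂ = t(ε(x))` in a universal coring, by bisimulation. -/
theorem IsUniv.antipode_mul (hT : IsUniv T ξ) (H : AlgStr T.toBimod)
    (S : T.carrier →ₗ[k] T.carrier)
    (hξm : ∀ x y, ξ (H.mul x y) = convR U.toCCBialgd (ξ x) (ξ y))
    (hξ1 : ξ H.one = counitR U.toCCBialgd) (hΔ1 : T.comul H.one = bt T.r T.l H.one H.one)
    (hΔ : ∀ (x y : T.carrier) (ι κ : Type) [Fintype ι] [Fintype κ] (x1 x2 : ι → T.carrier)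
        (y1 y2 : κ → T.carrier), T.comul x = ∑ i, bt T.r T.l (x1 i) (x2 i) →
          T.comul y = ∑ j, bt T.r T.l (y1 j) (y2 j) → T.comul (H.mul x y) =
            ∑ i, ∑ j, bt T.r T.l (H.mul (x1 i) (y1 j)) (H.mul (x2 i) (y2 j)))
    (hξS : ∀ x, ξ (S x) = sigmaR U (ξ x))
    (hSl : ∀ a x, S (T.l a x) = T.r a (S x)) (hSr : ∀ a x, S (T.r a x) = T.l a (S x))
    (hΔS : ∀ (x : T.carrier) (ι : Type) [Fintype ι] (x1 x2 : ι → T.carrier),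
        T.comul x = ∑ i, bt T.r T.l (x1 i) (x2 i) →
          T.comul (S x) = ∑ i, bt T.r T.l (S (x2 i)) (S (x1 i)))
    (hb : IsBal (P := T.carrier) T.r T.l (H.mul.comp S)) (x : T.carrier) :
    Bal.lift _ hb (T.comul x) = H.t (T.counit x) := by
  refine hT.bisim (F := fun x => Bal.lift _ hb (T.comul x)) (G := fun x => H.t (T.counit x))
    (fun x => ?_) (fun Q p h => ?_) x
  · apply Subtype.ext; ext u
    obtain ⟨n, x1, x2, hx⟩ := (T.comul x).exists_sum
    have e : ξ (Bal.lift _ hb (T.comul x)) =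
        ∑ i, convR U.toCCBialgd (sigmaR U (ξ (x1 i))) (ξ (x2 i)) := by
      rw [hx, map_sum, map_sum]
      refine Finset.sum_congr rfl fun i _ => ?_
      rw [Bal.lift_bt, LinearMap.comp_apply, hξm, hξS]
    rw [e, AlgStr.t, hT.zeta.map_r, hξ1, ← Submodule.subtype_apply, map_sum, LinearMap.sum_apply]
    simp only [Submodule.subtype_apply, convR_apply]
    exact sum_conv_sigmaR hT.zeta hx u
  · have hmr : ∀ c, IsALin T.r Q.r (p.toLin.comp (H.mul (S c))) := fun c =>
      ⟨fun e m => by simp only [LinearMap.comp_apply, H.mul_r, p.map_r]⟩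
    have hml : ∀ c, IsALin T.l Q.l (p.toLin.comp (H.mul (S c))) := fun c =>
      ⟨fun e m => by simp only [LinearMap.comp_apply, H.mul_l, p.map_l]⟩
    let Λ : T.carrier →ₗ[k] T.carrier →ₗ[k] Bal T.r T.l →ₗ[k] Bal Q.r Q.l :=
      LinearMap.mk₂ k (fun a c => Bal.map _ _ (hmr c) (hml a))
        (fun _ _ _ => Bal.hom_ext fun _ _ => by simp [bt_add_right])
        (fun _ _ _ => Bal.hom_ext fun _ _ => by simp [bt_smul_right])
        (fun _ _ _ => Bal.hom_ext fun _ _ => by simp [bt_add_left])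
        (fun _ _ _ => Bal.hom_ext fun _ _ => by simp [bt_smul_left])
    have hΛ : ∀ a c d d', Λ a c (bt T.r T.l d d') =
        bt Q.r Q.l (p.toLin (H.mul (S c) d)) (p.toLin (H.mul (S a) d')) := fun a c d d' =>
      Bal.map_bt _ _ (hmr c) (hml a) _ _
    -- `L a (c ⊗ (d ⊗ d')) = S(c) d ⊗ S(a) d'`
    let L : T.carrier → (Bal T.r (Bal.actL T.l T.l T.toBimod.comm) →ₗ[k] Bal Q.r Q.l) := fun a =>
      Bal.lift (Λ a) ⟨fun e c w => by
        induction w using Bal.ind with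
        | h0 => simp
        | ht d d' => rw [Bal.actL_bt, hΛ, hΛ, hSr, H.l_mul, H.mul_l]
        | ha p q hp hq => simp only [map_add, hp, hq]⟩
    have hL : ∀ a c w, L a (bt _ _ c w) = Λ a c w := fun a c w => Bal.lift_bt _ _ _ _
    let c3 : Bal T.r T.l →ₗ[k] Bal T.r (Bal.actL T.l T.l T.toBimod.comm) :=
      Bal.map LinearMap.id T.comul ⟨fun _ _ => rfl⟩ ⟨T.str.comul_l⟩
    have hc3 : ∀ c d, c3 (bt T.r T.l c d) = bt _ _ c (T.comul d) := fun c d =>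
      Bal.map_bt _ _ _ _ _ _
    -- `K (a ⊗ (c ⊗ d)) = S(c) d₁ ⊗ S(a) d₂`
    let K : Bal T.r (Bal.actL T.l T.l T.toBimod.comm) →ₗ[k] Bal Q.r Q.l :=
      Bal.lift
        (LinearMap.mk₂ k (fun a w => L a (c3 w))
          (fun a a' w => by
            have : L (a + a') = L a + L a' := Bal.hom_ext fun c w => by
              rw [LinearMap.add_apply, hL, hL, hL, map_add]; rfl
            rw [this]; rfl)
          (fun e a w => by
            have : L (e • a) = e • L a := Bal.hom_ext fun c w => by
              rw [LinearMap.smul_apply, hL, hL, map_smul]; rfl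
            rw [this]; rfl)
          (fun a w w' => by rw [map_add, map_add])
          (fun e a w => by rw [map_smul, map_smul]))
        ⟨fun e a w => by
          change L (T.r e a) (c3 w) = L a (c3 (Bal.actL T.l T.l T.toBimod.comm e w))
          induction w using Bal.ind with
          | h0 => simp
          | ht c d =>
            rw [Bal.actL_bt, hc3, hc3, hL, hL]
            generalize T.comul d = w
            induction w using Bal.ind with
            | h0 => simp
            | ht d d' =>
              rw [hΛ, hΛ, hSr, hSl, H.l_mul, H.r_mul, p.map_l, p.map_r, bt_bal]
            | ha p q hp hq => simp only [map_add, hp, hq]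
          | ha p q hp hq => simp only [map_add, hp, hq]⟩
    have hK : ∀ a w, K (bt _ _ a w) = L a (c3 w) := fun a w => Bal.lift_bt _ _ _ _
    let d3 : Bal T.r T.l →ₗ[k] Bal T.r (Bal.actL T.l T.l T.toBimod.comm) :=
      (Bal.assoc T.r T.l T.r T.l (fun a b x => (T.toBimod.comm b a x).symm)).comp
        (Bal.map T.comul LinearMap.id ⟨T.str.comul_r⟩ ⟨fun _ _ => rfl⟩)
    have hcd : ∀ x, d3 (T.comul x) = c3 (T.comul x) := T.str.coassoc
    have hd3 : ∀ (c d : T.carrier) (n : ℕ) (c1 c2 : Fin n → T.carrier),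
        T.comul c = ∑ i, bt T.r T.l (c1 i) (c2 i) →
        d3 (bt T.r T.l c d) = ∑ i, bt _ _ (c1 i) (bt T.r T.l (c2 i) d) :=
      fun c d n c1 c2 hc => by
        simp only [d3, LinearMap.comp_apply, Bal.map_bt, hc, bt_sum_left, map_sum, Bal.assoc_bt,
          LinearMap.id_apply]
    have h1 : ∀ z, p.bal (T.comul (Bal.lift _ hb z)) = K (d3 z) := fun z => by
      induction z using Bal.ind with
      | h0 => simp
      | ht a b =>
        obtain ⟨n, a1, a2, ha⟩ := (T.comul a).exists_sum
        obtain ⟨m, b1, b2, hb'⟩ := (T.comul b).exists_sum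
        rw [Bal.lift_bt, LinearMap.comp_apply,
          hΔ (S a) b (Fin n) (Fin m) _ _ b1 b2 (hΔS a (Fin n) a1 a2 ha) hb', hd3 a b n a1 a2 ha]
        simp only [map_sum, hK, hc3, hL, hb', hΛ, BiLin.bal_bt]
      | ha p q hp hq => simp only [map_add, hp, hq]
    have h2 : ∀ a w, L a (d3 w) = bt Q.r Q.l (p.toLin H.one) (p.toLin (H.mul (S a)
        (Bal.lift (P := T.carrier) (T.l.toLinearMap.comp T.counit)
          ⟨fun a m n => by simp [T.str.counit_r]⟩ w))) := fun a w => by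
      induction w using Bal.ind with
      | h0 => simp
      | ht e f =>
        obtain ⟨n, e1, e2, he⟩ := (T.comul e).exists_sum
        have hF : p.toLin (∑ i, H.mul (S (e1 i)) (e2 i)) = Q.r (T.counit e) (p.toLin H.one) := by
          have := h e
          simp only [he, map_sum, Bal.lift_bt, LinearMap.comp_apply] at this
          rw [map_sum, this, AlgStr.t, p.map_r]
        rw [hd3 e f n e1 e2 he]
        simp only [map_sum, hL, hΛ]
        rw [← bt_sum_left, ← map_sum, hF, bt_bal, ← p.map_l, Bal.lift_bt, ← H.mul_l]; rfl
      | ha p q hp hq => simp only [map_add, bt_add_right, hp, hq]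
    have h3 : ∀ z, K (c3 z) = bt Q.r Q.l (p.toLin H.one) (p.toLin (Bal.lift _ hb z)) := fun z => by
      induction z using Bal.ind with
      | h0 => simp
      | ht a b =>
        rw [hc3, hK, ← hcd, h2]
        rw [Bal.lift_bt]
        congr 2
        exact congrArg (H.mul (S a)) (T.str.counit_comul b)
      | ha p q hp hq => simp only [map_add, bt_add_right, hp, hq]
    intro x
    have hx := h x
    change p.bal (T.comul (Bal.lift _ hb (T.comul x))) = _
    rw [h1, hcd, h3]
    rw [hx, AlgStr.t, T.str.comul_r, hΔ1, Bal.actR_bt, BiLin.bal_bt]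

/-- A universal coring over `U^*` is a commutative Hopf algebroid. -/
theorem IsUniv.exists_hopf (hT : IsUniv T ξ) : ∃ h : HopfStr T, DualRel U ξ h := by
  obtain ⟨m, hξm, hml, hmr, hεm, hΔm⟩ := hT.exists_mul
  obtain ⟨o, hξo, hεo, hΔo⟩ := hT.exists_one
  obtain ⟨S, hξS, hSl, hSr, hΔS⟩ := hT.exists_antipode
  have hΔo' : T.comul o = ∑ _i : Fin 1, bt T.r T.l o o := by simp [hΔo]
  let H : AlgStr T.toBimod :=
    { mul := m
      one := o
      mul_comm := fun x y => by
        refine hT.bisim (F := fun z : T.carrier × T.carrier => m z.1 z.2)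
          (G := fun z => m z.2 z.1) (fun z => ?_) (fun Q p h z => ?_) (x, y)
        · rw [hξm, hξm, convR_comm]
        · obtain ⟨n, x1, x2, hx⟩ := (T.comul z.1).exists_sum
          obtain ⟨n', y1, y2, hy⟩ := (T.comul z.2).exists_sum
          rw [hΔm _ _ _ _ _ _ _ _ hx hy, hΔm _ _ _ _ _ _ _ _ hy hx, Finset.sum_comm]
          simp only [map_sum, BiLin.bal_bt]
          refine Finset.sum_congr rfl fun j _ => Finset.sum_congr rfl fun i _ => ?_
          rw [h (x1 i, y1 j), h (x2 i, y2 j)]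
      mul_assoc := fun x y z => by
        refine hT.bisim (F := fun w : T.carrier × T.carrier × T.carrier => m (m w.1 w.2.1) w.2.2)
          (G := fun w => m w.1 (m w.2.1 w.2.2)) (fun w => ?_) (fun Q p h w => ?_) (x, y, z)
        · rw [hξm, hξm, hξm, hξm, convR_assoc]
        · obtain ⟨n, x1, x2, hx⟩ := (T.comul w.1).exists_sum
          obtain ⟨n', y1, y2, hy⟩ := (T.comul w.2.1).exists_sum
          obtain ⟨n'', z1, z2, hz⟩ := (T.comul w.2.2).exists_sum
          have hxy : T.comul (m w.1 w.2.1) = ∑ i : Fin n × Fin n',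
              bt T.r T.l (m (x1 i.1) (y1 i.2)) (m (x2 i.1) (y2 i.2)) := by
            rw [hΔm _ _ _ _ _ _ _ _ hx hy, Fintype.sum_prod_type]
          have hyz : T.comul (m w.2.1 w.2.2) = ∑ i : Fin n' × Fin n'',
              bt T.r T.l (m (y1 i.1) (z1 i.2)) (m (y2 i.1) (z2 i.2)) := by
            rw [hΔm _ _ _ _ _ _ _ _ hy hz, Fintype.sum_prod_type]
          rw [hΔm _ _ _ _ _ _ _ _ hxy hz, hΔm _ _ _ _ _ _ _ _ hx hyz]
          simp only [map_sum, BiLin.bal_bt, Fintype.sum_prod_type]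
          refine Finset.sum_congr rfl fun i _ => Finset.sum_congr rfl fun j _ =>
            Finset.sum_congr rfl fun l _ => ?_
          rw [h (x1 i, y1 j, z1 l), h (x2 i, y2 j, z2 l)]
      one_mul := fun x => by
        refine hT.bisim (F := fun x => m o x) (G := fun x => x) (fun x => ?_)
          (fun Q p h x => ?_) x
        · rw [hξm, hξo, convR_counit]
        · obtain ⟨n, x1, x2, hx⟩ := (T.comul x).exists_sum
          rw [hΔm _ _ _ _ _ _ _ _ hΔo' hx, hx]
          simp only [map_sum, BiLin.bal_bt, Finset.univ_unique, Finset.sum_const,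
            Finset.card_singleton, one_smul]
          refine Finset.sum_congr rfl fun i _ => ?_
          rw [h, h]
      l_mul := hml
      r_mul := hmr }
  have S_one : S o = o := by
    refine hT.bisim (X := Unit) (F := fun _ => S o) (G := fun _ => o) (fun _ => ?_)
      (fun Q p h _ => ?_) ()
    · rw [hξS, hξo, sigmaR_counit]
    · rw [hΔS o (Fin 1) _ _ hΔo', hΔo]
      simp only [BiLin.bal_bt, Finset.univ_unique, Finset.sum_const,
        Finset.card_singleton, one_smul, h ()]
  have S_mul : ∀ x y, S (m x y) = m (S x) (S y) := fun x y => by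
    refine hT.bisim (F := fun z : T.carrier × T.carrier => S (m z.1 z.2))
      (G := fun z => m (S z.1) (S z.2)) (fun z => ?_) (fun Q p h z => ?_) (x, y)
    · rw [hξm, hξS, hξS, hξS, hξm, sigmaR_convR]
    · obtain ⟨n, x1, x2, hx⟩ := (T.comul z.1).exists_sum
      obtain ⟨n', y1, y2, hy⟩ := (T.comul z.2).exists_sum
      have hxy : T.comul (m z.1 z.2) = ∑ i : Fin n × Fin n',
          bt T.r T.l (m (x1 i.1) (y1 i.2)) (m (x2 i.1) (y2 i.2)) := by
        rw [hΔm _ _ _ _ _ _ _ _ hx hy, Fintype.sum_prod_type]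
      rw [hΔS _ _ _ _ hxy, hΔm _ _ _ _ _ _ _ _ (hΔS _ _ _ _ hx) (hΔS _ _ _ _ hy)]
      simp only [map_sum, BiLin.bal_bt, Fintype.sum_prod_type]
      refine Finset.sum_congr rfl fun i _ => Finset.sum_congr rfl fun j _ => ?_
      rw [h (x1 i, y1 j), h (x2 i, y2 j)]
  have S_S : ∀ x, S (S x) = x := fun x => by
    refine hT.bisim (F := fun x => S (S x)) (G := fun x => x) (fun x => ?_)
      (fun Q p h x => ?_) x
    · rw [hξS, hξS, sigmaR_sigmaR]
    · obtain ⟨n, x1, x2, hx⟩ := (T.comul x).exists_sum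
      rw [hΔS _ _ _ _ (hΔS _ _ _ _ hx), hx]
      simp only [map_sum, BiLin.bal_bt]
      refine Finset.sum_congr rfl fun i _ => ?_
      rw [h, h]
  have hb : IsBal (P := T.carrier) T.r T.l (H.mul.comp S) := ⟨fun a x y => by
    rw [LinearMap.comp_apply, LinearMap.comp_apply, hSr, H.l_mul, H.mul_l]⟩
  have S_mul_id := hT.antipode_mul H S hξm hξo hΔo hΔm hξS hSl hSr hΔS hb
  refine ⟨
    { toAlgStr := H
      counit_one := hεo
      counit_mul := hεm
      comul_one := hΔo
      comul_mul := fun x y => by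
        obtain ⟨n, x1, x2, hx⟩ := (T.comul x).exists_sum
        obtain ⟨n', y1, y2, hy⟩ := (T.comul y).exists_sum
        rw [hx, hy]
        refine (hΔm _ _ _ _ _ _ _ _ hx hy).trans ?_
        simp only [map_sum, LinearMap.sum_apply, AlgStr.mulT_bt]
        exact Finset.sum_comm
      S := S
      S_one := S_one
      S_mul := S_mul
      S_l := hSl
      S_r := hSr
      S_S := S_S
      S_mul_id := S_mul_id
      id_mul_S := fun x => H.id_mul_S S_one S_mul hSr S_S hb _ (S_mul_id x) },
    fun a b u => ?_, fun x y u => ?_, fun x u => ?_⟩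
  · change (ξ (H.eta a b)).1 u = _
    rw [AlgStr.eta, AlgStr.s, AlgStr.t, H.l_mul, H.one_mul, hT.zeta.map_l, hT.zeta.map_r, hξo,
      mul_comm]
    rfl
  · change (ξ (m x y)).1 u = _
    rw [hξm, convR_apply]
  · change (ξ (S x)).1 u = _
    rw [hξS, sigmaR_apply]

end UnivHopf

/-- A coring map between commutative Hopf algebroids which is an algebra map commutes with the
antipodes: compute `g(S(x₁)) g(x₂) S(g(x₃))` in two ways. -/
theorem HopfStr.map_S_of_map_mul {C D : ACoring k A} (H : HopfStr C) (K : HopfStr D) (g : C ⟶ D)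
    (h1 : g.toLin H.one = K.one)
    (hm : ∀ x y, g.toLin (H.mul x y) = K.mul (g.toLin x) (g.toLin y)) (x : C.carrier) :
    g.toLin (H.S x) = K.S (g.toLin x) := by
  let ν : Bal C.r C.l →ₗ[k] D.carrier :=
    Bal.lift ((K.mul.compl₂ K.S).compl₁₂ g.toLin g.toLin) ⟨fun a x y => by
      change K.mul (g.toLin (C.r a x)) (K.S (g.toLin y)) =
        K.mul (g.toLin x) (K.S (g.toLin (C.l a y)))
      rw [g.map_r, g.map_l, K.S_l, K.r_mul, K.mul_r]⟩
  have hν : ∀ x y, ν (bt C.r C.l x y) = K.mul (g.toLin x) (K.S (g.toLin y)) := fun x y =>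
    Bal.lift_bt _ _ _ _
  have hνl : ∀ a w, ν (Bal.actL C.l C.l C.toBimod.comm a w) = D.l a (ν w) := fun a w => by
    induction w using Bal.ind with
    | h0 => simp
    | ht x y => rw [Bal.actL_bt, hν, hν, g.map_l, K.l_mul]
    | ha p q hp hq => simp only [map_add, hp, hq]
  have hνΔ : ∀ x, ν (C.comul x) = D.l (C.counit x) K.one := fun x => by
    refine Eq.trans ?_ ((K.id_mul_S (g.toLin x)).trans (by rw [g.counit_map]; rfl))
    rw [g.comul_bi]
    generalize C.comul x = w
    induction w using Bal.ind with
    | h0 => simp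
    | ht x y => rw [hν, BiLin.bal_bt, Bal.lift_bt]; rfl
    | ha p q hp hq => simp only [map_add, hp, hq]
  let Φ : Bal C.r (Bal.actL C.l C.l C.toBimod.comm) →ₗ[k] D.carrier :=
    Bal.lift (K.mul.compl₁₂ (g.toLin.comp H.S) ν) ⟨fun a x w => by
      change K.mul (g.toLin (H.S (C.r a x))) (ν w) = K.mul (g.toLin (H.S x)) (ν _)
      rw [hνl, H.S_r, g.map_l, K.l_mul, K.mul_l]⟩
  have hΦ : ∀ x w, Φ (bt _ _ x w) = K.mul (g.toLin (H.S x)) (ν w) := fun x w =>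
    Bal.lift_bt _ _ _ _
  have e1 : ∀ z, Φ (Bal.map LinearMap.id C.comul ⟨fun _ _ => rfl⟩ ⟨C.str.comul_l⟩ z) =
      g.toLin (H.S (Bal.lift (P := C.carrier) (C.r.toLinearMap.comp C.counit).flip
        ⟨fun a m n => by simp [C.str.counit_l, mul_comm a]⟩ z)) := fun z => by
    induction z using Bal.ind with
    | h0 => simp
    | ht x y =>
      rw [Bal.map_bt, hΦ, hνΔ, Bal.lift_bt, K.mul_l, K.mul_comm, K.one_mul]
      change _ = g.toLin (H.S (C.r (C.counit y) x))
      rw [H.S_r, g.map_l]; rfl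
    | ha p q hp hq => simp only [map_add, hp, hq]
  have hd : ∀ w y, Φ (Bal.assoc C.r C.l C.r C.l (fun a b x => (C.toBimod.comm b a x).symm)
      (bt _ C.l w y)) = K.mul (g.toLin (Bal.lift (P := C.carrier) (H.mul.comp H.S)
        ⟨fun a x y => (congrArg (fun z => H.mul z y) (H.S_r a x)).trans
          ((H.l_mul a (H.S x) y).trans (H.mul_l a (H.S x) y).symm)⟩ w))
        (K.S (g.toLin y)) := fun w y => by
    induction w using Bal.ind with
    | h0 => simp
    | ht a b =>
      rw [Bal.assoc_bt, hΦ, hν, Bal.lift_bt, LinearMap.comp_apply, hm, K.mul_assoc]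
    | ha p q hp hq => simp only [map_add, bt_add_left, LinearMap.add_apply, hp, hq]
  have e2 : ∀ z, Φ (Bal.assoc C.r C.l C.r C.l (fun a b x => (C.toBimod.comm b a x).symm)
      (Bal.map C.comul LinearMap.id ⟨C.str.comul_r⟩ ⟨fun _ _ => rfl⟩ z)) =
      K.S (g.toLin (Bal.lift (P := C.carrier) (C.l.toLinearMap.comp C.counit)
        ⟨fun a m n => by simp [C.str.counit_r]⟩ z)) := fun z => by
    induction z using Bal.ind with
    | h0 => simp
    | ht x y =>
      rw [Bal.map_bt, hd, H.S_mul_id, AlgStr.t, g.map_r, h1, K.r_mul, K.one_mul, Bal.lift_bt]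
      change _ = K.S (g.toLin (C.l (C.counit x) y))
      rw [g.map_l, K.S_l]; rfl
    | ha p q hp hq => simp only [map_add, hp, hq]
  have h3 := (e1 (C.comul x)).symm.trans
    ((congrArg Φ (C.str.coassoc x).symm).trans (e2 (C.comul x)))
  have h4 := C.str.comul_counit x
  have h5 := C.str.counit_comul x
  exact (congrArg (fun z => g.toLin (H.S z)) h4).symm.trans
    (h3.trans (congrArg (fun z => K.S (g.toLin z)) h5))

section UnivProp

variable {U : CCHopf k A} {T : ACoring k A} {ξ : T.carrier →ₗ[k] U.RDual}

/-- A coring map `g` to a universal coring is a map of Hopf algebroids as soon as `ξ ∘ g` is an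
algebra map. -/
theorem IsUniv.exists_chopfHom (hT : IsUniv T ξ) {K : HopfStr T} (hK : DualRel U ξ K)
    (H : CHopf k A) (g : H.coring ⟶ T) (hg : U.IsAlgMap H.str.toAlgStr (ξ.comp g.toLin)) :
    ∃ G : H ⟶ ⟨T, K⟩, G.toCoringHom = g := by
  have e1 : ∀ (C : ACoring k A) (H : HopfStr C), H.eta 1 1 = H.one := fun C H => by
    rw [AlgStr.eta, AlgStr.s, AlgStr.t, map_one, map_one]
    exact H.one_mul _
  have h1 : g.toLin H.str.one = K.one := by
    refine hT.bisim (X := Unit) (F := fun _ => g.toLin H.str.one) (G := fun _ => K.one)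
      (fun _ => ?_) (fun Q p h _ => ?_) ()
    · apply Subtype.ext; ext u
      have a1 := hg.map_eta 1 1 u
      have a2 := hK.eta 1 1 u
      rw [e1] at a1 a2
      exact a1.trans a2.symm
    · rw [g.comul_bi, H.str.comul_one, K.comul_one]
      rw [BiLin.bal_bt, BiLin.bal_bt, BiLin.bal_bt]
      change bt Q.r Q.l (p.toLin (g.toLin H.str.one)) (p.toLin (g.toLin H.str.one)) = _
      rw [h ()]
  have hm : ∀ x y, g.toLin (H.str.mul x y) = K.mul (g.toLin x) (g.toLin y) := fun x y => by
    refine hT.bisim (F := fun z : H.coring.carrier × H.coring.carrier =>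
      g.toLin (H.str.mul z.1 z.2)) (G := fun z => K.mul (g.toLin z.1) (g.toLin z.2))
      (fun z => ?_) (fun Q p h z => ?_) (x, y)
    · apply Subtype.ext; ext u
      exact (hg.map_mul z.1 z.2 u).trans (hK.mul _ _ u).symm
    · rw [g.comul_bi, H.str.comul_mul, K.comul_mul, g.comul_bi, g.comul_bi]
      generalize H.coring.comul z.1 = v
      generalize H.coring.comul z.2 = w
      induction v using Bal.ind with
      | h0 => simp
      | ht a b =>
        induction w using Bal.ind with
        | h0 => simp
        | ht c d =>
          rw [AlgStr.mulT_bt, BiLin.bal_bt, BiLin.bal_bt, BiLin.bal_bt, BiLin.bal_bt,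
            AlgStr.mulT_bt, BiLin.bal_bt]
          exact congrArg₂ (bt Q.r Q.l) (h (a, c)) (h (b, d))
        | ha p q hp hq => simp only [map_add, hp, hq]
      | ha p q hp hq => simp only [map_add, LinearMap.add_apply, hp, hq]
  exact ⟨⟨g, h1, hm, HopfStr.map_S_of_map_mul H.str K g h1 hm⟩, rfl⟩

theorem IsUniv.hopf_unique (hT : IsUniv T ξ) {K K' : HopfStr T} (hK : DualRel U ξ K)
    (hK' : DualRel U ξ K') : K' = K := by
  obtain ⟨G, hG⟩ := hT.exists_chopfHom hK ⟨T, K'⟩ (𝟙 T)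
    ⟨fun a b u => hK'.eta a b u, fun x y u => hK'.mul x y u⟩
  have h0 : ∀ x, G.toCoringHom.toLin x = x := fun x => by rw [hG]; rfl
  have h1 := G.map_one
  have h2 := G.map_mul
  have h3 := G.map_S
  simp only [h0] at h1 h2 h3
  exact HopfStr.ext (LinearMap.ext fun x => LinearMap.ext fun y => h2 x y) h1
    (LinearMap.ext h3)

/-- The universal property of a universal coring among commutative Hopf algebroids. -/
theorem IsUniv.existsUnique_chopfHom (hT : IsUniv T ξ) {K : HopfStr T} (hK : DualRel U ξ K)
    (H : CHopf k A) (f : H.coring.carrier →ₗ[k] U.RDual) (hf : U.IsAlgMap H.str.toAlgStr f)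
    (hz : ZetaProp f) :
    ∃ g : H ⟶ ⟨T, K⟩, (∀ x, ξ (g.toCoringHom.toLin x) = f x) ∧
      ∀ g' : H.coring ⟶ T, (∀ x, ξ (g'.toLin x) = f x) → g' = g.toCoringHom := by
  obtain ⟨g, hg⟩ := hT.exists_hom H.coring f hz
  have e : ξ.comp g.toLin = f := LinearMap.ext hg
  obtain ⟨G, hG⟩ := hT.exists_chopfHom hK H g (by rw [e]; exact hf)
  refine ⟨G, fun x => ?_, fun g' hg' => ?_⟩
  · rw [hG]; exact hg x
  · rw [hG]; exact hT.uniq _ _ _ fun x => (hg' x).trans (hg x).symm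

end UnivProp

/-! ### Functoriality -/

section Functoriality

variable {L : ARing k A ⥤ (ACoring k A)ᵒᵖ} (adj : L ⊣ ldualFunctor k A)

/-- The maps `ξ` are compatible with maps of `A`-rings, by the naturality of the unit. -/
theorem xi_map {R T : ARing k A} (f : R ⟶ T) (z : (bullet L T).carrier) (x : R.carrier) :
    (xi adj R ((L.map f).unop.toLin z)).1 x = (xi adj T z).1 (f.toAlgHom x) := by
  have h := congrArg ARing.Hom.toAlgHom (adj.unit.naturality f)
  have h2 := congrArg (fun g => g x) h
  exact (congrArg (fun (g : (bullet L T).LDual) => g.1 z) h2).symm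

theorem convPair_comp {U V : CCHopf k A} (f : U ⟶ V) (φ ψ : V.RDual) (φ' ψ' : U.RDual)
    (hφ : ∀ u, φ'.1 u = φ.1 (f.toRingHom.toAlgHom u))
    (hψ : ∀ u, ψ'.1 u = ψ.1 (f.toRingHom.toAlgHom u)) (u : U.carrier) :
    U.conv φ' ψ' u = V.conv φ ψ (f.toRingHom.toAlgHom u) := by
  rw [CCBialgd.conv, CCBialgd.conv, f.comul_map]
  induction U.comul u using Bal.ind with
  | h0 => simp
  | ht v w =>
    rw [Bal.map_bt, convPair_bt, convPair_bt, hφ, hψ]; rfl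
  | ha p q hp hq => simp only [map_add, hp, hq]

/-- For a morphism `f : U → V`, the composite of `V^• → U^•` with `ξ` is `ξ` followed by the
restriction `V^* → U^*` along `f`, which is a map of algebras as `f` is compatible with `ε` and
`Δ`. -/
theorem isAlgMap_xi_map {U V : CCHopf k A} (f : U ⟶ V) {K : HopfStr (bullet L V.toARing)}
    (hK : DualRel V (xi adj V.toARing) K) :
    U.IsAlgMap K.toAlgStr ((xi adj U.toARing).comp (L.map f.toRingHom).unop.toLin) where
  map_eta a b u := by
    rw [LinearMap.comp_apply, xi_map, hK.eta, ← f.toRingHom.map_s, ← map_mul, f.counit_map]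
  map_mul x y u := by
    rw [LinearMap.comp_apply, xi_map, hK.mul]
    exact (convPair_comp f _ _ _ _ (fun u => xi_map adj _ x u) (fun u => xi_map adj _ y u) u).symm

/-- The contravariant functor from cocommutative to commutative Hopf algebroids induced by
`(-)^•`, for a choice of Hopf algebroid structures on its values. -/
def bulletFunctor (h : ∀ U : CCHopf k A, HopfStr (bullet L U.toARing))
    (hh : ∀ U, DualRel U (xi adj U.toARing) (h U)) : (CCHopf k A)ᵒᵖ ⥤ CHopf k A where
  obj U := ⟨bullet L U.unop.toARing, h U.unop⟩
  map {V U} f :=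
    have e := (isUniv_bullet adj U.unop.toARing).exists_chopfHom (hh U.unop)
      ⟨bullet L V.unop.toARing, h V.unop⟩ (L.map f.unop.toRingHom).unop
      (isAlgMap_xi_map adj f.unop (hh V.unop))
    { toCoringHom := (L.map f.unop.toRingHom).unop
      map_one := by obtain ⟨G, hG⟩ := e; rw [← hG]; exact G.map_one
      map_mul := by obtain ⟨G, hG⟩ := e; rw [← hG]; exact G.map_mul
      map_S := by obtain ⟨G, hG⟩ := e; rw [← hG]; exact G.map_S }
  map_id U := CHopf.Hom.ext (congrArg Quiver.Hom.unop (L.map_id U.unop.toARing))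
  map_comp f g := CHopf.Hom.ext
    (congrArg Quiver.Hom.unop (L.map_comp g.unop.toRingHom f.unop.toRingHom))

theorem bulletFunctor_forget (h : ∀ U : CCHopf k A, HopfStr (bullet L U.toARing))
    (hh : ∀ U, DualRel U (xi adj U.toARing) (h U)) :
    bulletFunctor adj h hh ⋙ CHopf.forgetCoring k A =
      (CCHopf.forgetRing k A).op ⋙ L.leftOp := rfl

end Functoriality

/-! ### The finite dual as a universal coring -/

section Lift

variable {R : ARing k A}

/-- If `ζ` is injective, a lift of a coring map `f : C → R^*` through `ζ` is a map of corings as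
soon as it is compatible with the comultiplications. -/
theorem exists_circHom (hinj : Function.Injective (zeta R)) {C : ACoring k A}
    {f : C.carrier →ₗ[k] R.RDual} (hf : ZetaProp f) (g : C.carrier →ₗ[k] CircCarrier R)
    (hg : ∀ x, zeta R (g x) = f x)
    (hΔ : ∀ (x : C.carrier) (n : ℕ) (x1 x2 : Fin n → C.carrier),
      C.comul x = ∑ i, bt C.r C.l (x1 i) (x2 i) →
        circComul R (g x) = ∑ i, bt (circR R) (circL R) (g (x1 i)) (g (x2 i))) :
    ∃ G : C ⟶ circC R, ∀ x, zeta R (G.toLin x) = f x := by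
  have hz := zetaProp_zeta R
  refine ⟨
    { toLin := g
      map_l := fun a x => hinj (Subtype.ext (LinearMap.ext fun u => ?_))
      map_r := fun a x => hinj (Subtype.ext (LinearMap.ext fun u => ?_))
      counit_map := fun x => ?_
      comul_map := fun x => ?_ }, hg⟩
  · rw [hg, hf.map_l]
    exact (congrArg (a * ·) (by rw [hg])).trans (hz.map_l a (g x) u).symm
  · rw [hg, hf.map_r]
    exact Eq.trans (by rw [hg]) (hz.map_r a (g x) u).symm
  · rw [← hf.map_one, ← hg]
    exact (hz.map_one (g x)).symm
  · obtain ⟨n, x1, x2, hx⟩ := (C.comul x).exists_sum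
    rw [hx, map_sum]
    exact (hΔ x n x1 x2 hx).trans (Finset.sum_congr rfl fun i _ => (Bal.map_bt _ _ _ _ _ _).symm)

theorem circHom_ext (hinj : Function.Injective (zeta R)) {C : ACoring k A} (g h : C ⟶ circC R)
    (e : ∀ x, zeta R (g.toLin x) = zeta R (h.toLin x)) : g = h :=
  ACoring.Hom.ext (LinearMap.ext fun x => hinj (e x))

end Lift

section Regular

variable (R : ARing k A) [Module.Finite A R.carrier] [Module.Projective A R.carrier]

/-- If `R` is finitely generated and projective, every element of `R°` is a matrix coefficient of
the regular module, at its generator. -/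
theorem gmk_zeta (z : CircCarrier R) : gmk R (rdualToDual R (zeta R z)) 1 = z := by
  induction z using circ_ind with
  | h0 =>
    have : rdualToDual R (zeta R 0) = 0 := by
      rw [map_zero]; rfl
    rw [this, ← gmkL_apply, map_zero, LinearMap.zero_apply]
  | hc P φ p =>
    let t : R.carrier →ₗ[A] P.S :=
      { toFun := P.act p
        map_add' := map_add _
        map_smul' := fun a x => P.act_r p a x }
    have ht : IsRLin R t := fun x y => P.act_mul p x y
    have h1 : t 1 = p := P.act_one p
    have h2 : rdualToDual R (zeta R (cmk P φ p)) = φ.comp t := by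
      rw [zeta_cmk]; rfl
    rw [h2, ← gmk_comp R ht, h1, gmk_cmk]
  | ha x y hx hy =>
    have : rdualToDual R (zeta R (x + y)) =
        rdualToDual R (zeta R x) + rdualToDual R (zeta R y) := by
      rw [map_add]; rfl
    rw [this, gmk_add_left, hx, hy]

theorem zeta_injective_of_finite : Function.Injective (zeta R) := fun x y h => by
  rw [← gmk_zeta R x, h, gmk_zeta R y]

/-- If `R` is finitely generated and projective, then `ζ : R° → R^*` is bijective, and `R°` is
universal: a coring map `f : C → R^*` lifts to `x ↦ f(x) ⊗ 1` at the regular module. -/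
theorem isUniv_circ_of_finite : IsUniv (circC R) (zeta R) where
  zeta := zetaProp_zeta R
  exists_hom C f hf := by
    let g : C.carrier →ₗ[k] CircCarrier R :=
      { toFun := fun x => gmk R (rdualToDual R (f x)) 1
        map_add' := fun x y => by
          rw [← gmk_add_left, map_add]; rfl
        map_smul' := fun c x => by
          rw [RingHom.id_apply, ← gmk_smul_left, map_smul]; rfl }
    have hg : ∀ x, zeta R (g x) = f x := fun x =>
      (zeta_gmk R _ _).trans (mcoeff_regular R (f x))
    have hinj := zeta_injective_of_finite R
    refine exists_circHom hinj hf g hg fun x n x1 x2 hx => ?_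
    obtain ⟨m, e, e', h⟩ := exists_isDualBasis (A := A) R.carrier
    -- `f(x) ⊗ r = Σ g(x₁) f(x₂)(r)`
    have h1 : ∀ r, gmk R (rdualToDual R (f x)) r =
        ∑ i, circR R ((f (x2 i)).1 r) (g (x1 i)) := fun r => hinj (by
      apply Subtype.ext; ext u
      rw [zeta_gmk, mcoeff_apply, regular_act, rdualToDual_apply, hf.map_mul_sum hx, map_sum,
        ← Submodule.subtype_apply, map_sum, LinearMap.sum_apply]
      refine Finset.sum_congr rfl fun i _ => ?_
      rw [Submodule.subtype_apply, ← hg (x1 i)]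
      exact ((zetaProp_zeta R).map_r _ (g (x1 i)) u).symm)
    refine (circComul_gmk R h _ _).trans ?_
    simp only [h1, bt_sum_left, bt_bal]
    rw [Finset.sum_comm]
    refine Finset.sum_congr rfl fun i _ => ?_
    rw [← bt_sum_right]
    congr 1
    simp only [circL_gmk]
    rw [← gmk_sum_left]
    exact congrArg (fun φ => gmk R φ 1) (h.sum_dual (rdualToDual R (f (x2 i))))
  uniq _ := circHom_ext (zeta_injective_of_finite R)

end Regular

section FieldBase

variable {R : ARing k A}

/-- The right action of `A` on a bimodule, as a module structure. -/
abbrev ABimod.rightModule (M : ABimod k A) : Module A M.carrier :=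
  Module.compHom M.carrier M.r.toRingHom

/-- A submodule stable under `R` is a right `R`-module. -/
abbrev RAct.restrict {X : Type*} [AddCommGroup X] [Module k X] [Module A X] [IsScalarTower k A X]
    [RAct R X] (N : Submodule A X) (hN : ∀ p ∈ N, ∀ x, act R p x ∈ N) : RAct R N where
  act' := LinearMap.mk₂ k (fun p x => ⟨act R p.1 x, hN p.1 p.2 x⟩)
    (fun _ _ _ => by apply Subtype.ext; simp) (fun _ _ _ => by apply Subtype.ext; simp)
    (fun _ _ _ => by apply Subtype.ext; simp) (fun _ _ _ => by apply Subtype.ext; simp)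
  act_one' p := Subtype.ext (act_one R p.1)
  act_mul' p x y := Subtype.ext (act_mul R p.1 x y)
  act_s' p a := Subtype.ext (act_s R p.1 a)

/-- The direct sum of two modules. -/
instance {X Y : Type*} [AddCommGroup X] [Module k X] [Module A X] [RAct R X]
    [AddCommGroup Y] [Module k Y] [Module A Y] [RAct R Y] : RAct R (X × Y) where
  act' := LinearMap.mk₂ k (fun p x => (act R p.1 x, act R p.2 x))
    (fun _ _ _ => by simp) (fun _ _ _ => by simp) (fun _ _ _ => by simp) (fun _ _ _ => by simp)
  act_one' p := Prod.ext (act_one R p.1) (act_one R p.2)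
  act_mul' p x y := Prod.ext (act_mul R p.1 x y) (act_mul R p.2 x y)
  act_s' p a := Prod.ext (act_s R p.1 a) (act_s R p.2 a)

/-- Every element of `R°` is represented by a single tensor, as one sees from direct sums of
modules. -/
theorem exists_eq_cmk (z : CircCarrier R) : ∃ P φ p, z = cmk (R := R) P φ p := by
  induction z using circ_ind with
  | h0 =>
    let P : FGPMod R :=
      { n := 0
        S := ⊥
        finite := inferInstance
        proj := inferInstance
        act := 0
        act_one := fun _ => Subsingleton.elim _ _
        act_mul := fun _ _ _ => Subsingleton.elim _ _
        act_s := fun _ _ => Subsingleton.elim _ _ }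
    exact ⟨P, 0, 0, ((cmkL P).map_zero₂ 0).symm⟩
  | hc P φ p => exact ⟨P, φ, p, rfl⟩
  | ha x y hx hy =>
    obtain ⟨P, φ, p, rfl⟩ := hx
    obtain ⟨Q, ψ, q, rfl⟩ := hy
    refine ⟨ofMod R (P.S × Q.S), _, _,
      (?_ : _ = gmk R (φ.comp (LinearMap.fst A P.S Q.S) + ψ.comp (LinearMap.snd A P.S Q.S)) (p, q))⟩
    rw [gmk_add_left, ← gmk_comp R (X := P.S × Q.S) (Y := P.S) (t := LinearMap.fst A P.S Q.S)
      (fun _ _ => rfl), ← gmk_comp R (X := P.S × Q.S) (Y := Q.S) (t := LinearMap.snd A P.S Q.S)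
      (fun _ _ => rfl), gmk_cmk, gmk_cmk]
    rfl

theorem finite_of_isField (hA : IsField A) {X : Type*} [AddCommGroup X] [Module A X]
    [Module.Finite A X] (N : Submodule A X) : Module.Finite A N := by
  let _ := hA.toField
  exact inferInstance

theorem projective_of_isField (hA : IsField A) (X : Type*) [AddCommGroup X] [Module A X] :
    Module.Projective A X := by
  let _ := hA.toField
  exact inferInstance

/-- Over a field, `ζ` is injective: if `φ(p x) = 0` for all `x`, then `φ` vanishes on the submodule
generated by `p`, to which `φ ⊗ p` can be restricted. -/
theorem zeta_injective_of_isField (hA : IsField A) : Function.Injective (zeta R) := by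
  rw [injective_iff_map_eq_zero]
  intro z hz
  obtain ⟨P, φ, p, rfl⟩ := exists_eq_cmk z
  rw [zeta_cmk] at hz
  -- the submodule generated by `p`
  let t : R.carrier →ₗ[A] P.S :=
    { toFun := P.act p
      map_add' := map_add _
      map_smul' := fun a x => P.act_r p a x }
  let N := LinearMap.range t
  let _ : RAct R N := RAct.restrict N (by
    rintro _ ⟨x, rfl⟩ y
    exact ⟨x * y, P.act_mul p x y⟩)
  have := finite_of_isField hA N
  have := projective_of_isField hA N
  have h1 : φ.comp N.subtype = 0 := by
    ext ⟨_, x, rfl⟩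
    exact congrArg (fun f : R.RDual => f.1 x) hz
  have h2 := gmk_comp R (X := N) (Y := P.S) (t := N.subtype) (fun _ _ => rfl) φ
    ⟨p, 1, P.act_one p⟩
  rw [h1, gmk_cmk, ← gmkL_apply, map_zero, LinearMap.zero_apply] at h2
  exact h2

attribute [local instance] ABimod.rightModule

instance (M : ABimod k A) : IsScalarTower k A M.carrier :=
  ⟨fun c a x => by
    change M.r (c • a) x = c • M.r a x
    simp⟩

/-- The right action `x · r = x₁ f(x₂)(r)` on a coring `C` with a map `f : C → R^*` satisfying
`(ζ)`. -/
abbrev ZetaProp.coringAct {C : ACoring k A} {f : C.carrier →ₗ[k] R.RDual} (hf : ZetaProp f) :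
    RAct R C.carrier :=
  let h : R.carrier →ₗ[k] C.LDual := (ofZeta f hf).toAlgHom.toLinearMap
  { act' := LinearMap.mk₂ k (fun x r => C.contr (h r) (C.comul x))
      (fun _ _ _ => by simp only [map_add]) (fun _ _ _ => by simp only [map_smul])
      (fun x r r' => by
        rw [map_add]
        have : C.contr (h r + h r') = C.contr (h r) + C.contr (h r') :=
          Bal.hom_ext fun m n => by simp
        rw [this]; rfl)
      (fun c x r => by
        rw [map_smul]
        have : C.contr (c • h r) = c • C.contr (h r) := Bal.hom_ext fun m n => by simp
        rw [this]; rfl)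
    act_one' := fun p => by
      have e : h 1 = 1 := _root_.map_one (ofZeta f hf).toAlgHom
      change C.contr (h 1) (C.comul p) = p
      rw [e, C.contr_one]
    act_mul' := fun p x y => by
      have e : h (x * y) = h x * h y := _root_.map_mul (ofZeta f hf).toAlgHom x y
      change C.contr (h (x * y)) (C.comul p) = _
      rw [e, C.contr_mul]; rfl
    act_s' := fun p a => by
      have e : h (R.s a) = C.ldualUnit a := (ofZeta f hf).map_s a
      change C.contr (h (R.s a)) (C.str.comul p) = C.r a p
      rw [e]
      conv_rhs => rw [← C.str.comul_counit p]
      generalize C.str.comul p = w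
      induction w using Bal.ind with
      | h0 => simp
      | ht m n => simp [mul_comm]
      | ha p q hp hq => simp only [map_add, hp, hq] }

section

variable {C : ACoring k A} {f : C.carrier →ₗ[k] R.RDual} (hf : ZetaProp f)

theorem ZetaProp.coringAct_apply {x : C.carrier} {ι : Type*} [Fintype ι] {x1 x2 : ι → C.carrier}
    (hx : C.comul x = ∑ i, bt C.r C.l (x1 i) (x2 i)) (r : R.carrier) :
    hf.coringAct.act' x r = ∑ i, (f (x2 i)).1 r • x1 i := by
  change C.contr ((ofZeta f hf).toAlgHom r) (C.comul x) = _
  rw [hx, map_sum]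
  exact Finset.sum_congr rfl fun i _ => C.contr_bt _ _ _

theorem ZetaProp.counit_coringAct (x : C.carrier) (r : R.carrier) :
    C.counit (hf.coringAct.act' x r) = (f x).1 r :=
  C.counit_contr _ x

/-- Over a field, finitely many elements of the coring `C` lie in a finite-dimensional submodule:
the submodule `x R` is contained in the span of the components `x₁` of `Δ(x)`. -/
theorem ZetaProp.exists_stable (hA : IsField A) {n : ℕ} (v : Fin n → C.carrier) :
    ∃ N : Submodule A C.carrier, Module.Finite A N ∧
      (∀ p ∈ N, ∀ r, hf.coringAct.act' p r ∈ N) ∧ ∀ i, v i ∈ N := by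
  let _ := hf.coringAct
  let W : C.carrier → Submodule A C.carrier := fun y => LinearMap.range
    ({ toFun := act R y
       map_add' := map_add _
       map_smul' := fun a x => act_r R y x a } : R.carrier →ₗ[A] C.carrier)
  have hW : ∀ y, (W y).FG := fun y => by
    obtain ⟨m, y1, y2, hy⟩ := (C.comul y).exists_sum
    let S := Submodule.span A (Set.range y1)
    have hS : IsNoetherian A S := by
      let _ := hA.toField
      exact isNoetherian_of_fg_of_noetherian S (Submodule.fg_span (Set.finite_range y1))
    refine isNoetherian_submodule.1 hS (W y) ?_
    rintro _ ⟨r, rfl⟩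
    change hf.coringAct.act' y r ∈ S
    rw [hf.coringAct_apply hy]
    exact Submodule.sum_mem _ fun i _ => S.smul_mem _ (Submodule.subset_span ⟨i, rfl⟩)
  refine ⟨⨆ i, W (v i), Module.Finite.iff_fg.2 (Submodule.fg_iSup _ fun i => hW _),
    fun p hp r => ?_, fun i => le_iSup (fun i => W (v i)) i ⟨1, act_one R (v i)⟩⟩
  change act R p r ∈ _
  induction hp using Submodule.iSup_induction' with
  | mem i x hx =>
    obtain ⟨s, rfl⟩ := hx
    exact le_iSup (fun i => W (v i)) i ⟨s * r, act_mul R (v i) s r⟩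
  | zero => simp
  | add x y _ _ hx hy =>
    rw [map_add, LinearMap.add_apply]
    exact Submodule.add_mem _ hx hy

end

/-- Over a field, `R°` is universal. An element `x` of a coring `C` over `R^*` lies in a
finite-dimensional `R`-submodule `N`, and `f(x)` is the matrix coefficient of `N` at `x` and the
counit. For the comultiplications to agree, `N` has to contain the components `x₁` as well. -/
theorem isUniv_circ_of_isField (hA : IsField A) : IsUniv (circC R) (zeta R) where
  zeta := zetaProp_zeta R
  exists_hom C f hf := by
    have hinj := zeta_injective_of_isField (R := R) hA
    let _ := hf.coringAct
    let ε : C.carrier →ₗ[A] A :=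
      { toFun := C.counit
        map_add' := map_add _
        map_smul' := fun a x => (C.str.counit_r a x).trans (mul_comm _ _) }
    -- the elements of a finite-dimensional submodule lift through `ζ`
    have key : ∀ (N : Submodule A C.carrier) (hfin : Module.Finite A N)
        (hpr : Module.Projective A N) (hN : ∀ p ∈ N, ∀ r, act R p r ∈ N) (p : N),
        let _ := RAct.restrict N hN
        zeta R (gmk R (ε.comp N.subtype) p) = f p.1 := fun N hfin hpr hN p => by
      intro _
      rw [zeta_gmk]
      apply Subtype.ext; ext r
      exact hf.counit_coringAct p.1 r
    have hex : ∀ x, ∃ z, zeta R z = f x := fun x => by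
      obtain ⟨N, hfin, hN, hv⟩ := hf.exists_stable hA ![x]
      exact ⟨_, key N hfin (projective_of_isField hA N) hN ⟨x, hv 0⟩⟩
    choose g hg using hex
    let g' : C.carrier →ₗ[k] CircCarrier R :=
      { toFun := g
        map_add' := fun x y => hinj (by rw [map_add, hg, hg, hg, map_add])
        map_smul' := fun c x => hinj (by rw [map_smul, hg, hg, map_smul]; rfl) }
    refine exists_circHom hinj hf g' hg fun x n x1 x2 hx => ?_
    obtain ⟨N, hfin, hN, hv⟩ := hf.exists_stable hA (Fin.cons x x1)
    have hpr := projective_of_isField hA N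
    let _ := RAct.restrict N hN
    have hgN : ∀ p : N, gmk R (ε.comp N.subtype) p = g p.1 := fun p =>
      hinj ((key N hfin hpr hN p).trans (hg _).symm)
    have hx1 : ∀ i, x1 i ∈ N := fun i => hv i.succ
    obtain ⟨m, e, e', h⟩ := exists_isDualBasis (A := A) N
    have h1 : ∀ φ : Module.Dual A N, gmk R φ ⟨x, hv 0⟩ =
        ∑ i, circL R (φ ⟨x1 i, hx1 i⟩) (g (x2 i)) := fun φ => hinj (by
      apply Subtype.ext; ext r
      have e1 : act R (⟨x, hv 0⟩ : N) r = ∑ i, (f (x2 i)).1 r • (⟨x1 i, hx1 i⟩ : N) := by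
        apply Subtype.ext
        rw [Submodule.coe_sum]
        exact hf.coringAct_apply hx r
      rw [zeta_gmk, mcoeff_apply, e1, map_sum, map_sum, ← Submodule.subtype_apply, map_sum,
        LinearMap.sum_apply]
      refine Finset.sum_congr rfl fun i _ => ?_
      rw [Submodule.subtype_apply, map_smul, smul_eq_mul, mul_comm, ← hg (x2 i)]
      exact ((zetaProp_zeta R).map_l _ (g (x2 i)) r).symm)
    change circComul R (g x) = _
    rw [← hgN ⟨x, hv 0⟩, circComul_gmk R h]
    simp only [h1, bt_sum_right]
    rw [Finset.sum_comm]
    refine Finset.sum_congr rfl fun i _ => ?_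
    simp only [← bt_bal, ← bt_sum_left]
    congr 1
    simp only [circR_gmk]
    rw [← gmk_sum_right, h]
    exact hgN ⟨x1 i, hx1 i⟩
  uniq _ := circHom_ext (zeta_injective_of_isField hA)

end FieldBase

/-! ### The comparison with the finite dual -/

theorem CHopf.isIso_of_inverse {H K : CHopf k A} (g : H ⟶ K) (g' : K.coring ⟶ H.coring)
    (h1 : g.toCoringHom ≫ g' = 𝟙 _) (h2 : g' ≫ g.toCoringHom = 𝟙 _) : IsIso g := by
  have e1 : ∀ x, g'.toLin (g.toCoringHom.toLin x) = x := fun x =>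
    congrArg (fun f : H.coring ⟶ H.coring => f.toLin x) h1
  have e2 : ∀ x, g.toCoringHom.toLin (g'.toLin x) = x := fun x =>
    congrArg (fun f : K.coring ⟶ K.coring => f.toLin x) h2
  have hinj : Function.Injective g.toCoringHom.toLin := fun x y h => by rw [← e1 x, h, e1]
  exact ⟨⟨g', hinj (by rw [e2, g.map_one]), fun x y => hinj (by rw [e2, g.map_mul, e2, e2]),
    fun x => hinj (by rw [e2, g.map_S, e2])⟩, CHopf.Hom.ext h1, CHopf.Hom.ext h2⟩

/-- A morphism between Hopf algebroids which are universal over `R^*` is an isomorphism. -/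
theorem IsUniv.isIso {R : ARing k A} {H K : CHopf k A} {ζ : H.coring.carrier →ₗ[k] R.RDual}
    {ξ : K.coring.carrier →ₗ[k] R.RDual} (hH : IsUniv H.coring ζ) (hK : IsUniv K.coring ξ)
    (g : H ⟶ K) (hg : ∀ x, ξ (g.toCoringHom.toLin x) = ζ x) : IsIso g := by
  obtain ⟨g', hg'⟩ := hH.exists_hom _ ξ hK.zeta
  exact CHopf.isIso_of_inverse g g'
    (hH.uniq _ _ _ fun x => (hg' _).trans (hg x)) (hK.uniq _ _ _ fun x => (hg _).trans (hg' x))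

end HAlgd

end

open HAlgd in
theorem mainTheorem2 (k A : Type u) [Field k] [CommRing A] [Algebra k A] :
    -- the functor `^*(-) : Corings_A^op → Rings_A` has a left adjoint
    (ldualFunctor k A).IsRightAdjoint ∧
    ∀ (L : ARing k A ⥤ (ACoring k A)ᵒᵖ) (adj : L ⊣ ldualFunctor k A),
      ∃ (h : ∀ U : CCHopf k A, HopfStr (bullet L U.toARing))
        (F : (CCHopf k A)ᵒᵖ ⥤ CHopf k A),
        -- the left adjoint induces a functor to commutative Hopf algebroids
        (∀ U : CCHopf k A, F.obj (op U) = ⟨bullet L U.toARing, h U⟩) ∧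
        F ⋙ CHopf.forgetCoring k A = (CCHopf.forgetRing k A).op ⋙ L.leftOp ∧
        ∀ U : CCHopf k A,
          -- the structure is determined by the relations
          ZetaProp (xi adj U.toARing) ∧
          DualRel U (xi adj U.toARing) (h U) ∧
          (∀ h' : HopfStr (bullet L U.toARing), DualRel U (xi adj U.toARing) h' → h' = h U) ∧
          -- the universal property
          (∀ (H : CHopf k A) (f : H.coring.carrier →ₗ[k] U.RDual),
            U.IsAlgMap H.str.toAlgStr f → ZetaProp f →
            ∃ g : H ⟶ ⟨bullet L U.toARing, h U⟩,
              (∀ x, xi adj U.toARing (g.toCoringHom.toLin x) = f x) ∧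
              ∀ g' : H.coring ⟶ bullet L U.toARing,
                (∀ x, xi adj U.toARing (g'.toLin x) = f x) → g' = g.toCoringHom) ∧
          -- the comparison with the Tannakian dual
          ∃ (c : CoringStr (circ U.toARing)) (H : HopfStr ⟨circ U.toARing, c⟩),
            IsTannaka U c H ∧
            U.IsAlgMap H.toAlgStr (zeta U.toARing) ∧
            ZetaProp (C := ⟨circ U.toARing, c⟩) (zeta U.toARing) ∧
            ∃ ζhat : (⟨⟨circ U.toARing, c⟩, H⟩ : CHopf k A) ⟶ ⟨bullet L U.toARing, h U⟩,
              (∀ x, xi adj U.toARing (ζhat.toCoringHom.toLin x) = zeta U.toARing x) ∧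
              (∀ g' : (⟨circ U.toARing, c⟩ : ACoring k A) ⟶ bullet L U.toARing,
                (∀ x, xi adj U.toARing (g'.toLin x) = zeta U.toARing x) →
                  g' = ζhat.toCoringHom) ∧
              (IsField A → IsIso ζhat) ∧
              (IsFGP U.r → IsIso ζhat) := by
  refine ⟨ldualFunctor_isRightAdjoint, fun L adj => ?_⟩
  have hT := fun U : CCHopf k A => isUniv_bullet adj U.toARing
  choose h hh using fun U => (hT U).exists_hopf
  refine ⟨h, bulletFunctor adj h hh, fun _ => rfl, bulletFunctor_forget adj h hh, fun U =>
    ⟨(hT U).zeta, hh U, fun h' hh' => (hT U).hopf_unique (hh U) hh',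
      (hT U).existsUnique_chopfHom (hh U), circCoring U.toARing, circHopf U, isTannaka_circ U,
      isAlgMap_zeta U, zetaProp_zeta U.toARing, ?_⟩⟩
  obtain ⟨g, hg, hu⟩ := (hT U).existsUnique_chopfHom (hh U) ⟨circC U.toARing, circHopf U⟩ _
    (isAlgMap_zeta U) (zetaProp_zeta U.toARing)
  refine ⟨g, hg, hu, fun hA => (isUniv_circ_of_isField hA).isIso (hT U) g hg, fun hU => ?_⟩
  have : Module.Finite A U.carrier := hU.1
  have : Module.Projective A U.carrier := hU.2
  exact (isUniv_circ_of_finite U.toARing).isIso (hT U) g hg
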